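/- Let $q\in\mathbb{C}\setminus\{0\}$ be not a root of unity (in particular, $q$ may be any transcendental number), and fix $s=q^{1/2}$. Let $\mathcal{A}=\mathcal{O}(\mathrm{SL}_q(2))$ be the coordinate Hopf algebra with generators $u^i_j$ ($i,j=1,2$), relations $ab=q\,ba$, $ac=q\,ca$, $bd=q\,db$, $cd=q\,dc$, $bc=cb$, $ad=1+q\,bc$, $da=1+q^{-1}bc$ (where $a=u^1_1,\ b=u^1_2,\ c=u^2_1,\ d=u^2_2$), coproduct $\Delta(u^i_j)=\sum_k u^i_k\otimes u^k_j$, counit $\varepsilon(u^i_j)=\delta_{ij}$, and antipode $S(a)=d$, $S(b)=-q^{-1}b$, $S(c)=-qc$, $S(d)=a$. In the convolution algebra of linear functionals on $\mathcal{A}$, with unit $1=\varepsilon$, let $f_\mu$ ($\mu\in\mathbb{C}\setminus\{0\}$) be the character with matrix $(f_\mu(u^i_j))=\mathrm{diag}(\mu^{-1},\mu)$, put $K=f_{s}$ and $\varepsilon_-=f_{-1}$, and let $E,F$ be the functionals with $E(xy)=E(x)K(y)+K^{-1}(x)E(y)$, $F(xy)=F(x)K(y)+K^{-1}(x)F(y)$,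 whose only nonzero values on the generators are $E(u^2_1)=1$ and $F(u^1_2)=1$. A first order differential calculus over $\mathcal{A}$ is an $\mathcal{A}$-bimodule $\Gamma$ with a linear map $\mathrm{d}:\mathcal{A}\to\Gamma$ such that $\mathrm{d}(xy)=(\mathrm{d}x)y+x\,\mathrm{d}y$ and $\Gamma=\mathrm{Lin}\{x\,\mathrm{d}y\}$. It is left-covariant if there is a linear map $\Delta_L:\Gamma\to\mathcal{A}\otimes\Gamma$ with $\Delta_L(x(\mathrm{d}y)z)=\Delta(x)\,(\mathrm{id}\otimes\mathrm{d})\Delta(y)\,\Delta(z)$. Put $\omega(x)=S(x_{(1)})\mathrm{d}x_{(2)}$; the quantum tangent space of $\Gamma$ is $\mathcal{X}_\Gamma=\{\varphi\circ\omega\mid\varphi:\Gamma\to\mathbb{C}\text{ linear}\}$, and $\bar{\mathcal{X}}_\Gamma=\mathcal{X}_\Gamma\oplus\mathbb{C}\varepsilon$. Let $\Gamma$ be one of the following eleven left-covariant first order differential calculi, that is, let $\bar{\mathcal{X}}_\Gamma$ be the linear span of one of the sets 1. $\{FK^2E+\tfrac{q^5}{(q^2-1)^2}K^4,\ FK,\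 KE,\ 1\}$, 2. $\{FK^5,\ KE,\ K^4,\ 1\}$, 3. $\{FK^{-3},\ KE,\ K^{-4},\ 1\}$, 4. $\{FK^{-1},\ K^{-1}E,\ K^{-2},\ 1\}$, 5. $\{F\varepsilon_-K^{-1},\ \varepsilon_-K^{-1}E,\ \varepsilon_-K^{-2},\ 1\}$, 6. $\{FK^{-3},\ K^{-3}E,\ K^{-4},\ 1\}$, 7. $\{FK,\ K^5E,\ K^4,\ 1\}$, 8. $\{FK,\ K^{-3}E,\ K^{-4},\ 1\}$, 9. $\{FK,\ KE,\ K^4,\ 1\}$, 10. $\{FK,\ KE,\ K^2,\ 1\}$, 11. $\{FK,\ KE,\ \varepsilon_-K^2,\ 1\}$. Let $\Gamma^\wedge=\bigoplus_{n\ge 0}\Gamma^{\wedge n}$ be the universal differential calculus generated by $\Gamma$: the quotient of the tensor algebra $\mathcal{A}\oplus\Gamma\oplus(\Gamma\otimes_{\mathcal{A}}\Gamma)\oplus\cdots$ by the two-sided ideal generated by all $\sum_i\mathrm{d}x_i\otimes_{\mathcal{A}}\mathrm{d}y_i$ with $\sum_i x_i\,\mathrm{d}y_i=0$ in $\Gamma$,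 with the unique differential of degree one that extends $\mathrm{d}$, satisfies the graded Leibniz rule and squares to zero. Then $\Gamma^{\wedge n}=0$ for all $n>3$, and the cohomology spaces of the complex $$0\to\mathcal{A}\xrightarrow{\mathrm{d}}\Gamma\xrightarrow{\mathrm{d}}\Gamma^{\wedge 2}\xrightarrow{\mathrm{d}}\Gamma^{\wedge 3}\to 0$$ are $H^0\cong\mathbb{C}$, $H^1=0$, $H^2=0$, $H^3\cong\mathbb{C}$. -/

import Mathlib

set_option linter.unusedSectionVars false
set_option linter.unusedSimpArgs false

open scoped TensorProduct

/-- The defining relations of the coordinate algebra of the quantum group `SL_q(2)` for a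
`2 × 2` array `u` of elements of an algebra (`u i j` is the entry in row `i`, column `j`):
the `q`-commutation relations and quantum determinant one. -/
structure IsQuantumSL2Matrix (q : ℂˣ) {B : Type*} [Ring B] [Algebra ℂ B]
    (u : Fin 2 → Fin 2 → B) : Prop where
  ab : u 0 0 * u 0 1 = (q : ℂ) • (u 0 1 * u 0 0)
  ac : u 0 0 * u 1 0 = (q : ℂ) • (u 1 0 * u 0 0)
  bd : u 0 1 * u 1 1 = (q : ℂ) • (u 1 1 * u 0 1)
  cd : u 1 0 * u 1 1 = (q : ℂ) • (u 1 1 * u 1 0)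
  bc : u 0 1 * u 1 0 = u 1 0 * u 0 1
  ad : u 0 0 * u 1 1 = 1 + (q : ℂ) • (u 0 1 * u 1 0)
  da : u 1 1 * u 0 0 = 1 + (q : ℂ)⁻¹ • (u 0 1 * u 1 0)

/-- The relations imposed on the free algebra on four generators. -/
inductive OSLq2.Rel (q : ℂˣ) :
    FreeAlgebra ℂ (Fin 2 × Fin 2) → FreeAlgebra ℂ (Fin 2 × Fin 2) → Prop
  | ab : Rel q (.ι ℂ (0, 0) * .ι ℂ (0, 1)) ((q : ℂ) • (.ι ℂ (0, 1) * .ι ℂ (0, 0)))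
  | ac : Rel q (.ι ℂ (0, 0) * .ι ℂ (1, 0)) ((q : ℂ) • (.ι ℂ (1, 0) * .ι ℂ (0, 0)))
  | bd : Rel q (.ι ℂ (0, 1) * .ι ℂ (1, 1)) ((q : ℂ) • (.ι ℂ (1, 1) * .ι ℂ (0, 1)))
  | cd : Rel q (.ι ℂ (1, 0) * .ι ℂ (1, 1)) ((q : ℂ) • (.ι ℂ (1, 1) * .ι ℂ (1, 0)))
  | bc : Rel q (.ι ℂ (0, 1) * .ι ℂ (1, 0)) (.ι ℂ (1, 0) * .ι ℂ (0, 1))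
  | ad : Rel q (.ι ℂ (0, 0) * .ι ℂ (1, 1)) (1 + (q : ℂ) • (.ι ℂ (0, 1) * .ι ℂ (1, 0)))
  | da : Rel q (.ι ℂ (1, 1) * .ι ℂ (0, 0)) (1 + (q : ℂ)⁻¹ • (.ι ℂ (0, 1) * .ι ℂ (1, 0)))

/-- The coordinate algebra `O(SL_q(2))`, by generators and relations. -/
def OSLq2 (q : ℂˣ) : Type := RingQuot (OSLq2.Rel q)

namespace OSLq2

noncomputable instance (q : ℂˣ) : Ring (OSLq2 q) := inferInstanceAs (Ring (RingQuot _))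

noncomputable instance (q : ℂˣ) : Algebra ℂ (OSLq2 q) :=
  inferInstanceAs (Algebra ℂ (RingQuot _))

/-- The generators: `u i j` is the matrix element in row `i` and column `j`. -/
noncomputable def u {q : ℂˣ} (i j : Fin 2) : OSLq2 q :=
  RingQuot.mkAlgHom ℂ (Rel q) (FreeAlgebra.ι ℂ (i, j))

theorem isQuantumSL2Matrix_u (q : ℂˣ) : IsQuantumSL2Matrix q (u (q := q)) where
  ab := by simpa using! RingQuot.mkAlgHom_rel ℂ (Rel.ab (q := q))
  ac := by simpa using! RingQuot.mkAlgHom_rel ℂ (Rel.ac (q := q))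
  bd := by simpa using! RingQuot.mkAlgHom_rel ℂ (Rel.bd (q := q))
  cd := by simpa using! RingQuot.mkAlgHom_rel ℂ (Rel.cd (q := q))
  bc := by simpa using! RingQuot.mkAlgHom_rel ℂ (Rel.bc (q := q))
  ad := by simpa using! RingQuot.mkAlgHom_rel ℂ (Rel.ad (q := q))
  da := by simpa using! RingQuot.mkAlgHom_rel ℂ (Rel.da (q := q))

section lift

variable {q : ℂˣ} {B : Type*} [Ring B] [Algebra ℂ B]

/-- The universal property of `O(SL_q(2))`. -/
noncomputable def lift (v : Fin 2 → Fin 2 → B) (hv : IsQuantumSL2Matrix q v) :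
    OSLq2 q →ₐ[ℂ] B :=
  RingQuot.liftAlgHom ℂ ⟨FreeAlgebra.lift ℂ fun p ↦ v p.1 p.2, by
    intro x y h
    cases h
    · simpa using hv.ab
    · simpa using hv.ac
    · simpa using hv.bd
    · simpa using hv.cd
    · simpa using hv.bc
    · simpa using hv.ad
    · simpa using hv.da⟩

theorem lift_u (v : Fin 2 → Fin 2 → B) (hv : IsQuantumSL2Matrix q v) (i j : Fin 2) :
    lift v hv (u i j) = v i j := by
  refine (RingQuot.liftAlgHom_mkAlgHom_apply ℂ _ _ _).trans ?_
  simp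

theorem algHom_ext {f g : OSLq2 q →ₐ[ℂ] B} (h : ∀ i j, f (u i j) = g (u i j)) : f = g := by
  refine RingQuot.ringQuot_ext' ℂ (s := Rel q) f g (FreeAlgebra.hom_ext ?_)
  funext p
  exact h p.1 p.2

end lift

/-- The coproduct `u i j ↦ ∑ k, u i k ⊗ u k j`. -/
noncomputable def comulHom (q : ℂˣ) : OSLq2 q →ₐ[ℂ] OSLq2 q ⊗[ℂ] OSLq2 q :=
  lift (fun i j ↦ ∑ k, u i k ⊗ₜ[ℂ] u k j) <| by
    have h := isQuantumSL2Matrix_u q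
    have hq : (q : ℂ) ≠ 0 := q.ne_zero
    constructor <;>
    · simp only [Fin.sum_univ_two, mul_add, add_mul, Algebra.TensorProduct.tmul_mul_tmul,
        h.ab, h.ac, h.bd, h.cd, h.bc, h.ad, h.da, TensorProduct.tmul_add, TensorProduct.add_tmul,
        ← TensorProduct.smul_tmul', TensorProduct.tmul_smul, smul_add, smul_smul,
        Algebra.TensorProduct.one_def]
      match_scalars <;> first | ring1 | field_simp

/-- The counit `u i j ↦ δ i j`. -/
noncomputable def counitHom (q : ℂˣ) : OSLq2 q →ₐ[ℂ] ℂ :=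
  lift (fun i j ↦ if i = j then 1 else 0) <| by
    constructor <;> simp

noncomputable instance (q : ℂˣ) : Bialgebra ℂ (OSLq2 q) :=
  Bialgebra.ofAlgHom (comulHom q) (counitHom q)
    (algHom_ext fun i j ↦ by
      simp [comulHom, lift_u, TensorProduct.tmul_add, TensorProduct.add_tmul]
      abel)
    (algHom_ext fun i j ↦ by
      fin_cases i <;> fin_cases j <;> simp [comulHom, counitHom, lift_u])
    (algHom_ext fun i j ↦ by
      fin_cases i <;> fin_cases j <;> simp [comulHom, counitHom, lift_u])

/-- The antipode, as an algebra homomorphism into the opposite algebra. -/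
noncomputable def antipodeHom (q : ℂˣ) : OSLq2 q →ₐ[ℂ] (OSLq2 q)ᵐᵒᵖ :=
  lift (fun i j ↦ MulOpposite.op
      (!![u 1 1, -(q : ℂ)⁻¹ • u 0 1; -(q : ℂ) • u 1 0, u 0 0] i j)) <| by
    have h := isQuantumSL2Matrix_u q
    have hq : (q : ℂ) ≠ 0 := q.ne_zero
    constructor <;> apply MulOpposite.unop_injective <;>
      simp [h.ab, h.ac, h.bd, h.cd, h.bc, h.ad, h.da, smul_smul, hq]

/-- The antipode `S(a) = d`, `S(b) = -q⁻¹ b`, `S(c) = -q c`, `S(d) = a`, extended as an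
anti-homomorphism, where `a, b, c, d` are the generators `u i j` in reading order. -/
noncomputable def antipodeLin (q : ℂˣ) : OSLq2 q →ₗ[ℂ] OSLq2 q :=
  (MulOpposite.opLinearEquiv ℂ).symm.toLinearMap ∘ₗ (antipodeHom q).toLinearMap

theorem antipodeLin_mul {q : ℂˣ} (x y : OSLq2 q) :
    antipodeLin q (x * y) = antipodeLin q y * antipodeLin q x := by
  simp [antipodeLin]

theorem antipodeLin_u {q : ℂˣ} (i j : Fin 2) :
    antipodeLin q (u i j) = !![u 1 1, -(q : ℂ)⁻¹ • u 0 1; -(q : ℂ) • u 1 0, u 0 0] i j := by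
  simp [antipodeLin, antipodeHom, lift_u]

/-- Induction over products of generators. -/
theorem induction {q : ℂˣ} {p : OSLq2 q → Prop} (hu : ∀ i j, p (u i j))
    (hc : ∀ r, p (algebraMap ℂ _ r)) (hm : ∀ x y, p x → p y → p (x * y))
    (ha : ∀ x y, p x → p y → p (x + y)) (x : OSLq2 q) : p x := by
  obtain ⟨x, rfl⟩ := RingQuot.mkAlgHom_surjective ℂ (Rel q) x
  induction x using FreeAlgebra.induction with
  | grade0 r => simpa using! hc r
  | grade1 x => exact hu x.1 x.2
  | mul a b h1 h2 => simpa using! hm _ _ h1 h2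
  | add a b h1 h2 => simpa using! ha _ _ h1 h2

theorem comul_u {q : ℂˣ} (i j : Fin 2) :
    Coalgebra.comul (R := ℂ) (u (q := q) i j) = ∑ k, u i k ⊗ₜ[ℂ] u k j :=
  lift_u _ _ i j

theorem counit_u {q : ℂˣ} (i j : Fin 2) :
    Coalgebra.counit (R := ℂ) (u (q := q) i j) = if i = j then 1 else 0 :=
  lift_u _ _ i j

theorem antipode_left {q : ℂˣ} (x : OSLq2 q) :
    LinearMap.mul' ℂ _ ((antipodeLin q).rTensor _ (Coalgebra.comul x)) =
      algebraMap ℂ _ (Coalgebra.counit x) := by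
  have key (s t : OSLq2 q ⊗[ℂ] OSLq2 q) (r : ℂ)
      (hs : LinearMap.mul' ℂ _ ((antipodeLin q).rTensor _ s) = algebraMap ℂ _ r) :
      LinearMap.mul' ℂ _ ((antipodeLin q).rTensor _ (s * t)) =
        r • LinearMap.mul' ℂ _ ((antipodeLin q).rTensor _ t) := by
    induction t with
    | zero => simp
    | add a b ha hb => simp [mul_add, ha, hb]
    | tmul y z =>
      have : LinearMap.mul' ℂ _ ((antipodeLin q).rTensor _ (s * y ⊗ₜ[ℂ] z)) =
          antipodeLin q y * LinearMap.mul' ℂ _ ((antipodeLin q).rTensor _ s) * z := by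
        clear hs
        induction s with
        | zero => simp
        | add a b ha hb => simp [add_mul, mul_add, ha, hb]
        | tmul v w => simp [antipodeLin_mul, mul_assoc]
      rw [this, hs, ← Algebra.commutes, mul_assoc, Algebra.smul_def]
      simp
  induction x using induction with
  | hu i j =>
    have h := isQuantumSL2Matrix_u q
    have hq : (q : ℂ) ≠ 0 := q.ne_zero
    fin_cases i <;> fin_cases j <;>
      simp [comul_u, counit_u, antipodeLin_u, h.ab, h.ac, h.bd, h.cd, h.bc, h.ad, h.da,
        smul_smul, hq]
  | hc r => simp [Algebra.TensorProduct.algebraMap_apply, antipodeLin, Bialgebra.comul_algebraMap]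
  | hm x y hx hy =>
    rw [Bialgebra.comul_mul, key _ _ _ hx, hy, Bialgebra.counit_mul, map_mul, Algebra.smul_def]
  | ha x y hx hy => simp [hx, hy]

theorem antipode_right {q : ℂˣ} (x : OSLq2 q) :
    LinearMap.mul' ℂ _ ((antipodeLin q).lTensor _ (Coalgebra.comul x)) =
      algebraMap ℂ _ (Coalgebra.counit x) := by
  have key (s t : OSLq2 q ⊗[ℂ] OSLq2 q) (r : ℂ)
      (ht : LinearMap.mul' ℂ _ ((antipodeLin q).lTensor _ t) = algebraMap ℂ _ r) :
      LinearMap.mul' ℂ _ ((antipodeLin q).lTensor _ (s * t)) =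
        r • LinearMap.mul' ℂ _ ((antipodeLin q).lTensor _ s) := by
    induction s with
    | zero => simp
    | add a b ha hb => simp [add_mul, ha, hb]
    | tmul y z =>
      have : LinearMap.mul' ℂ _ ((antipodeLin q).lTensor _ (y ⊗ₜ[ℂ] z * t)) =
          y * LinearMap.mul' ℂ _ ((antipodeLin q).lTensor _ t) * antipodeLin q z := by
        clear ht
        induction t with
        | zero => simp
        | add a b ha hb => simp [add_mul, mul_add, ha, hb]
        | tmul v w => simp [antipodeLin_mul, mul_assoc]
      rw [this, ht, ← Algebra.commutes, mul_assoc, Algebra.smul_def]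
      simp
  induction x using induction with
  | hu i j =>
    have h := isQuantumSL2Matrix_u q
    have hq : (q : ℂ) ≠ 0 := q.ne_zero
    fin_cases i <;> fin_cases j <;>
      simp [comul_u, counit_u, antipodeLin_u, h.ab, h.ac, h.bd, h.cd, h.bc, h.ad, h.da,
        smul_smul, hq]
  | hc r => simp [Algebra.TensorProduct.algebraMap_apply, antipodeLin, Bialgebra.comul_algebraMap]
  | hm x y hx hy =>
    rw [Bialgebra.comul_mul, key _ _ _ hy, hx, Bialgebra.counit_mul, map_mul, Algebra.smul_def,
      Algebra.commutes]
  | ha x y hx hy => simp [hx, hy]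

noncomputable instance (q : ℂˣ) : HopfAlgebra ℂ (OSLq2 q) where
  antipode := antipodeLin q
  mul_antipode_rTensor_comul := LinearMap.ext antipode_left
  mul_antipode_lTensor_comul := LinearMap.ext antipode_right

end OSLq2

namespace OSLq2

/-- The convolution algebra of linear functionals on `O(SL_q(2))`:
`(f * g) a = f a₍₁₎ * g a₍₂₎`, with the counit as unit. -/
abbrev Functional (q : ℂˣ) : Type := WithConv (OSLq2 q →ₗ[ℂ] ℂ)

/-- The character `f_μ` of `O(SL_q(2))` with `f_μ (u i j)` the matrix `diag (μ⁻¹, μ)`. -/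
noncomputable def char {q : ℂˣ} (μ : ℂˣ) : OSLq2 q →ₐ[ℂ] ℂ :=
  lift (fun i j ↦ !![(μ : ℂ)⁻¹, 0; 0, (μ : ℂ)] i j) <| by
    constructor <;> simp

/-- The character `f_μ` as an element of the convolution algebra; it is group-like. -/
noncomputable def f {q : ℂˣ} (μ : ℂˣ) : Functional q := .toConv (char μ).toLinearMap

/-- The representation of `O(SL_q(2))` by upper triangular matrices whose diagonal entries
are the characters `K⁻¹` and `K`, where `K = f_s`, and whose upper right entry is the functional
with matrix `e` on the generators. -/
noncomputable def skewHom {q : ℂˣ} (s : ℂˣ) (hs : s ^ 2 = q) (e : Matrix (Fin 2) (Fin 2) ℂ)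
    (he : e 0 0 = 0 ∧ e 1 1 = 0) : OSLq2 q →ₐ[ℂ] Matrix (Fin 2) (Fin 2) ℂ :=
  lift (fun i j ↦ !![char (q := q) s⁻¹ (u i j), e i j; 0, char (q := q) s (u i j)]) <| by
    have hs' : (q : ℂ) = s ^ 2 := by rw [← hs]; simp
    have hs0 : (s : ℂ) ≠ 0 := s.ne_zero
    obtain ⟨h0, h1⟩ := he
    constructor <;>
    · ext i j
      fin_cases i <;> fin_cases j <;>
        simp [char, lift_u, hs', h0, h1, Matrix.mul_apply] <;> field_simp

/-- The functional `E`, determined by its values on the generators, `E (u i j) = 1` for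
`(i, j)` the lower left position and `0` otherwise, and by
`Δ E = E ⊗ K + K⁻¹ ⊗ E`, i.e. `E (x y) = E x * K y + K⁻¹ x * E y`, where `K = f_s`, `s ^ 2 = q`. -/
noncomputable def E {q : ℂˣ} (s : ℂˣ) (hs : s ^ 2 = q) : Functional q :=
  .toConv (Matrix.entryLinearMap ℂ ℂ 0 1 ∘ₗ
    (skewHom s hs !![0, 0; 1, 0] (by simp)).toLinearMap)

/-- The functional `F`, determined by its values on the generators, `F (u i j) = 1` for
`(i, j)` the upper right position and `0` otherwise, and by
`Δ F = F ⊗ K + K⁻¹ ⊗ F`, i.e. `F (x y) = F x * K y + K⁻¹ x * F y`, where `K = f_s`, `s ^ 2 = q`. -/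
noncomputable def F {q : ℂˣ} (s : ℂˣ) (hs : s ^ 2 = q) : Functional q :=
  .toConv (Matrix.entryLinearMap ℂ ℂ 0 1 ∘ₗ
    (skewHom s hs !![0, 1; 0, 0] (by simp)).toLinearMap)

/-- The integer power `K ^ n` of `K = f_s`. -/
noncomputable def K {q : ℂˣ} (s : ℂˣ) (n : ℤ) : Functional q := f (s ^ n)

/-- The functional `ε₋ = f_{-1}`. -/
noncomputable def εm {q : ℂˣ} : Functional q := f (-1)

theorem skewHom_apply {q : ℂˣ} (s : ℂˣ) (hs : s ^ 2 = q) (e : Matrix (Fin 2) (Fin 2) ℂ)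
    (he : e 0 0 = 0 ∧ e 1 1 = 0) (x : OSLq2 q) :
    skewHom s hs e he x 1 0 = 0 ∧ skewHom s hs e he x 0 0 = char s⁻¹ x ∧
      skewHom s hs e he x 1 1 = char s x := by
  induction x using induction with
  | hu i j => simp [skewHom, lift_u]
  | hc r => simp [Matrix.algebraMap_matrix_apply]
  | hm x y hx hy => simp [Matrix.mul_apply, hx, hy]
  | ha x y hx hy => simp [hx, hy]

theorem E_u {q : ℂˣ} (s : ℂˣ) (hs : s ^ 2 = q) (i j : Fin 2) :
    E s hs (u i j) = !![0, 0; 1, 0] i j := by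
  simp [E, skewHom, lift_u]

theorem F_u {q : ℂˣ} (s : ℂˣ) (hs : s ^ 2 = q) (i j : Fin 2) :
    F s hs (u i j) = !![0, 1; 0, 0] i j := by
  simp [F, skewHom, lift_u]

theorem E_mul {q : ℂˣ} (s : ℂˣ) (hs : s ^ 2 = q) (x y : OSLq2 q) :
    E s hs (x * y) = E s hs x * char s y + char s⁻¹ x * E s hs y := by
  simp [E, Matrix.mul_apply, skewHom_apply, add_comm]

theorem F_mul {q : ℂˣ} (s : ℂˣ) (hs : s ^ 2 = q) (x y : OSLq2 q) :
    F s hs (x * y) = F s hs x * char s y + char s⁻¹ x * F s hs y := by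
  simp [F, Matrix.mul_apply, skewHom_apply, add_comm]

/-- The eleven four-dimensional unital right coideals of the dual of `O(SL_q(2))`, where
`K = f_s`, `s ^ 2 = q`; the unit `1` is the counit. -/
noncomputable def coideal {q : ℂˣ} (s : ℂˣ) (hs : s ^ 2 = q) :
    Fin 11 → Submodule ℂ (Functional q) :=
  let E : Functional q := E s hs
  let F : Functional q := F s hs
  let K : ℤ → Functional q := K s
  ![Submodule.span ℂ
      {F * K 2 * E + ((q : ℂ) ^ 5 / ((q : ℂ) ^ 2 - 1) ^ 2) • K 4, F * K 1, K 1 * E, 1},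
    Submodule.span ℂ {F * K 5, K 1 * E, K 4, 1},
    Submodule.span ℂ {F * K (-3), K 1 * E, K (-4), 1},
    Submodule.span ℂ {F * K (-1), K (-1) * E, K (-2), 1},
    Submodule.span ℂ {F * εm * K (-1), εm * K (-1) * E, εm * K (-2), 1},
    Submodule.span ℂ {F * K (-3), K (-3) * E, K (-4), 1},
    Submodule.span ℂ {F * K 1, K 5 * E, K 4, 1},
    Submodule.span ℂ {F * K 1, K (-3) * E, K (-4), 1},
    Submodule.span ℂ {F * K 1, K 1 * E, K 4, 1},
    Submodule.span ℂ {F * K 1, K 1 * E, K 2, 1},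
    Submodule.span ℂ {F * K 1, K 1 * E, εm * K 2, 1}]

end OSLq2

universe u v w

/-- A first order differential calculus over an algebra `A`: an `A`-bimodule `Γ` with a linear
map `d : A → Γ` satisfying the Leibniz rule such that `Γ` is spanned by the elements `a d(b)`.
The right action of `a` is the action of `MulOpposite.op a`. -/
structure FODC (k : Type u) (A : Type v) (Γ : Type w) [Field k] [Ring A] [Algebra k A] [AddCommGroup Γ] [Module k Γ]
    [Module A Γ] [Module Aᵐᵒᵖ Γ] where
  d : A →ₗ[k] Γ
  leibniz : ∀ a b : A, d (a * b) = MulOpposite.op b • d a + a • d b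
  span_eq_top : Submodule.span k {ρ : Γ | ∃ a b : A, ρ = a • d b} = ⊤

namespace FODC

variable {k : Type u} {A : Type v} {Γ : Type w} [Field k] [Ring A] [AddCommGroup Γ] [Module k Γ] [Module A Γ]
  [Module Aᵐᵒᵖ Γ]

section Covariant

variable [HopfAlgebra k A] [IsScalarTower k A Γ] [IsScalarTower k Aᵐᵒᵖ Γ]

/-- The action of `A ⊗ A` on `A ⊗ Γ` from the left, `(a ⊗ b) · (c ⊗ ρ) = a c ⊗ b ρ`. -/
noncomputable def leftMul (k A Γ : Type*) [Field k] [Ring A] [AddCommGroup Γ] [Module k Γ]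
    [Module A Γ] [HopfAlgebra k A] [IsScalarTower k A Γ] :
    A ⊗[k] A →ₗ[k] A ⊗[k] Γ →ₗ[k] A ⊗[k] Γ :=
  TensorProduct.map₂ (LinearMap.mul k A) (LinearMap.mk₂ k (fun (a : A) (ρ : Γ) ↦ a • ρ)
    add_smul (fun c a ρ ↦ smul_assoc c a ρ) smul_add (fun c a ρ ↦ smul_algebra_smul_comm c a ρ))

/-- The action of `A ⊗ A` on `A ⊗ Γ` from the right, `(a ⊗ ρ) · (b ⊗ c) = a b ⊗ ρ c`
(the element of `A ⊗ A` is the first argument). -/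
noncomputable def rightMul (k A Γ : Type*) [Field k] [Ring A] [AddCommGroup Γ] [Module k Γ]
    [Module Aᵐᵒᵖ Γ] [HopfAlgebra k A] [IsScalarTower k Aᵐᵒᵖ Γ] :
    A ⊗[k] A →ₗ[k] A ⊗[k] Γ →ₗ[k] A ⊗[k] Γ :=
  TensorProduct.map₂ (LinearMap.mul k A).flip
    (LinearMap.mk₂ k (fun (a : A) (ρ : Γ) ↦ MulOpposite.op a • ρ)
      (fun a b ρ ↦ by rw [MulOpposite.op_add, add_smul])
      (fun c a ρ ↦ by rw [MulOpposite.op_smul, smul_assoc]) (fun _ ↦ smul_add _)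
      (fun c a ρ ↦ smul_algebra_smul_comm c (MulOpposite.op a) ρ))

/-- Left-covariance: there is a linear map `Δ_L : Γ → A ⊗ Γ` with
`Δ_L (a d(b) c) = Δ(a) · (id ⊗ d)Δ(b) · Δ(c)`. -/
def IsLeftCovariant (C : FODC k A Γ) : Prop :=
  ∃ ΔL : Γ →ₗ[k] A ⊗[k] Γ, ∀ a b c : A,
    ΔL (MulOpposite.op c • a • C.d b) =
      rightMul k A Γ (Coalgebra.comul c) (leftMul k A Γ (Coalgebra.comul a)
        (C.d.lTensor A (Coalgebra.comul b)))

/-- The map `ω : A → Γ`, `ω(a) = S(a₍₁₎) d(a₍₂₎)`; its values are the left-invariant one-forms. -/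
noncomputable def ω (C : FODC k A Γ) : A →ₗ[k] Γ :=
  TensorProduct.lift (LinearMap.mk₂ k (fun (a b : A) ↦ HopfAlgebra.antipode k a • C.d b)
    (by simp [add_smul]) (by simp) (by simp)
    (fun c a b ↦ by rw [map_smul, smul_algebra_smul_comm])) ∘ₗ Coalgebra.comul

/-- The quantum tangent space: the span of the functionals `X_i` in the expansion
`ω(a) = ∑ X_i(a) ω_i` with respect to a basis of left-invariant one-forms. Equivalently,
the set of all functionals `φ ∘ ω` with `φ` a linear functional. -/
def tangentSpace (C : FODC k A Γ) : Submodule k (WithConv (A →ₗ[k] k)) where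
  carrier := {X | ∃ φ : Γ →ₗ[k] k, X = .toConv (φ ∘ₗ C.ω)}
  zero_mem' := ⟨0, rfl⟩
  add_mem' := by
    rintro _ _ ⟨φ, rfl⟩ ⟨ψ, rfl⟩
    exact ⟨φ + ψ, rfl⟩
  smul_mem' := by
    rintro c _ ⟨φ, rfl⟩
    exact ⟨c • φ, rfl⟩

/-- The unital right coideal `X ⊕ k ε` belonging to the quantum tangent space `X`. -/
noncomputable def tangentCoideal (C : FODC k A Γ) : Submodule k (WithConv (A →ₗ[k] k)) :=
  C.tangentSpace ⊔ Submodule.span k {1}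

end Covariant

section Universal

variable [Algebra k A] [IsScalarTower k A Γ] [IsScalarTower k Aᵐᵒᵖ Γ]

/-- The linear map `A ⊗ A → Γ`, `a ⊗ b ↦ a d(b)`. -/
noncomputable def smulD (C : FODC k A Γ) : A ⊗[k] A →ₗ[k] Γ :=
  TensorProduct.lift (LinearMap.mk₂ k (fun (a b : A) ↦ a • C.d b)
    (by simp [add_smul]) (by simp) (by simp)
    (fun c a b ↦ by rw [map_smul, smul_algebra_smul_comm]))

@[simp]
theorem smulD_tmul (C : FODC k A Γ) (a b : A) : C.smulD (a ⊗ₜ b) = a • C.d b := rfl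

theorem smulD_surjective (C : FODC k A Γ) : Function.Surjective C.smulD := by
  rw [← LinearMap.range_eq_top, eq_top_iff, ← C.span_eq_top, Submodule.span_le]
  rintro _ ⟨a, b, rfl⟩
  exact ⟨a ⊗ₜ b, rfl⟩

theorem d_one (C : FODC k A Γ) : C.d 1 = 0 := by
  simpa using C.leibniz 1 1

/-- The relations of the universal differential calculus, imposed on the tensor algebra of the
vector space `A × Γ`. The first four relations give the tensor algebra
`A ⊕ Γ ⊕ (Γ ⊗_A Γ) ⊕ ⋯` of the `A`-bimodule `Γ`; the last one divides out the two-sided ideal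
generated by the elements `∑ d(aᵢ) ⊗_A d(bᵢ)` for which `∑ aᵢ d(bᵢ) = 0` in `Γ`. -/
inductive Rel (C : FODC k A Γ) : TensorAlgebra k (A × Γ) → TensorAlgebra k (A × Γ) → Prop
  | one : Rel C (.ι k (1, 0)) 1
  | mul (a b : A) : Rel C (.ι k (a, 0) * .ι k (b, 0)) (.ι k (a * b, 0))
  | left (a : A) (ρ : Γ) : Rel C (.ι k (a, 0) * .ι k (0, ρ)) (.ι k (0, a • ρ))
  | right (ρ : Γ) (a : A) :
      Rel C (.ι k (0, ρ) * .ι k (a, 0)) (.ι k (0, MulOpposite.op a • ρ))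
  | two (t : A ⊗[k] A) (ht : C.smulD t = 0) :
      Rel C (LinearMap.mul' k _ (TensorProduct.map (TensorAlgebra.ι k ∘ₗ .inr k A Γ ∘ₗ C.d)
        (TensorAlgebra.ι k ∘ₗ .inr k A Γ ∘ₗ C.d) t)) 0

/-- The algebra of differential forms of the universal differential calculus generated by a first
order differential calculus. -/
def Forms (C : FODC k A Γ) : Type (max u v w) := RingQuot C.Rel

noncomputable instance (C : FODC k A Γ) : Ring C.Forms := inferInstanceAs (Ring (RingQuot _))

noncomputable instance (C : FODC k A Γ) : Algebra k C.Forms :=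
  inferInstanceAs (Algebra k (RingQuot _))

variable (C : FODC k A Γ)

/-- The quotient map. -/
noncomputable def mkForms : TensorAlgebra k (A × Γ) →ₐ[k] C.Forms := RingQuot.mkAlgHom k C.Rel

/-- The inclusion of `A` as the forms of degree zero. -/
noncomputable def ofAlg : A →ₐ[k] C.Forms :=
  AlgHom.ofLinearMap (C.mkForms.toLinearMap ∘ₗ TensorAlgebra.ι k ∘ₗ .inl k A Γ)
    (by simpa using! RingQuot.mkAlgHom_rel k (Rel.one (C := C)))
    (fun a b ↦ by simpa using! (RingQuot.mkAlgHom_rel k (Rel.mul (C := C) a b)).symm)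

/-- The inclusion of `Γ` as the forms of degree one. -/
noncomputable def ofForm : Γ →ₗ[k] C.Forms :=
  C.mkForms.toLinearMap ∘ₗ TensorAlgebra.ι k ∘ₗ .inr k A Γ

theorem ofAlg_mul_ofForm (a : A) (ρ : Γ) : C.ofAlg a * C.ofForm ρ = C.ofForm (a • ρ) := by
  simpa using! RingQuot.mkAlgHom_rel k (Rel.left (C := C) a ρ)

theorem ofForm_mul_ofAlg (ρ : Γ) (a : A) :
    C.ofForm ρ * C.ofAlg a = C.ofForm (MulOpposite.op a • ρ) := by
  simpa using! RingQuot.mkAlgHom_rel k (Rel.right (C := C) ρ a)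

/-- The linear map `a ⊗ b ↦ d(a) ∧ d(b)`. -/
noncomputable def dd : A ⊗[k] A →ₗ[k] C.Forms :=
  LinearMap.mul' k _ ∘ₗ TensorProduct.map (C.ofForm ∘ₗ C.d) (C.ofForm ∘ₗ C.d)

@[simp]
theorem dd_tmul (a b : A) : C.dd (a ⊗ₜ b) = C.ofForm (C.d a) * C.ofForm (C.d b) := rfl

theorem dd_eq_zero (t : A ⊗[k] A) (ht : C.smulD t = 0) : C.dd t = 0 := by
  have key (t : A ⊗[k] A) : C.dd t = C.mkForms (LinearMap.mul' k _
      (TensorProduct.map (TensorAlgebra.ι k ∘ₗ .inr k A Γ ∘ₗ C.d)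
        (TensorAlgebra.ι k ∘ₗ .inr k A Γ ∘ₗ C.d) t)) := by
    induction t with
    | zero => simp only [map_zero]
    | tmul a b => exact (map_mul C.mkForms _ _).symm
    | add s t hs ht => simp only [map_add, hs, ht]
  have h : C.mkForms _ = C.mkForms 0 := RingQuot.mkAlgHom_rel k (Rel.two (C := C) t ht)
  rw [key, h, map_zero]

section lift

variable {B : Type*} [Ring B] [Algebra k B]

/-- The universal property of the algebra of forms. -/
noncomputable def lift (f : A →ₐ[k] B) (g : Γ →ₗ[k] B)
    (hl : ∀ a ρ, g (a • ρ) = f a * g ρ) (hr : ∀ a ρ, g (MulOpposite.op a • ρ) = g ρ * f a)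
    (h2 : ∀ t, C.smulD t = 0 →
      LinearMap.mul' k B (TensorProduct.map (g ∘ₗ C.d) (g ∘ₗ C.d) t) = 0) : C.Forms →ₐ[k] B :=
  RingQuot.liftAlgHom k ⟨TensorAlgebra.lift k (f.toLinearMap.coprod g), by
    intro x y h
    cases h with
    | one => simp
    | mul a b => simp
    | left a ρ => simp [hl]
    | right ρ a => simp [hr]
    | two t ht =>
      rw [map_zero, ← h2 t ht]
      clear ht
      induction t with
      | zero => simp
      | tmul a b => simp
      | add s t hs ht => simp only [map_add, hs, ht]⟩

variable {f : A →ₐ[k] B} {g : Γ →ₗ[k] B}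
  {hl : ∀ a ρ, g (a • ρ) = f a * g ρ} {hr : ∀ a ρ, g (MulOpposite.op a • ρ) = g ρ * f a}
  {h2 : ∀ t, C.smulD t = 0 →
      LinearMap.mul' k B (TensorProduct.map (g ∘ₗ C.d) (g ∘ₗ C.d) t) = 0}

theorem lift_ofAlg (a : A) : C.lift f g hl hr h2 (C.ofAlg a) = f a := by
  refine (RingQuot.liftAlgHom_mkAlgHom_apply k (TensorAlgebra.lift k (f.toLinearMap.coprod g))
    _ _).trans ?_
  simp

theorem lift_ofForm (ρ : Γ) : C.lift f g hl hr h2 (C.ofForm ρ) = g ρ := by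
  refine (RingQuot.liftAlgHom_mkAlgHom_apply k (TensorAlgebra.lift k (f.toLinearMap.coprod g))
    _ _).trans ?_
  simp

theorem algHom_ext {F G : C.Forms →ₐ[k] B} (h0 : ∀ a, F (C.ofAlg a) = G (C.ofAlg a))
    (h1 : ∀ ρ, F (C.ofForm ρ) = G (C.ofForm ρ)) : F = G := by
  refine RingQuot.ringQuot_ext' k (s := C.Rel) F G (TensorAlgebra.hom_ext (LinearMap.ext ?_))
  rintro ⟨a, ρ⟩
  have : ((a, ρ) : A × Γ) = (a, 0) + (0, ρ) := by simp
  rw [this, map_add, map_add]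
  exact congrArg₂ (· + ·) (h0 a) (h1 ρ)

end lift

/-- The differential on one-forms, `∑ aᵢ d(bᵢ) ↦ ∑ d(aᵢ) ∧ d(bᵢ)`. -/
noncomputable def dForm : Γ →ₗ[k] C.Forms :=
  (LinearMap.ker C.smulD).liftQ C.dd (fun t ht ↦ C.dd_eq_zero t ht) ∘ₗ
    (C.smulD.quotKerEquivOfSurjective C.smulD_surjective).symm.toLinearMap

theorem dForm_smulD (t : A ⊗[k] A) : C.dForm (C.smulD t) = C.dd t := by
  have : (C.smulD.quotKerEquivOfSurjective C.smulD_surjective).symm (C.smulD t) =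
      Submodule.Quotient.mk t := by
    rw [LinearEquiv.symm_apply_eq]
    rfl
  simp only [dForm, LinearMap.comp_apply, LinearEquiv.coe_coe, this]
  exact Submodule.liftQ_apply _ _ _

theorem dForm_smul_d (a b : A) :
    C.dForm (a • C.d b) = C.ofForm (C.d a) * C.ofForm (C.d b) :=
  C.dForm_smulD (a ⊗ₜ b)

theorem dForm_smul (a : A) (ρ : Γ) :
    C.dForm (a • ρ) = C.ofForm (C.d a) * C.ofForm ρ + C.ofAlg a * C.dForm ρ := by
  obtain ⟨t, rfl⟩ := C.smulD_surjective ρ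
  induction t with
  | zero => simp
  | add s t hs ht => simp only [map_add, smul_add, hs, ht, mul_add]; abel
  | tmul x y =>
    rw [smulD_tmul, ← mul_smul, dForm_smul_d, dForm_smul_d, C.leibniz, map_add, add_mul,
      ← ofForm_mul_ofAlg, ← ofAlg_mul_ofForm, ← ofAlg_mul_ofForm, mul_assoc, mul_assoc]

variable [SMulCommClass A Aᵐᵒᵖ Γ]

theorem dForm_op_smul (a : A) (ρ : Γ) :
    C.dForm (MulOpposite.op a • ρ) = C.dForm ρ * C.ofAlg a - C.ofForm ρ * C.ofForm (C.d a) := by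
  obtain ⟨t, rfl⟩ := C.smulD_surjective ρ
  induction t with
  | zero => simp
  | add s t hs ht => simp only [map_add, smul_add, hs, ht, add_mul]; abel
  | tmul x y =>
    have h : MulOpposite.op a • x • C.d y = x • C.d (y * a) - (x * y) • C.d a := by
      rw [C.leibniz, smul_add, mul_smul, add_sub_cancel_right,
        smul_comm x (MulOpposite.op a)]
    rw [smulD_tmul, h, map_sub, dForm_smul_d, dForm_smul_d, dForm_smul_d, C.leibniz, C.leibniz,
      map_add, map_add, mul_add, add_mul, ← ofForm_mul_ofAlg, ← ofForm_mul_ofAlg,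
      ← ofAlg_mul_ofForm, ← ofAlg_mul_ofForm]
    simp only [mul_assoc]
    abel

/-- The parity automorphism, `(-1)^m` on forms of degree `m`. -/
noncomputable def parity : C.Forms →ₐ[k] C.Forms :=
  C.lift C.ofAlg (-C.ofForm) (by simp [ofAlg_mul_ofForm]) (by simp [ofForm_mul_ofAlg]) <| by
    intro t ht
    rw [← C.dd_eq_zero t ht]
    clear ht
    induction t with
    | zero => simp
    | tmul a b => simp
    | add s t hs ht => simp only [map_add, hs, ht]

theorem parity_ofAlg (a : A) : C.parity (C.ofAlg a) = C.ofAlg a := C.lift_ofAlg a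

theorem parity_ofForm (ρ : Γ) : C.parity (C.ofForm ρ) = -C.ofForm ρ := C.lift_ofForm ρ

theorem dForm_d (a : A) : C.dForm (C.d a) = 0 := by
  simpa [d_one] using C.dForm_smul_d 1 a

/-- `a ↦ !![a, d a; 0, a]`. -/
noncomputable def matAlg : A →ₐ[k] Matrix (Fin 2) (Fin 2) C.Forms :=
  AlgHom.ofLinearMap
    { toFun := fun a ↦ !![C.ofAlg a, C.ofForm (C.d a); 0, C.ofAlg a]
      map_add' := fun a b ↦ by ext i j; fin_cases i <;> fin_cases j <;> simp
      map_smul' := fun c a ↦ by ext i j; fin_cases i <;> fin_cases j <;> simp }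
    (by ext i j; fin_cases i <;> fin_cases j <;> simp [d_one])
    (fun a b ↦ by
      ext i j
      fin_cases i <;> fin_cases j <;>
        simp [Matrix.mul_apply, C.leibniz, ofAlg_mul_ofForm, ofForm_mul_ofAlg, add_comm])

/-- `ρ ↦ !![-ρ, d ρ; 0, ρ]`. -/
noncomputable def matForm : Γ →ₗ[k] Matrix (Fin 2) (Fin 2) C.Forms where
  toFun := fun ρ ↦ !![-C.ofForm ρ, C.dForm ρ; 0, C.ofForm ρ]
  map_add' := fun a b ↦ by ext i j; fin_cases i <;> fin_cases j <;> simp [add_comm]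
  map_smul' := fun c a ↦ by ext i j; fin_cases i <;> fin_cases j <;> simp

theorem matAlg_apply (a : A) : C.matAlg a = !![C.ofAlg a, C.ofForm (C.d a); 0, C.ofAlg a] := rfl

theorem matForm_apply (ρ : Γ) :
    C.matForm ρ = !![-C.ofForm ρ, C.dForm ρ; 0, C.ofForm ρ] := rfl

theorem matForm_rel (t : A ⊗[k] A) : LinearMap.mul' k (Matrix (Fin 2) (Fin 2) C.Forms)
    (TensorProduct.map (C.matForm ∘ₗ C.d) (C.matForm ∘ₗ C.d) t) = !![C.dd t, 0; 0, C.dd t] := by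
  induction t with
  | zero => ext i j; fin_cases i <;> fin_cases j <;> simp
  | tmul a b =>
    ext i j
    fin_cases i <;> fin_cases j <;> simp [Matrix.mul_apply, matForm_apply, dForm_d]
  | add s t hs ht =>
    rw [map_add, map_add, hs, ht]
    ext i j
    fin_cases i <;> fin_cases j <;> simp

/-- A bookkeeping device for the graded Leibniz rule: the algebra homomorphism
`x ↦ !![parity x, d x; 0, x]`. -/
noncomputable def dHom : C.Forms →ₐ[k] Matrix (Fin 2) (Fin 2) C.Forms :=
  C.lift C.matAlg C.matForm
    (fun a ρ ↦ by
      ext i j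
      fin_cases i <;> fin_cases j <;>
        simp [matAlg_apply, matForm_apply, Matrix.mul_apply, ofAlg_mul_ofForm, dForm_smul,
          add_comm])
    (fun a ρ ↦ by
      ext i j
      fin_cases i <;> fin_cases j <;>
        simp [matAlg_apply, matForm_apply, Matrix.mul_apply, ofForm_mul_ofAlg, dForm_op_smul,
          sub_eq_add_neg, add_comm])
    (fun t ht ↦ by
      rw [matForm_rel, C.dd_eq_zero t ht]
      ext i j
      fin_cases i <;> fin_cases j <;> simp)

/-- The differential of the universal differential calculus. -/
noncomputable def D : C.Forms →ₗ[k] C.Forms :=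
  Matrix.entryLinearMap k C.Forms 0 1 ∘ₗ C.dHom.toLinearMap

theorem D_ofAlg (a : A) : C.D (C.ofAlg a) = C.ofForm (C.d a) := by
  simp [D, dHom, lift_ofAlg, matAlg_apply]

theorem D_ofForm (ρ : Γ) : C.D (C.ofForm ρ) = C.dForm ρ := by
  simp [D, dHom, lift_ofForm, matForm_apply]

/-- Induction over products of functions and one-forms. -/
theorem induction {p : C.Forms → Prop} (h0 : ∀ a, p (C.ofAlg a)) (h1 : ∀ ρ, p (C.ofForm ρ))
    (hm : ∀ x y, p x → p y → p (x * y)) (ha : ∀ x y, p x → p y → p (x + y)) (x : C.Forms) :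
    p x := by
  obtain ⟨x, rfl⟩ := RingQuot.mkAlgHom_surjective k C.Rel x
  induction x using TensorAlgebra.induction with
  | algebraMap r => simpa using! h0 (algebraMap k A r)
  | ι x =>
    have : x = (x.1, 0) + (0, x.2) := by simp
    rw [this, map_add, map_add]
    exact ha _ _ (h0 x.1) (h1 x.2)
  | mul a b h1 h2 => simpa using! hm _ _ h1 h2
  | add a b h1 h2 => simpa using! ha _ _ h1 h2

theorem dHom_apply (x : C.Forms) :
    C.dHom x 0 0 = C.parity x ∧ C.dHom x 1 0 = 0 ∧ C.dHom x 1 1 = x := by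
  induction x using C.induction with
  | h0 a => simp [dHom, lift_ofAlg, matAlg_apply, parity_ofAlg]
  | h1 ρ => simp [dHom, lift_ofForm, matForm_apply, parity_ofForm]
  | hm x y hx hy => simp [Matrix.mul_apply, hx, hy]
  | ha x y hx hy => simp [hx, hy]

/-- The graded Leibniz rule. -/
theorem D_mul (x y : C.Forms) : C.D (x * y) = C.D x * y + C.parity x * C.D y := by
  simp [D, Matrix.mul_apply, dHom_apply, add_comm]

theorem D_parity (x : C.Forms) : C.D (C.parity x) = -C.parity (C.D x) := by
  induction x using C.induction with
  | h0 a => simp [parity_ofAlg, parity_ofForm, D_ofAlg]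
  | h1 ρ =>
    rw [parity_ofForm, map_neg, D_ofForm]
    obtain ⟨t, rfl⟩ := C.smulD_surjective ρ
    rw [dForm_smulD, neg_inj]
    induction t with
    | zero => simp
    | tmul a b => simp [parity_ofForm]
    | add s t hs ht => rw [map_add, map_add, ← hs, ← ht]
  | hm x y hx hy =>
    simp only [map_mul, D_mul, map_add, hx, hy]
    noncomm_ring
  | ha x y hx hy => simp only [map_add, hx, hy]; abel

theorem parity_parity (x : C.Forms) : C.parity (C.parity x) = x := by
  induction x using C.induction with
  | h0 a => simp [parity_ofAlg]
  | h1 ρ => simp [parity_ofForm]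
  | hm x y hx hy => rw [map_mul, map_mul, hx, hy]
  | ha x y hx hy => rw [map_add, map_add, hx, hy]

theorem D_D (x : C.Forms) : C.D (C.D x) = 0 := by
  induction x using C.induction with
  | h0 a => rw [D_ofAlg, D_ofForm, dForm_d]
  | h1 ρ =>
    rw [D_ofForm]
    obtain ⟨t, rfl⟩ := C.smulD_surjective ρ
    rw [dForm_smulD]
    induction t with
    | zero => simp
    | tmul a b => simp [D_mul, D_ofForm, dForm_d]
    | add s t hs ht => rw [map_add, map_add, hs, ht, add_zero]
  | hm x y hx hy =>
    simp only [D_mul, map_add, hx, hy, D_parity]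
    noncomm_ring
  | ha x y hx hy => simp only [map_add, hx, hy, add_zero]

/-- The space `Γ^{∧n}` of `n`-forms: the span of all `a ρ₁ ∧ ⋯ ∧ ρₙ` with `a` in `A` and
`ρ₁, …, ρₙ` in `Γ`. In particular `Γ^{∧0} = A` and `Γ^{∧1} = Γ`. -/
noncomputable def forms (n : ℕ) : Submodule k C.Forms :=
  LinearMap.range C.ofAlg.toLinearMap * LinearMap.range C.ofForm ^ n

/-- The forms of degree at most one are not changed by the relations. -/
theorem ofAlg_injective : Function.Injective C.ofAlg := by
  intro a b h
  have := congrArg (fun x ↦ TrivSqZeroExt.fst (C.lift (B := TrivSqZeroExt A Γ)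
    (TrivSqZeroExt.inlAlgHom k A Γ) (TrivSqZeroExt.inrHom A Γ |>.restrictScalars k)
    (by intros; ext <;> simp) (by intros; ext <;> simp) (by
      intro t ht
      clear ht
      induction t with
      | zero => simp
      | tmul a b => simp
      | add s t hs ht => rw [map_add, map_add, hs, ht, add_zero]) x)) h
  simpa [lift_ofAlg] using this

theorem ofForm_injective : Function.Injective C.ofForm := by
  intro a b h
  have := congrArg (fun x ↦ TrivSqZeroExt.snd (C.lift (B := TrivSqZeroExt A Γ)
    (TrivSqZeroExt.inlAlgHom k A Γ) (TrivSqZeroExt.inrHom A Γ |>.restrictScalars k)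
    (by intros; ext <;> simp) (by intros; ext <;> simp) (by
      intro t ht
      clear ht
      induction t with
      | zero => simp
      | tmul a b => simp
      | add s t hs ht => rw [map_add, map_add, hs, ht, add_zero]) x)) h
  simpa [lift_ofForm] using this

/-- The closed `n`-forms. -/
noncomputable def cocycles (n : ℕ) : Submodule k C.Forms := C.forms n ⊓ LinearMap.ker C.D

/-- The exact `n`-forms; there are none but `0` for `n = 0`. -/
noncomputable def coboundaries : ℕ → Submodule k C.Forms
  | 0 => ⊥
  | n + 1 => (C.forms n).map C.D

/-- The `n`-th cohomology space of the complex `A → Γ → Γ^{∧2} → Γ^{∧3} → ⋯`: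
closed `n`-forms modulo exact `n`-forms. -/
abbrev Cohomology (n : ℕ) : Type (max u v w) :=
  C.cocycles n ⧸ (C.coboundaries n).submoduleOf (C.cocycles n)

end Universal

end FODC

/-! Linear functionals act on 𝒜 by X ▷ a = a₍₁₎X(a₍₂₎). This action is a faithful algebra map, and a
coproduct formula for X becomes a twisted Leibniz rule. Left covariance makes Γ free over 𝒜 on
invariant forms w₀, w₁, w₂ dual to a basis X₀, X₁, X₂ of the tangent space, with da = ∑ (Xᵢ ▷ a) wᵢ
and wᵢ a = ∑ (fᵢⱼ ▷ a) wⱼ (`FODC.IsLeftCovariant.exists_basis`).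

In all eleven cases X₀ = F f_μ, X₁ = f_ν E and an X₂ of degree zero obey three quadratic-linear
relations, and the ordered monomials of degree at most two are independent (`IsKoszulTangent`). The
equation d² = 0 then forces the dual quadratic relations on the wᵢ, which leave three invariant
two-forms, one invariant three-form and nothing above. That these stay independent over 𝒜 is seen in
a model: the forms map to End 𝒜 ⊗ M₈, where the wᵢ become twisted copies of the generators of an
eight-dimensional quadratic algebra. The de Rham complex thus turns into a Koszul-type complex 𝒜 →
𝒜³ → 𝒜³ → 𝒜 built from the operators Xᵢ ▷.

In cases 2 to 11, X₂ = f_γ - 1 acts on weight m by γ^m - 1, which is invertible unless m = 0, so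
only weight zero contributes. There the question concerns E and F alone. A Casimir argument for
locally finite modules shows that E F is invertible on weight 2, that weight zero is F(weight 2)
plus the invariants, and that Fx = Ey always has a common solution x = Ea, y = Fa. The invariants of
𝒜 are the constants (`OSLq2.eq_smul_one_of_invariant`). They survive in degrees 0 and 3; between
degrees 1 and 2 they cancel because the coefficient σ of X₂ in the third relation is nonzero
(`IsQuantumSl2Module.hasTrivialKoszulCohomology`).

In case 1, X₂ = X₀X₁ + c (f_{s⁴} - 1), and a triangular change of coordinates identifies the complex
with one of the previous kind (`HasTrivialKoszulCohomology.change_generator`). -/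

/-! ### The left action of functionals on a Hopf algebra -/

section ConvolutionAction

variable {k : Type*} {A : Type*} [Field k] [Ring A]

section Bialgebra

variable [Bialgebra k A]

/-- The left action `X ▷ a = a₍₁₎ X(a₍₂₎)` of the convolution algebra. -/
noncomputable def convAct (X : WithConv (A →ₗ[k] k)) : Module.End k A :=
  (TensorProduct.rid k A).toLinearMap ∘ₗ X.ofConv.lTensor A ∘ₗ Coalgebra.comul

theorem convAct_apply (X : WithConv (A →ₗ[k] k)) (a : A) :
    convAct X a = TensorProduct.rid k A (X.ofConv.lTensor A (Coalgebra.comul a)) := rfl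

theorem convAct_repr {ι : Type*} (X : WithConv (A →ₗ[k] k)) {a : A}
    (r : Coalgebra.Repr k a ι) :
    convAct X a = ∑ i ∈ r.index, X (r.right i) • r.left i := by
  rw [convAct_apply, ← r.eq]
  simp

theorem convAct_one : convAct (1 : WithConv (A →ₗ[k] k)) = 1 := by
  refine LinearMap.ext fun a ↦ ?_
  have : ((1 : WithConv (A →ₗ[k] k)).ofConv) = Coalgebra.counit := by
    ext; simp [LinearMap.convOne_def]
  rw [convAct_apply, this, Coalgebra.lTensor_counit_comul]
  simp

theorem convAct_comp (X Y : WithConv (A →ₗ[k] k)) :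
    convAct (X * Y) = convAct X * convAct Y := by
  refine LinearMap.ext fun a ↦ ?_
  have key (t : A ⊗[k] A) : TensorProduct.rid k A ((X * Y).ofConv.lTensor A t) =
      TensorProduct.rid k A (X.ofConv.lTensor A (TensorProduct.rid k _ (Y.ofConv.lTensor _
        ((TensorProduct.assoc k A A A).symm (Coalgebra.comul.lTensor A t))))) := by
    induction t with
    | zero => simp
    | add s t hs ht => simp only [map_add, hs, ht]
    | tmul x y =>
      have r := Coalgebra.Repr.arbitrary k y
      simp only [LinearMap.lTensor_tmul, ← r.eq]
      simp [r.convMul_apply, LinearMap.convMul_def, ← r.eq, TensorProduct.tmul_sum, mul_comm,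
        smul_smul, Finset.sum_smul]
  have key2 (t : A ⊗[k] A) : TensorProduct.rid k _ (Y.ofConv.lTensor (A ⊗[k] A)
      (Coalgebra.comul.rTensor A t)) =
      Coalgebra.comul (TensorProduct.rid k A (Y.ofConv.lTensor A t)) := by
    induction t with
    | zero => simp
    | add s t hs ht => simp only [map_add, hs, ht]
    | tmul x y => simp
  rw [convAct_apply, key, Coalgebra.coassoc_symm_apply, key2]
  rfl

theorem convAct_add (X Y : WithConv (A →ₗ[k] k)) :
    convAct (X + Y) = convAct X + convAct Y := by
  ext; simp [convAct_apply, LinearMap.lTensor_add]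

theorem convAct_smul (c : k) (X : WithConv (A →ₗ[k] k)) :
    convAct (c • X) = c • convAct X := by
  ext; simp [convAct_apply, LinearMap.lTensor_smul]

variable (k A) in
/-- The left action of the convolution algebra as an algebra homomorphism. -/
noncomputable def convActHom : WithConv (A →ₗ[k] k) →ₐ[k] Module.End k A :=
  AlgHom.ofLinearMap
    { toFun := convAct
      map_add' := convAct_add
      map_smul' := convAct_smul } convAct_one convAct_comp

theorem convActHom_apply (X : WithConv (A →ₗ[k] k)) : convActHom k A X = convAct X := rfl

/-- This is the counit axiom. It recovers a functional from its action, so identities between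
functionals can be checked on operators. -/
theorem counit_convAct (X : WithConv (A →ₗ[k] k)) (a : A) :
    Coalgebra.counit (R := k) (convAct X a) = X a := by
  have key (t : A ⊗[k] A) : Coalgebra.counit (R := k) (TensorProduct.rid k A
      (X.ofConv.lTensor A t)) = X.ofConv (TensorProduct.lid k A
        (Coalgebra.counit.rTensor A t)) := by
    induction t with
    | zero => simp
    | add s t hs ht => simp only [map_add, hs, ht]
    | tmul x y => simp [mul_comm]
  rw [convAct_apply, key, Coalgebra.rTensor_counit_comul]
  simp

theorem convAct_injective : Function.Injective (convAct (k := k) (A := A)) := by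
  intro X Y h
  ext a
  have := congrArg (fun T : Module.End k A ↦ Coalgebra.counit (R := k) (T a)) h
  simpa only [counit_convAct] using this

theorem convAct_one_apply (X : WithConv (A →ₗ[k] k)) : convAct X 1 = X 1 • (1 : A) := by
  simp [convAct_apply, Algebra.TensorProduct.one_def]

/-- A coproduct formula for a functional gives a product rule for its action. -/
theorem convAct_mul {ι : Type*} [Fintype ι] {X : WithConv (A →ₗ[k] k)}
    {P Q : ι → WithConv (A →ₗ[k] k)} (h : ∀ x y, X (x * y) = ∑ i, P i x * Q i y) (x y : A) :
    convAct X (x * y) = ∑ i, convAct (P i) x * convAct (Q i) y := by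
  have key (s t : A ⊗[k] A) : TensorProduct.rid k A (X.ofConv.lTensor A (s * t)) =
      ∑ i, TensorProduct.rid k A ((P i).ofConv.lTensor A s) *
        TensorProduct.rid k A ((Q i).ofConv.lTensor A t) := by
    induction s with
    | zero => simp
    | add s t hs ht => simp only [map_add, add_mul, hs, ht, Finset.sum_add_distrib]
    | tmul a b =>
      induction t with
      | zero => simp
      | add s t hs ht => simp only [map_add, mul_add, hs, ht, Finset.sum_add_distrib]
      | tmul c d =>
        have := h b d
        simp [this, Finset.sum_smul, smul_smul, mul_comm]
  simp only [convAct_apply, Bialgebra.comul_mul, key]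

/-- Every element lies in a finite-dimensional submodule of the convolution action. -/
theorem exists_finite_convAct_stable (a : A) : ∃ V : Submodule k A, FiniteDimensional k V ∧ a ∈ V ∧
    ∀ X : WithConv (A →ₗ[k] k), ∀ b ∈ V, convAct X b ∈ V := by
  -- The orbit of `a` under all functionals; it lies in the span of the left legs of any one
  -- expression for the coproduct of `a`.
  refine ⟨LinearMap.range ((LinearMap.applyₗ a) ∘ₗ (convActHom k A).toLinearMap), ?_, ?_, ?_⟩
  · have r := Coalgebra.Repr.arbitrary k a
    have hfin : FiniteDimensional k (Submodule.span k (r.left '' (r.index : Set _))) :=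
      FiniteDimensional.span_of_finite k ((Finset.finite_toSet _).image _)
    refine Submodule.finiteDimensional_of_le
      (S₂ := Submodule.span k (r.left '' (r.index : Set _))) ?_
    · rintro _ ⟨X, rfl⟩
      change convAct X a ∈ _
      rw [convAct_repr X r]
      exact Submodule.sum_mem _ fun i hi ↦ Submodule.smul_mem _ _
        (Submodule.subset_span ⟨i, hi, rfl⟩)
  · exact ⟨1, by simp⟩
  · rintro X _ ⟨Y, rfl⟩
    exact ⟨X * Y, by simp [convActHom_apply, convAct_comp]⟩

end Bialgebra

section Hopf

variable [HopfAlgebra k A]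

/-- In Sweedler notation S(a₍₁₎) a₍₂₎ X(a₍₃₎) collapses by the antipode axiom. This is the device
that strips coefficients X ▷ a down to scalars X(a). -/
theorem sum_antipode_mul_convAct {ι : Type*} (X : WithConv (A →ₗ[k] k)) {a : A}
    (r : Coalgebra.Repr k a ι) :
    ∑ i ∈ r.index, HopfAlgebra.antipode k (r.left i) * convAct X (r.right i) =
      X a • (1 : A) := by
  have key (t : A ⊗[k] A) : LinearMap.mul' k A (TensorProduct.map (HopfAlgebra.antipode k)
      (convAct X) t) = TensorProduct.rid k A (X.ofConv.lTensor A
        ((LinearMap.mul' k A ∘ₗ (HopfAlgebra.antipode k).rTensor A).rTensor A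
          ((TensorProduct.assoc k A A A).symm (Coalgebra.comul.lTensor A t)))) := by
    induction t with
    | zero => simp
    | add s t hs ht => simp only [map_add, hs, ht]
    | tmul x y =>
      have r := Coalgebra.Repr.arbitrary k y
      simp only [TensorProduct.map_tmul, LinearMap.lTensor_tmul, convAct_repr X r, ← r.eq]
      simp [TensorProduct.tmul_sum, Finset.mul_sum]
  have h := key (Coalgebra.comul a)
  rw [Coalgebra.coassoc_symm_apply, ← LinearMap.comp_apply (LinearMap.rTensor A _),
    ← LinearMap.rTensor_comp, LinearMap.comp_assoc,
    HopfAlgebra.mul_antipode_rTensor_comul] at h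
  have h3 : TensorProduct.rid k A (X.ofConv.lTensor A
      ((Algebra.linearMap k A ∘ₗ Coalgebra.counit).rTensor A (Coalgebra.comul a))) =
      X a • (1 : A) := by
    rw [LinearMap.rTensor_comp, LinearMap.comp_apply, Coalgebra.rTensor_counit_comul]
    simp
  rw [h3, ← r.eq] at h
  simpa using h

/-- If a combination of the vectors `v i` with coefficients `X i ▷ a` vanishes for all `a`, then
so does the one with coefficients `X i a`. -/
theorem sum_apply_smul_eq_zero {ι N : Type*} [Fintype ι] [AddCommGroup N] [Module k N] [Module A N]
    [IsScalarTower k A N] {X : ι → WithConv (A →ₗ[k] k)} {v : ι → N}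
    (h : ∀ a, ∑ i, convAct (X i) a • v i = 0) (a : A) : ∑ i, X i a • v i = 0 := by
  have r := Coalgebra.Repr.arbitrary k a
  calc ∑ i, X i a • v i = ∑ i, (X i a • (1 : A)) • v i := by simp
    _ = ∑ j ∈ r.index, HopfAlgebra.antipode k (r.left j) •
          ∑ i, convAct (X i) (r.right j) • v i := by
      simp only [← sum_antipode_mul_convAct _ r, Finset.sum_smul, Finset.smul_sum, mul_smul]
      exact Finset.sum_comm
    _ = 0 := by simp [h]

end Hopf

end ConvolutionAction

/-- A linearly independent finite family of functionals admits dual elements. -/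
theorem LinearIndependent.exists_dual_vectors {k V ι : Type*} [Field k] [AddCommGroup V] [Module k V]
    [Finite ι] [DecidableEq ι] {X : ι → V →ₗ[k] k} (h : LinearIndependent k X) :
    ∃ r : ι → V, ∀ i j, X i (r j) = if i = j then 1 else 0 := by
  have := Fintype.ofFinite ι
  -- A functional that kills the range of the joint evaluation map would be a linear relation among
  -- the `X i`.
  have hs : LinearMap.range (LinearMap.pi X) = ⊤ := by
    by_contra hne
    obtain ⟨g, hg, hle⟩ := Submodule.exists_le_ker_of_lt_top _ (lt_top_iff_ne_top.mpr hne)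
    apply hg
    have h0 : ∑ i, g (Pi.single i 1) • X i = 0 := by
      ext v
      have := hle ⟨v, rfl⟩
      rw [LinearMap.mem_ker, ← Finset.univ_sum_single (LinearMap.pi X v), map_sum] at this
      rw [LinearMap.sum_apply, LinearMap.zero_apply, ← this]
      refine Finset.sum_congr rfl fun i _ ↦ ?_
      have : (Pi.single i (X i v) : ι → k) = X i v • Pi.single i 1 := by
        rw [← Pi.single_smul]; simp
      rw [LinearMap.pi_apply, this, map_smul]
      simp [mul_comm]
    have h1 := Fintype.linearIndependent_iff.mp h _ h0
    refine LinearMap.pi_ext' fun i ↦ ?_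
    ext
    simpa using h1 i
  choose r hr using fun j ↦ LinearMap.range_eq_top.mp hs (Pi.single j 1)
  refine ⟨r, fun i j ↦ ?_⟩
  have := congrFun (hr j) i
  simpa [Pi.single_apply] using this

/-! ### Commutation relations of E, F and the characters -/

namespace OSLq2

variable {q : ℂˣ}

theorem convAct_u (X : Functional q) (i j : Fin 2) :
    convAct X (u (q := q) i j) = ∑ k, X (u k j) • u i k := by
  rw [convAct_apply, comul_u]
  simp

theorem char_u (μ : ℂˣ) (i j : Fin 2) :
    char (q := q) μ (u i j) = !![(μ : ℂ)⁻¹, 0; 0, (μ : ℂ)] i j := by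
  rw [char, lift_u]

theorem f_apply (μ : ℂˣ) (x : OSLq2 q) : f μ x = char μ x := rfl

theorem convAct_f_mul (μ : ℂˣ) (x y : OSLq2 q) :
    convAct (f μ) (x * y) = convAct (f μ) x * convAct (f μ) y := by
  have := convAct_mul (ι := Unit) (X := f (q := q) μ) (P := fun _ ↦ f μ) (Q := fun _ ↦ f μ)
    (by simp [f_apply]) x y
  simpa using this

theorem convAct_E_mul (s : ℂˣ) (hs : s ^ 2 = q) (x y : OSLq2 q) :
    convAct (E s hs) (x * y) =
      convAct (E s hs) x * convAct (f s) y + convAct (f s⁻¹) x * convAct (E s hs) y := by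
  have := convAct_mul (ι := Fin 2) (X := E s hs) (P := ![E s hs, f s⁻¹]) (Q := ![f s, E s hs])
    (by simp [f_apply, E_mul]) x y
  simpa using this

theorem convAct_F_mul (s : ℂˣ) (hs : s ^ 2 = q) (x y : OSLq2 q) :
    convAct (F s hs) (x * y) =
      convAct (F s hs) x * convAct (f s) y + convAct (f s⁻¹) x * convAct (F s hs) y := by
  have := convAct_mul (ι := Fin 2) (X := F s hs) (P := ![F s hs, f s⁻¹]) (Q := ![f s, F s hs])
    (by simp [f_apply, F_mul]) x y
  simpa using this

theorem f_one_apply (μ : ℂˣ) : f (q := q) μ 1 = 1 := by simp [f_apply]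

theorem E_one_apply (s : ℂˣ) (hs : s ^ 2 = q) : E s hs 1 = 0 := by simp [E]

theorem F_one_apply (s : ℂˣ) (hs : s ^ 2 = q) : F s hs 1 = 0 := by simp [F]

theorem convAct_f_one (μ : ℂˣ) : convAct (f (q := q) μ) 1 = 1 := by
  rw [convAct_one_apply, f_one_apply, one_smul]

theorem convAct_E_one (s : ℂˣ) (hs : s ^ 2 = q) : convAct (E s hs) 1 = 0 := by
  rw [convAct_one_apply, E_one_apply, zero_smul]

theorem convAct_F_one (s : ℂˣ) (hs : s ^ 2 = q) : convAct (F s hs) 1 = 0 := by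
  rw [convAct_one_apply, F_one_apply, zero_smul]

theorem convAct_f_u (μ : ℂˣ) (i j : Fin 2) :
    convAct (f μ) (u (q := q) i j) = !![(μ : ℂ)⁻¹, (μ : ℂ)] 0 j • u i j := by
  rw [convAct_u]
  fin_cases j <;> simp [f_apply, char_u]

theorem convAct_E_u (s : ℂˣ) (hs : s ^ 2 = q) (i j : Fin 2) :
    convAct (E s hs) (u i j) = if j = 0 then u i 1 else 0 := by
  rw [convAct_u]
  fin_cases j <;> simp [E_u]

theorem convAct_F_u (s : ℂˣ) (hs : s ^ 2 = q) (i j : Fin 2) :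
    convAct (F s hs) (u i j) = if j = 1 then u i 0 else 0 := by
  rw [convAct_u]
  fin_cases j <;> simp [F_u]

/-- Linear endomorphisms of `O(SL_q(2))` with a common product rule agree as soon as they agree
on the generators. -/
theorem linearMap_ext_of_mul {S T P Q : OSLq2 q →ₗ[ℂ] OSLq2 q}
    (hS : ∀ x y, S (x * y) = S x * P y + Q x * S y)
    (hT : ∀ x y, T (x * y) = T x * P y + Q x * T y) (h1 : S 1 = T 1)
    (h : ∀ i j, S (u i j) = T (u i j)) : S = T := by
  refine LinearMap.ext fun x ↦ ?_
  induction x using induction with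
  | hu i j => exact h i j
  | hc r => rw [Algebra.algebraMap_eq_smul_one, map_smul, map_smul, h1]
  | hm x y hx hy => rw [hS, hT, hx, hy]
  | ha x y hx hy => rw [map_add, map_add, hx, hy]

theorem f_mul_f (μ ν : ℂˣ) : f (q := q) μ * f ν = f (μ * ν) := by
  apply convAct_injective
  refine LinearMap.ext fun x ↦ ?_
  rw [convAct_comp, Module.End.mul_apply]
  induction x using induction with
  | hu i j =>
    rw [convAct_f_u, convAct_f_u, map_smul, convAct_f_u, smul_smul]
    fin_cases j <;> simp [mul_comm]
  | hc r =>
    rw [Algebra.algebraMap_eq_smul_one]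
    simp only [map_smul, convAct_f_one]
  | hm x y hx hy => rw [convAct_f_mul, convAct_f_mul, convAct_f_mul, hx, hy]
  | ha x y hx hy => simp only [map_add, hx, hy]

theorem f_one : f (q := q) 1 = 1 := by
  ext x
  induction x using induction with
  | hu i j => fin_cases i <;> fin_cases j <;> simp [f_apply, char_u, counit_u]
  | hc r => simp [f_apply]
  | hm x y hx hy => simp_all [f_apply]
  | ha x y hx hy => simp_all [f_apply]

theorem convAct_f_convAct_f (μ ν : ℂˣ) (x : OSLq2 q) :
    convAct (f μ) (convAct (f ν) x) = convAct (f (μ * ν)) x := by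
  rw [← f_mul_f, convAct_comp, Module.End.mul_apply]

/-- Both sides obey the product rule with outer factors f_{sμ} and f_{s⁻¹μ}, so a comparison on the
generators suffices. -/
theorem f_mul_E (s : ℂˣ) (hs : s ^ 2 = q) (μ : ℂˣ) :
    f μ * E s hs = (μ : ℂ) ^ 2 • (E s hs * f μ) := by
  apply convAct_injective
  simp only [convAct_comp, convAct_smul]
  refine linearMap_ext_of_mul (P := convAct (f (s * μ))) (Q := convAct (f (s⁻¹ * μ)))
    (fun x y ↦ ?_) (fun x y ↦ ?_) ?_ (fun i j ↦ ?_)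
  · simp [convAct_E_mul, convAct_f_mul, convAct_f_convAct_f, mul_comm]
  · simp [convAct_E_mul, convAct_f_mul, convAct_f_convAct_f, mul_comm]
  · simp [convAct_E_one, convAct_f_one]
  · have hμ : (μ : ℂ) ≠ 0 := μ.ne_zero
    fin_cases j <;> simp [convAct_E_u, convAct_f_u, smul_smul]
    match_scalars
    field_simp

theorem f_mul_F (s : ℂˣ) (hs : s ^ 2 = q) (μ : ℂˣ) :
    f μ * F s hs = ((μ : ℂ)⁻¹) ^ 2 • (F s hs * f μ) := by
  apply convAct_injective
  simp only [convAct_comp, convAct_smul]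
  refine linearMap_ext_of_mul (P := convAct (f (s * μ))) (Q := convAct (f (s⁻¹ * μ)))
    (fun x y ↦ ?_) (fun x y ↦ ?_) ?_ (fun i j ↦ ?_)
  · simp [convAct_F_mul, convAct_f_mul, convAct_f_convAct_f, mul_comm]
  · simp [convAct_F_mul, convAct_f_mul, convAct_f_convAct_f, mul_comm]
  · simp [convAct_F_one, convAct_f_one]
  · have hμ : (μ : ℂ) ≠ 0 := μ.ne_zero
    fin_cases j <;> simp [convAct_F_u, convAct_f_u, smul_smul]
    match_scalars
    field_simp

theorem convAct_f_convAct_E (s : ℂˣ) (hs : s ^ 2 = q) (μ : ℂˣ) (x : OSLq2 q) :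
    convAct (f μ) (convAct (E s hs) x) =
      (μ : ℂ) ^ 2 • convAct (E s hs) (convAct (f μ) x) := by
  have := congrArg (fun X : Functional q ↦ convAct X x) (f_mul_E s hs μ)
  simpa [convAct_comp, convAct_smul] using this

theorem convAct_f_convAct_F (s : ℂˣ) (hs : s ^ 2 = q) (μ : ℂˣ) (x : OSLq2 q) :
    convAct (f μ) (convAct (F s hs) x) =
      ((μ : ℂ)⁻¹) ^ 2 • convAct (F s hs) (convAct (f μ) x) := by
  have := congrArg (fun X : Functional q ↦ convAct X x) (f_mul_F s hs μ)
  simpa [convAct_comp, convAct_smul] using this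

/-- In EF - FE applied to a product the mixed terms cancel, because moving f_s and f_{s⁻¹} past E
and F costs reciprocal powers of q. What remains is a product rule with f_q and f_{q⁻¹}, which f_q -
f_{q⁻¹} also satisfies; the generators fix the scalar. -/
theorem E_mul_F_sub (s : ℂˣ) (hs : s ^ 2 = q) (hq : (q : ℂ) ^ 2 ≠ 1) :
    E s hs * F s hs = F s hs * E s hs + ((q : ℂ) - (q : ℂ)⁻¹)⁻¹ • (f q - f q⁻¹) := by
  rw [← sub_eq_iff_eq_add']
  apply convAct_injective
  have hsub (X Y : Functional q) : convAct (X - Y) = convAct X - convAct Y :=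
    map_sub (convActHom ℂ (OSLq2 q)) X Y
  simp only [convAct_comp, convAct_smul, hsub]
  have hqs : s * s = q := by rw [← hs, sq]
  have hqs' : s⁻¹ * s⁻¹ = q⁻¹ := by rw [← hs, sq, mul_inv]
  have hs0 : (s : ℂ) ≠ 0 := s.ne_zero
  have hq0 : (q : ℂ) ≠ 0 := q.ne_zero
  have h0 : (q : ℂ) - (q : ℂ)⁻¹ ≠ 0 := by
    intro h
    apply hq
    field_simp at h
    linear_combination h
  refine linearMap_ext_of_mul (P := convAct (f q)) (Q := convAct (f q⁻¹))
    (fun x y ↦ ?_) (fun x y ↦ ?_) ?_ (fun i j ↦ ?_)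
  · simp only [LinearMap.sub_apply, Module.End.mul_apply, convAct_E_mul, convAct_F_mul, map_add,
      convAct_f_convAct_f, hqs, hqs', convAct_f_convAct_E, convAct_f_convAct_F, Units.val_inv_eq_inv_val]
    simp only [sub_mul, mul_sub, smul_mul_assoc, mul_smul_comm]
    match_scalars <;> field_simp <;> ring
  · simp only [LinearMap.smul_apply, LinearMap.sub_apply, convAct_f_mul, smul_mul_assoc,
      mul_smul_comm, ← smul_add]
    congr 1
    noncomm_ring
  · simp [convAct_E_one, convAct_F_one, convAct_f_one]
  · fin_cases j <;> simp [convAct_E_u, convAct_F_u, convAct_f_u, ← sub_smul, smul_smul, h0]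
    have : ((q : ℂ) - (q : ℂ)⁻¹)⁻¹ * ((q : ℂ)⁻¹ - q) = -1 := by
      rw [← neg_sub (q : ℂ), mul_neg, inv_mul_cancel₀ h0]
    rw [this, neg_one_smul]

end OSLq2

/-! ### Casimir arguments in locally finite weight modules -/

/-- A locally finite weight module over a quantum analogue of `sl₂`: the operator
`F E + φ m` on weight `m` plays the role of the Casimir element. -/
structure IsQuantumSl2Module {V : Type*} [AddCommGroup V] [Module ℂ V] (W : ℤ → Submodule ℂ V)
    (E F : V →ₗ[ℂ] V) (φ : ℤ → ℂ) : Prop where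
  indep : iSupIndep W
  E_mem : ∀ {m n : ℤ}, n = m + 2 → ∀ {x}, x ∈ W m → E x ∈ W n
  F_mem : ∀ {m n : ℤ}, n = m - 2 → ∀ {x}, x ∈ W m → F x ∈ W n
  comm : ∀ m, ∀ x ∈ W m, E (F x) = F (E x) + (φ m - φ (m - 2)) • x
  φ_inj : ∀ m n, φ m = φ n → m = n ∨ m + n + 2 = 0
  φ_symm : ∀ m, φ (-m - 2) = φ m
  exists_finite : ∀ x, ∃ U : Submodule ℂ V, FiniteDimensional ℂ U ∧ x ∈ U ∧
    (∀ y ∈ U, E y ∈ U) ∧ ∀ y ∈ U, F y ∈ U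

namespace IsQuantumSl2Module

variable {V : Type*} [AddCommGroup V] [Module ℂ V] {W : ℤ → Submodule ℂ V}
  {E F : V →ₗ[ℂ] V} {φ : ℤ → ℂ}

/-- Reversing the sign of the weights exchanges E and F, and `φ_symm` says that the Casimir function
is symmetric under this. It halves the work below. -/
theorem swap (h : IsQuantumSl2Module W E F φ) :
    IsQuantumSl2Module (fun m ↦ W (-m)) F E φ where
  indep := h.indep.comp neg_injective
  E_mem := fun hn _ hx ↦ h.F_mem (by omega) hx
  F_mem := fun hn _ hx ↦ h.E_mem (by omega) hx
  comm := fun m x hx ↦ by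
    have h1 := h.φ_symm m
    have h2 := h.φ_symm (m - 2)
    rw [show -(m - 2) - 2 = -m by ring] at h2
    rw [h.comm _ x hx, h1, h2, add_assoc, ← add_smul]
    simp
  φ_inj := h.φ_inj
  φ_symm := h.φ_symm
  exists_finite := fun x ↦ by
    obtain ⟨U, h1, h2, h3, h4⟩ := h.exists_finite x
    exact ⟨U, h1, h2, h4, h3⟩

variable (h : IsQuantumSl2Module W E F φ)
include h

theorem pow_E_mem {m : ℤ} {x : V} (hx : x ∈ W m) (i : ℕ) : (E ^ i) x ∈ W (m + 2 * i) := by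
  induction i with
  | zero => simpa using hx
  | succ i ih =>
    rw [pow_succ', Module.End.mul_apply]
    exact h.E_mem (by push_cast; ring) ih

/-- The iterates have different weights, so if none vanished they would be infinitely many
independent vectors in a finite-dimensional stable subspace. -/
theorem exists_pow_E_eq_zero {m : ℤ} {x : V} (hx : x ∈ W m) : ∃ i : ℕ, (E ^ i) x = 0 := by
  by_contra! hne
  obtain ⟨U, hU, hxU, hE, -⟩ := h.exists_finite x
  have hmem (i : ℕ) : (E ^ i) x ∈ U := by
    induction i with
    | zero => simpa using hxU
    | succ i ih =>
      rw [pow_succ', Module.End.mul_apply]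
      exact hE _ ih
  have hinj : Function.Injective fun i : ℕ ↦ m + 2 * (i : ℤ) := fun i j hij ↦ by
    simp only at hij; omega
  have hli : LinearIndependent ℂ fun i : ℕ ↦ (E ^ i) x :=
    (h.indep.comp hinj).linearIndependent _ (fun i ↦ h.pow_E_mem hx i) hne
  have hli' : LinearIndependent ℂ fun i : ℕ ↦ (⟨(E ^ i) x, hmem i⟩ : U) :=
    LinearIndependent.of_comp U.subtype hli
  exact Infinite.not_finite hli'.finite

/-- The top of the `E`-string through a nonzero vector. -/
theorem exists_top {m : ℤ} {x : V} (hx : x ∈ W m) (h0 : x ≠ 0) :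
    ∃ i : ℕ, (E ^ i) x ≠ 0 ∧ (E ^ (i + 1)) x = 0 := by
  classical
  have hex := h.exists_pow_E_eq_zero hx
  have hpos : Nat.find hex ≠ 0 := by
    intro h1
    have := Nat.find_spec hex
    rw [h1] at this
    exact h0 (by simpa using this)
  obtain ⟨i, hi⟩ := Nat.exists_eq_succ_of_ne_zero hpos
  refine ⟨i, Nat.find_min hex (by omega), ?_⟩
  have := Nat.find_spec hex
  rwa [hi] at this

/-- If `E` raises a vector of weight `m` on which the Casimir element acts by `φ n`, the string
ends in weight `n` or `-n-2`. -/
theorem eq_of_casimir {m n : ℤ} {x : V} (hx : x ∈ W m) (h0 : x ≠ 0)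
    (hc : F (E x) = (φ n - φ m) • x) : ∃ i : ℕ, n = m + 2 * i ∨ n + (m + 2 * i) + 2 = 0 := by
  -- The Casimir value φ n is constant along the string, so FE acts at each stage by φ n minus φ of
  -- the current weight. At the top of the string this difference must be zero.
  have key (i : ℕ) : F ((E ^ (i + 1)) x) = (φ n - φ (m + 2 * i)) • (E ^ i) x := by
    induction i with
    | zero => simpa using hc
    | succ i ih =>
      have hmem := h.pow_E_mem hx (i + 1)
      have h1 := h.comm _ _ hmem
      rw [ih, map_smul, ← Module.End.mul_apply, ← pow_succ', ← Module.End.mul_apply E,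
        ← pow_succ'] at h1
      rw [← sub_eq_iff_eq_add] at h1
      rw [← h1, ← sub_smul]
      congr 1
      rw [show m + 2 * ((i + 1 : ℕ) : ℤ) - 2 = m + 2 * i by push_cast; ring]
      ring
  obtain ⟨i, hi, hi'⟩ := h.exists_top hx h0
  refine ⟨i, ?_⟩
  have := key i
  rw [hi', map_zero, eq_comm, smul_eq_zero, sub_eq_zero] at this
  exact h.φ_inj _ _ (this.resolve_right hi)

/-- Such an x has Casimir value φ 0, so its E-string would end in weight 0 or -2; but a string that
starts in weight 2 only goes up. -/
theorem eq_zero_of_F_eq_zero {x : V} (hx : x ∈ W 2) (hF : F x = 0) : x = 0 := by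
  by_contra h0
  have h1 := h.comm _ x hx
  rw [hF, map_zero, eq_comm, ← eq_neg_iff_add_eq_zero, ← neg_smul, neg_sub] at h1
  obtain ⟨i, hi | hi⟩ := h.eq_of_casimir (n := 2 - 2) hx h0 h1 <;> omega

theorem eq_zero_of_E_eq_zero {x : V} (hx : x ∈ W (-2)) (hE : E x = 0) : x = 0 :=
  h.swap.eq_zero_of_F_eq_zero (by simpa using hx) hE

theorem E_F_of_mem_zero {x : V} (hx : x ∈ W 0) : E (F x) = F (E x) := by
  have := h.φ_symm 0
  rw [h.comm _ x hx, ← this]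
  simp

theorem F_eq_zero_of_E_eq_zero {x : V} (hx : x ∈ W 0) (hE : E x = 0) : F x = 0 := by
  refine h.eq_zero_of_E_eq_zero (h.F_mem (by simp) hx) ?_
  rw [h.E_F_of_mem_zero hx, hE, map_zero]

/-- Here E F x = 0 again forces the Casimir value φ 0 on a vector of weight 2. In other words, an
invariant cannot be reached from weight 2: the trivial module does not extend. -/
theorem F_eq_invariant {x v : V} (hx : x ∈ W 2) (hv : F x = v) (hE : E v = 0) : v = 0 := by
  by_contra h0
  have hx0 : x ≠ 0 := by
    rintro rfl
    exact h0 (by rw [← hv, map_zero])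
  have h1 := h.comm _ x hx
  rw [hv, hE, eq_comm, ← eq_neg_iff_add_eq_zero, ← neg_smul, neg_sub] at h1
  obtain ⟨i, hi | hi⟩ := h.eq_of_casimir (n := 2 - 2) hx hx0 h1 <;> omega

section Invariants

variable {v : V} (hinv : ∀ x ∈ W 0, E x = 0 → F x = 0 → ∃ c : ℂ, x = c • v)
include hinv

/-- On the weight 2 part of a finite-dimensional stable subspace, E F is injective by the two
vanishing results above, hence surjective. No complete reducibility is needed. -/
theorem exists_E_F_eq (hEv : E v = 0) {y : V} (hy : y ∈ W 2) : ∃ x ∈ W 2, E (F x) = y := by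
  obtain ⟨U, hU, hyU, hEU, hFU⟩ := h.exists_finite y
  have hstab : ∀ x ∈ W 2 ⊓ U, (E ∘ₗ F) x ∈ W 2 ⊓ U := fun x hx ↦
    ⟨h.E_mem (m := 0) (by norm_num) (h.F_mem (by norm_num) hx.1), hEU _ (hFU _ hx.2)⟩
  have : FiniteDimensional ℂ (W 2 ⊓ U : Submodule ℂ V) :=
    Submodule.finiteDimensional_of_le inf_le_right
  have hinj : Function.Injective ((E ∘ₗ F).restrict hstab) := by
    rw [← LinearMap.ker_eq_bot, LinearMap.ker_eq_bot']
    rintro ⟨x, hx⟩ hx0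
    have hx0 : E (F x) = 0 := congrArg Subtype.val hx0
    have h0 : F x ∈ W 0 := h.F_mem (by norm_num) hx.1
    obtain ⟨c, hc⟩ := hinv _ h0 hx0 (h.F_eq_zero_of_E_eq_zero h0 hx0)
    have := h.F_eq_invariant hx.1 hc (by rw [map_smul, hEv, smul_zero])
    rw [this] at hc
    exact Subtype.ext (h.eq_zero_of_F_eq_zero hx.1 hc)
  obtain ⟨x, hx⟩ := LinearMap.injective_iff_surjective.mp hinj ⟨y, hy, hyU⟩
  exact ⟨x, x.2.1, congrArg Subtype.val hx⟩

/-- Subtracting the F x with E F x = E y leaves a vector of weight zero killed by E, hence by F, so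
a multiple of v. -/
theorem exists_F_add (hEv : E v = 0) {y : V} (hy : y ∈ W 0) :
    ∃ x ∈ W 2, ∃ c : ℂ, y = F x + c • v := by
  obtain ⟨x, hx, hxy⟩ := h.exists_E_F_eq hinv hEv (h.E_mem (n := 2) (by simp) hy)
  have h0 : y - F x ∈ W 0 := sub_mem hy (h.F_mem (by norm_num) hx)
  have hE : E (y - F x) = 0 := by rw [map_sub, hxy, sub_self]
  obtain ⟨c, hc⟩ := hinv _ h0 hE (h.F_eq_zero_of_E_eq_zero h0 hE)
  exact ⟨x, hx, c, by rw [← hc]; abel⟩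

/-- Take a = F z with E F z = x. Then E(F a - y) = F x - E y = 0, and E is injective on weight -2.
This is the exactness that drives degrees one and two. -/
theorem exists_common_preimage (hEv : E v = 0) {x y : V} (hx : x ∈ W 2) (hy : y ∈ W (-2))
    (hxy : F x = E y) : ∃ a ∈ W 0, E a = x ∧ F a = y := by
  obtain ⟨z, hz, hzx⟩ := h.exists_E_F_eq hinv hEv hx
  have hz0 : F z ∈ W 0 := h.F_mem (by norm_num) hz
  refine ⟨F z, hz0, hzx, ?_⟩
  rw [← sub_eq_zero]
  refine h.eq_zero_of_E_eq_zero (sub_mem (h.F_mem (by norm_num) hz0) hy) ?_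
  rw [map_sub, h.E_F_of_mem_zero hz0, hzx, hxy, sub_self]

end Invariants

end IsQuantumSl2Module

/-! ### Projections onto weight components -/

section WeightProjection

variable {V : Type*} [AddCommGroup V] [Module ℂ V] {W : ℤ → Submodule ℂ V}

/-- The projection to the component of degree `m`. -/
noncomputable def weightProj (hW : DirectSum.IsInternal W) (m : ℤ) : V →ₗ[ℂ] V :=
  (W m).subtype ∘ₗ DirectSum.component ℂ ℤ (fun m ↦ W m) m ∘ₗ
    (LinearEquiv.ofBijective (DirectSum.coeLinearMap W) hW).symm.toLinearMap

variable (hW : DirectSum.IsInternal W)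

theorem weightProj_mem (m : ℤ) (x : V) : weightProj hW m x ∈ W m := Subtype.coe_prop _

theorem weightProj_of_mem {m : ℤ} {x : V} (hx : x ∈ W m) (n : ℤ) :
    weightProj hW n x = if n = m then x else 0 := by
  have : (LinearEquiv.ofBijective (DirectSum.coeLinearMap W) hW).symm x =
      DirectSum.lof ℂ ℤ (fun m ↦ W m) m ⟨x, hx⟩ := by
    rw [LinearEquiv.symm_apply_eq]
    exact (DirectSum.coeLinearMap_lof W m ⟨x, hx⟩).symm
  simp only [weightProj, LinearMap.comp_apply, LinearEquiv.coe_coe, this]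
  split_ifs with h
  · subst h
    simp
  · rw [DirectSum.component.of, dif_neg (Ne.symm h)]
    simp

theorem exists_weightProj_sum (x : V) :
    ∃ S : Finset ℤ, ∀ T, S ⊆ T → x = ∑ m ∈ T, weightProj hW m x := by
  classical
  set y := (LinearEquiv.ofBijective (DirectSum.coeLinearMap W) hW).symm x with hy
  have hx : x = DirectSum.coeLinearMap W y := by
    rw [hy]
    exact ((LinearEquiv.ofBijective (DirectSum.coeLinearMap W) hW).apply_symm_apply x).symm
  refine ⟨DFinsupp.support y, fun T hT ↦ ?_⟩
  have : ∀ m, weightProj hW m x = (y m : V) := fun m ↦ rfl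
  simp only [this]
  conv_lhs => rw [hx, DirectSum.coeLinearMap_eq_dfinsuppSum, DFinsupp.sum]
  refine Finset.sum_subset hT fun m _ hm ↦ ?_
  rw [DFinsupp.notMem_support_iff.mp hm]
  rfl

include hW in
theorem weight_induction {p : V → Prop} (hp : ∀ m, ∀ x ∈ W m, p x) (h0 : p 0)
    (ha : ∀ x y, p x → p y → p (x + y)) (x : V) : p x := by
  obtain ⟨S, hS⟩ := exists_weightProj_sum hW x
  rw [hS S subset_rfl]
  exact Finset.sum_induction _ p ha h0 fun m _ ↦ hp m _ (weightProj_mem hW m x)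

theorem weightProj_comm {T : V →ₗ[ℂ] V} {k : ℤ} (hT : ∀ m, ∀ x ∈ W m, T x ∈ W (m + k))
    {m n : ℤ} (hn : n = m + k) (x : V) : weightProj hW n (T x) = T (weightProj hW m x) := by
  subst hn
  induction x using weight_induction hW with
  | hp l x hx =>
    rw [weightProj_of_mem hW hx, weightProj_of_mem hW (hT l x hx)]
    by_cases h : m = l <;> simp [h]
  | h0 => simp
  | ha x y hx hy => simp [hx, hy]

end WeightProjection

/-! ### Row and column weights -/

namespace OSLq2

variable {q : ℂˣ}

/-- The common eigenspace of weight `m` for a one-parameter family of automorphisms. -/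
def weightSpace (φ : ℂˣ → OSLq2 q →ₐ[ℂ] OSLq2 q) (m : ℤ) : Submodule ℂ (OSLq2 q) where
  carrier := {x | ∀ μ : ℂˣ, φ μ x = (μ : ℂ) ^ m • x}
  zero_mem' := fun μ ↦ by simp
  add_mem' := fun hx hy μ ↦ by rw [map_add, hx, hy, smul_add]
  smul_mem' := fun c x hx μ ↦ by rw [map_smul, hx, smul_comm]

theorem one_mem_weightSpace (φ : ℂˣ → OSLq2 q →ₐ[ℂ] OSLq2 q) : 1 ∈ weightSpace φ 0 :=
  fun μ ↦ by simp

theorem mul_mem_weightSpace {φ : ℂˣ → OSLq2 q →ₐ[ℂ] OSLq2 q} {m n l : ℤ} (hl : l = m + n)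
    {x y : OSLq2 q} (hx : x ∈ weightSpace φ m) (hy : y ∈ weightSpace φ n) :
    x * y ∈ weightSpace φ l := fun μ ↦ by
  rw [map_mul, hx, hy, hl, zpow_add₀ μ.ne_zero, smul_mul_smul_comm]

theorem zpow_injective (hq : ∀ n : ℕ, 0 < n → q ^ n ≠ 1) :
    Function.Injective fun m : ℤ ↦ (q : ℂ) ^ m := by
  have h1 : Function.Injective fun m : ℤ ↦ q ^ m :=
    injective_zpow_iff_not_isOfFinOrder.mpr fun h ↦ by
      obtain ⟨n, hn, h⟩ := isOfFinOrder_iff_pow_eq_one.mp h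
      exact hq n hn h
  intro m n h
  apply h1
  ext
  simpa using h

/-- The weight spaces lie in eigenspaces of the single operator `φ q`, and the eigenvalues q^m are
distinct. -/
theorem iSupIndep_weightSpace (hq : ∀ n : ℕ, 0 < n → q ^ n ≠ 1)
    (φ : ℂˣ → OSLq2 q →ₐ[ℂ] OSLq2 q) : iSupIndep (weightSpace φ) := by
  refine ((Module.End.eigenspaces_iSupIndep (φ q).toLinearMap).comp (zpow_injective hq)).mono ?_
  intro m x hx
  exact Module.End.mem_eigenspace_iff.mpr (hx q)

theorem iSup_weightSpace {φ : ℂˣ → OSLq2 q →ₐ[ℂ] OSLq2 q} {w : Fin 2 → Fin 2 → ℤ}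
    (h : ∀ i j, u i j ∈ weightSpace φ (w i j)) : ⨆ m, weightSpace φ m = ⊤ := by
  rw [eq_top_iff]
  rintro x -
  induction x using induction with
  | hu i j => exact Submodule.mem_iSup_of_mem _ (h i j)
  | hc r =>
    rw [Algebra.algebraMap_eq_smul_one]
    exact Submodule.smul_mem _ _ (Submodule.mem_iSup_of_mem _ (one_mem_weightSpace φ))
  | hm x y hx hy =>
    -- The sum of the weight spaces is closed under products, so it contains everything the
    -- generators produce.
    have : (⨆ m, weightSpace φ m) * (⨆ m, weightSpace φ m) ≤ ⨆ m, weightSpace φ m := by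
      rw [Submodule.iSup_mul]
      refine iSup_le fun m ↦ ?_
      rw [Submodule.mul_iSup]
      refine iSup_le fun n ↦ Submodule.mul_le.mpr fun a ha b hb ↦ ?_
      exact Submodule.mem_iSup_of_mem _ (mul_mem_weightSpace rfl ha hb)
    exact this (Submodule.mul_mem_mul hx hy)
  | ha x y hx hy => exact add_mem hx hy

theorem isInternal_weightSpace (hq : ∀ n : ℕ, 0 < n → q ^ n ≠ 1)
    {φ : ℂˣ → OSLq2 q →ₐ[ℂ] OSLq2 q} {w : Fin 2 → Fin 2 → ℤ}
    (h : ∀ i j, u i j ∈ weightSpace φ (w i j)) : DirectSum.IsInternal (weightSpace φ) :=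
  (DirectSum.isInternal_submodule_iff_iSupIndep_and_iSup_eq_top _).mpr
    ⟨iSupIndep_weightSpace hq φ, iSup_weightSpace h⟩

/-- The automorphism `f_μ ▷`, which scales the columns of `u` by `μ⁻¹` and `μ`. -/
noncomputable def colScale (μ : ℂˣ) : OSLq2 q →ₐ[ℂ] OSLq2 q :=
  AlgHom.ofLinearMap (convAct (f μ)) (convAct_f_one μ) (convAct_f_mul μ)

theorem colScale_apply (μ : ℂˣ) (x : OSLq2 q) : colScale μ x = convAct (f μ) x := rfl

/-- The automorphism which scales the rows of `u` by `μ⁻¹` and `μ`. -/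
noncomputable def rowScale (μ : ℂˣ) : OSLq2 q →ₐ[ℂ] OSLq2 q :=
  lift (fun i j ↦ ![(μ : ℂ)⁻¹, (μ : ℂ)] i • u i j) <| by
    have h := isQuantumSL2Matrix_u q
    have hμ : (μ : ℂ) ≠ 0 := μ.ne_zero
    constructor <;>
      simp [h.ab, h.ac, h.bd, h.cd, h.bc, h.ad, h.da, smul_smul, hμ] <;>
      (try match_scalars) <;> field_simp

theorem rowScale_u (μ : ℂˣ) (i j : Fin 2) :
    rowScale μ (u (q := q) i j) = ![(μ : ℂ)⁻¹, (μ : ℂ)] i • u i j := lift_u _ _ i j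

theorem u_mem_col (i j : Fin 2) : u (q := q) i j ∈ weightSpace colScale (![-1, 1] j) := by
  intro μ
  rw [colScale_apply, convAct_f_u]
  fin_cases j <;> simp

theorem u_mem_row (i j : Fin 2) : u (q := q) i j ∈ weightSpace rowScale (![-1, 1] i) := by
  intro μ
  rw [rowScale_u]
  fin_cases i <;> simp

theorem rowScale_convAct_f (μ ν : ℂˣ) (x : OSLq2 q) :
    rowScale μ (convAct (f ν) x) = convAct (f ν) (rowScale μ x) := by
  have : (rowScale μ).comp (colScale (q := q) ν) = (colScale ν).comp (rowScale μ) :=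
    algHom_ext fun i j ↦ by
      simp only [AlgHom.comp_apply, colScale_apply, rowScale_u, convAct_f_u, map_smul]
      exact smul_comm _ _ _
  exact congrArg (fun T : OSLq2 q →ₐ[ℂ] OSLq2 q ↦ T x) this

theorem rowScale_convAct_E (s : ℂˣ) (hs : s ^ 2 = q) (μ : ℂˣ) (x : OSLq2 q) :
    rowScale μ (convAct (E s hs) x) = convAct (E s hs) (rowScale μ x) := by
  have : (rowScale μ).toLinearMap ∘ₗ convAct (E s hs) =
      convAct (E s hs) ∘ₗ (rowScale μ).toLinearMap :=
    linearMap_ext_of_mul (P := (rowScale μ).toLinearMap ∘ₗ convAct (f s))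
      (Q := (rowScale μ).toLinearMap ∘ₗ convAct (f s⁻¹))
      (by simp [convAct_E_mul]) (by simp [convAct_E_mul, rowScale_convAct_f])
      (by simp [convAct_E_one]) (fun i j ↦ by
        fin_cases j <;> simp [convAct_E_u, rowScale_u])
  exact congrArg (fun T : OSLq2 q →ₗ[ℂ] OSLq2 q ↦ T x) this

theorem rowScale_convAct_F (s : ℂˣ) (hs : s ^ 2 = q) (μ : ℂˣ) (x : OSLq2 q) :
    rowScale μ (convAct (F s hs) x) = convAct (F s hs) (rowScale μ x) := by
  have : (rowScale μ).toLinearMap ∘ₗ convAct (F s hs) =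
      convAct (F s hs) ∘ₗ (rowScale μ).toLinearMap :=
    linearMap_ext_of_mul (P := (rowScale μ).toLinearMap ∘ₗ convAct (f s))
      (Q := (rowScale μ).toLinearMap ∘ₗ convAct (f s⁻¹))
      (by simp [convAct_F_mul]) (by simp [convAct_F_mul, rowScale_convAct_f])
      (by simp [convAct_F_one]) (fun i j ↦ by
        fin_cases j <;> simp [convAct_F_u, rowScale_u])
  exact congrArg (fun T : OSLq2 q →ₗ[ℂ] OSLq2 q ↦ T x) this

end OSLq2

/-! ### The element bc and the reversing anti-automorphism -/

namespace OSLq2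

variable {q : ℂˣ}

/-- The element `b c`, which generates the algebra of bi-invariant elements for the torus. -/
noncomputable def z (q : ℂˣ) : OSLq2 q := u 0 1 * u 1 0

open Polynomial

/-- A representation of `O(SL_q(2))` by `q`-difference operators. -/
noncomputable def diffRep (q : ℂˣ) : OSLq2 q →ₐ[ℂ] Module.End ℂ (ℤ → ℂ) :=
  -- On functions on ℤ, a is a shift, b and c multiply by q^n, and d shifts back with the weight
  -- that da = 1 + q⁻¹bc dictates.
  lift (fun i j ↦ !![LinearMap.funLeft ℂ ℂ (· + 1),
      LinearMap.pi fun n ↦ (q : ℂ) ^ n • LinearMap.proj n;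
      LinearMap.pi fun n ↦ (q : ℂ) ^ n • LinearMap.proj n,
      LinearMap.pi fun n ↦ (1 + (q : ℂ) ^ (2 * n - 1)) • LinearMap.proj (n - 1)] i j) <| by
    have hq : (q : ℂ) ≠ 0 := q.ne_zero
    constructor <;>
    · refine LinearMap.ext fun ψ ↦ funext fun n ↦ ?_
      simp [LinearMap.funLeft_apply, zpow_sub₀ hq, zpow_add₀ hq, zpow_mul, zpow_ofNat,
        ← zpow_mul, two_mul]
      try field_simp

/-- In the difference representation bc multiplies by q^{2n}, so a polynomial relation would have
infinitely many roots. This is the only linear independence inside 𝒜 that the computation of the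
invariants requires; a full monomial basis is not needed. -/
theorem aeval_z_injective (hq : ∀ n : ℕ, 0 < n → q ^ n ≠ 1) :
    Function.Injective (aeval (R := ℂ) (z q)) := by
  rw [injective_iff_map_eq_zero]
  intro p hp
  have key (p : ℂ[X]) (n : ℤ) : diffRep q (aeval (z q) p) 1 n = p.eval ((q : ℂ) ^ (2 * n)) := by
    induction p using Polynomial.induction_on' with
    | add p r hp hr => simp [hp, hr]
    | monomial i c =>
      have h1 (i : ℕ) (n : ℤ) : (diffRep q (z q) ^ i) 1 n = ((q : ℂ) ^ (2 * n)) ^ i := by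
        induction i with
        | zero => simp
        | succ i ih =>
          rw [pow_succ', Module.End.mul_apply]
          generalize (diffRep q (z q) ^ i) 1 = ψ at ih
          rw [pow_succ, ← ih]
          simp [z, diffRep, lift_u, two_mul, zpow_add₀ q.ne_zero]
          ring
      simp [aeval_monomial, h1, Algebra.algebraMap_eq_smul_one]
  have hinj : Function.Injective fun n : ℤ ↦ (q : ℂ) ^ (2 * n) :=
    (zpow_injective hq).comp (fun m n h ↦ by simpa using h)
  refine Polynomial.eq_zero_of_infinite_isRoot p ((Set.infinite_range_of_injective hinj).mono ?_)
  rintro _ ⟨n, rfl⟩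
  have := key p n
  rw [hp] at this
  simpa using this.symm

/-- The anti-automorphism exchanging `a ↔ d` and `b ↔ c`. -/
noncomputable def revHom (q : ℂˣ) : OSLq2 q →ₐ[ℂ] (OSLq2 q)ᵐᵒᵖ :=
  lift (fun i j ↦ MulOpposite.op (u i.rev j.rev)) <| by
    have h := isQuantumSL2Matrix_u q
    have hr0 : Fin.rev (0 : Fin 2) = 1 := rfl
    have hr1 : Fin.rev (1 : Fin 2) = 0 := rfl
    constructor <;> apply MulOpposite.unop_injective <;>
      simp [hr0, hr1, h.ab, h.ac, h.bd, h.cd, h.bc, h.ad, h.da]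

/-- The anti-automorphism exchanging `a ↔ d` and `b ↔ c`, as a linear map. -/
noncomputable def rev (q : ℂˣ) : OSLq2 q →ₗ[ℂ] OSLq2 q :=
  (MulOpposite.opLinearEquiv ℂ).symm.toLinearMap ∘ₗ (revHom q).toLinearMap

theorem rev_mul (x y : OSLq2 q) : rev q (x * y) = rev q y * rev q x := by simp [rev]

theorem rev_one : rev q 1 = 1 := by simp [rev]

theorem rev_pow (x : OSLq2 q) (n : ℕ) : rev q (x ^ n) = rev q x ^ n := by simp [rev]

theorem rev_u (i j : Fin 2) : rev q (u i j) = u i.rev j.rev := by simp [rev, revHom, lift_u]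

theorem rev_rev (x : OSLq2 q) : rev q (rev q x) = x := by
  induction x using induction with
  | hu i j => simp [rev_u]
  | hc r => simp [Algebra.algebraMap_eq_smul_one, rev_one]
  | hm x y hx hy => rw [rev_mul, rev_mul, hx, hy]
  | ha x y hx hy => rw [map_add, map_add, hx, hy]

theorem rev_convAct_f (μ : ℂˣ) (x : OSLq2 q) :
    rev q (convAct (f μ) x) = convAct (f μ⁻¹) (rev q x) := by
  induction x using induction with
  | hu i j => fin_cases j <;> simp [rev_u, convAct_f_u]
  | hc r => simp [Algebra.algebraMap_eq_smul_one, rev_one, convAct_f_one]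
  | hm x y hx hy => rw [rev_mul, convAct_f_mul, convAct_f_mul, rev_mul, hx, hy]
  | ha x y hx hy => simp only [map_add, hx, hy]

theorem rev_rowScale (μ : ℂˣ) (x : OSLq2 q) :
    rev q (rowScale μ x) = rowScale μ⁻¹ (rev q x) := by
  induction x using induction with
  | hu i j => fin_cases i <;> simp [rev_u, rowScale_u]
  | hc r => simp [Algebra.algebraMap_eq_smul_one, rev_one]
  | hm x y hx hy => rw [map_mul (rowScale μ), rev_mul, rev_mul, map_mul, hx, hy]
  | ha x y hx hy => simp only [map_add, hx, hy]

/-- Reversal exchanges E and F. It reflects weights, and it makes x · rev x invariant under E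
whenever x is invariant under E and F. -/
theorem rev_convAct_E (s : ℂˣ) (hs : s ^ 2 = q) (x : OSLq2 q) :
    rev q (convAct (E s hs) x) = convAct (F s hs) (rev q x) := by
  induction x using induction with
  | hu i j => fin_cases j <;> simp [rev_u, convAct_E_u, convAct_F_u]
  | hc r => simp [Algebra.algebraMap_eq_smul_one, rev_one, convAct_E_one, convAct_F_one]
  | hm x y hx hy =>
    rw [rev_mul, convAct_E_mul, convAct_F_mul, map_add, rev_mul, rev_mul, hx, hy,
      rev_convAct_f, rev_convAct_f, inv_inv, add_comm]
  | ha x y hx hy => simp only [map_add, hx, hy]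

theorem rev_convAct_F (s : ℂˣ) (hs : s ^ 2 = q) (x : OSLq2 q) :
    rev q (convAct (F s hs) x) = convAct (E s hs) (rev q x) := by
  rw [← rev_rev (convAct (E s hs) (rev q x)), rev_convAct_E, rev_rev]

theorem rev_mem_col {m n : ℤ} (h : n = -m) {x : OSLq2 q} (hx : x ∈ weightSpace colScale m) :
    rev q x ∈ weightSpace colScale n := fun μ ↦ by
  have := congrArg (rev q) (hx μ⁻¹)
  rw [colScale_apply, rev_convAct_f, inv_inv, map_smul] at this
  rw [colScale_apply, this, h]
  simp

theorem rev_mem_row {m n : ℤ} (h : n = -m) {x : OSLq2 q} (hx : x ∈ weightSpace rowScale m) :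
    rev q x ∈ weightSpace rowScale n := fun μ ↦ by
  have := congrArg (rev q) (hx μ⁻¹)
  rw [rev_rowScale, inv_inv, map_smul] at this
  rw [this, h]
  simp

end OSLq2

/-! ### Spanning monomials and normal forms of given biweight -/

theorem mul_pow_of_smul_comm {R : Type*} [Ring R] [Algebra ℂ R] {x y : R} {r : ℂ}
    (h : x * y = r • (y * x)) (n : ℕ) : x * y ^ n = r ^ n • (y ^ n * x) := by
  induction n with
  | zero => simp
  | succ n ih =>
    rw [pow_succ, ← mul_assoc, ih, smul_mul_assoc, mul_assoc, h, mul_smul_comm, smul_smul,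
      pow_succ, mul_assoc]

namespace OSLq2

variable {q : ℂˣ}

open Polynomial

theorem b_mul_a : u (q := q) 0 1 * u 0 0 = (q : ℂ)⁻¹ • (u 0 0 * u 0 1) := by
  rw [(isQuantumSL2Matrix_u q).ab, smul_smul, inv_mul_cancel₀ q.ne_zero, one_smul]

theorem c_mul_a : u (q := q) 1 0 * u 0 0 = (q : ℂ)⁻¹ • (u 0 0 * u 1 0) := by
  rw [(isQuantumSL2Matrix_u q).ac, smul_smul, inv_mul_cancel₀ q.ne_zero, one_smul]

theorem z_mul_a : z q * u 0 0 = ((q : ℂ)⁻¹ ^ 2) • (u 0 0 * z q) := by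
  rw [z, mul_assoc, c_mul_a, mul_smul_comm, ← mul_assoc, b_mul_a, smul_mul_assoc, smul_smul, sq,
    mul_assoc]

theorem z_mul_d : z q * u 1 1 = ((q : ℂ) ^ 2) • (u 1 1 * z q) := by
  have h := isQuantumSL2Matrix_u q
  rw [z, mul_assoc, h.cd, mul_smul_comm, ← mul_assoc, h.bd, smul_mul_assoc, smul_smul, sq,
    mul_assoc]

theorem commute_b_c : Commute (u (q := q) 0 1) (u 1 0) := (isQuantumSL2Matrix_u q).bc

theorem commute_z_b : Commute (z q) (u 0 1) := (Commute.refl _).mul_left commute_b_c.symm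

theorem commute_z_c : Commute (z q) (u 1 0) := commute_b_c.mul_left (Commute.refl _)

theorem z_mul_b_pow_mul_c_pow (j k : ℕ) :
    z q * (u 0 1 ^ j * u 1 0 ^ k) = u 0 1 ^ (j + 1) * u 1 0 ^ (k + 1) := by
  rw [pow_succ' (u 1 0), pow_succ (u 0 1), z, ← mul_assoc, mul_assoc (u 0 1) (u 1 0),
    (commute_b_c.symm.pow_right j).eq, ← mul_assoc, ← pow_succ', pow_succ]
  simp only [mul_assoc]

theorem b_pow_mul_c_pow (i : ℕ) : u (q := q) 0 1 ^ i * u 1 0 ^ i = z q ^ i :=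
  (commute_b_c.mul_pow i).symm

/-- The monomials `a^i b^j c^k` and `d^i b^j c^k`. -/
def monomials (q : ℂˣ) : Set (OSLq2 q) :=
  {x | ∃ l : Fin 2, ∃ i j k : ℕ, x = u l l ^ i * (u 0 1 ^ j * u 1 0 ^ k)}

/-- The span contains 1 and is stable under left multiplication by each generator. When a meets a
power of d, or d a power of a, the product is a polynomial in bc, which is then moved to the right.
-/
theorem mem_span_monomials (x : OSLq2 q) : x ∈ Submodule.span ℂ (monomials q) := by
  have h := isQuantumSL2Matrix_u q
  have hmem (l : Fin 2) (i j k : ℕ) : u (q := q) l l ^ i * (u 0 1 ^ j * u 1 0 ^ k) ∈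
      Submodule.span ℂ (monomials q) := Submodule.subset_span ⟨l, i, j, k, rfl⟩
  have hb (r : ℂ) (l : Fin 2) (hl : u (q := q) 0 1 * u l l = r • (u l l * u 0 1)) (i j k : ℕ) :
      u (q := q) 0 1 * (u l l ^ i * (u 0 1 ^ j * u 1 0 ^ k)) ∈
        Submodule.span ℂ (monomials q) := by
    rw [← mul_assoc, mul_pow_of_smul_comm hl, smul_mul_assoc, mul_assoc, ← mul_assoc (u 0 1),
      ← pow_succ']
    exact Submodule.smul_mem _ _ (hmem _ _ _ _)
  have hc (r : ℂ) (l : Fin 2) (hl : u (q := q) 1 0 * u l l = r • (u l l * u 1 0)) (i j k : ℕ) :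
      u (q := q) 1 0 * (u l l ^ i * (u 0 1 ^ j * u 1 0 ^ k)) ∈
        Submodule.span ℂ (monomials q) := by
    rw [← mul_assoc, mul_pow_of_smul_comm hl, smul_mul_assoc, mul_assoc, ← mul_assoc (u 1 0),
      (commute_b_c.symm.pow_right j).eq, mul_assoc, ← pow_succ']
    exact Submodule.smul_mem _ _ (hmem _ _ _ _)
  have hz (r t : ℂ) (l : Fin 2) (hl : z q * u l l = r • (u l l * z q)) (i j k : ℕ) :
      (1 + t • z q) * (u l l ^ i * (u 0 1 ^ j * u 1 0 ^ k)) ∈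
        Submodule.span ℂ (monomials q) := by
    rw [add_mul, one_mul, smul_mul_assoc, ← mul_assoc (z q), mul_pow_of_smul_comm hl, smul_mul_assoc,
      mul_assoc, z_mul_b_pow_mul_c_pow]
    exact add_mem (hmem _ _ _ _)
      (Submodule.smul_mem _ _ (Submodule.smul_mem _ _ (hmem _ _ _ _)))
  have key : ∀ x : OSLq2 q, ∀ y ∈ Submodule.span ℂ (monomials q),
      x * y ∈ Submodule.span ℂ (monomials q) := by
    intro x
    induction x using induction with
    | hc r =>
      intro y hy
      rw [Algebra.algebraMap_eq_smul_one, smul_mul_assoc, one_mul]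
      exact Submodule.smul_mem _ _ hy
    | hm x y hx hy =>
      intro w hw
      rw [mul_assoc]
      exact hx _ (hy _ hw)
    | ha x y hx hy =>
      intro w hw
      rw [add_mul]
      exact add_mem (hx _ hw) (hy _ hw)
    | hu r t =>
      intro y hy
      induction hy using Submodule.span_induction with
      | zero => simp
      | add v w _ _ hv hw => rw [mul_add]; exact add_mem hv hw
      | smul r v _ hv => rw [mul_smul_comm]; exact Submodule.smul_mem _ _ hv
      | mem v hv =>
        obtain ⟨l, i, j, k, rfl⟩ := hv
        fin_cases r <;> fin_cases t
        · fin_cases l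
          · rw [← mul_assoc]
            simp only [Fin.zero_eta, ← pow_succ']
            exact hmem _ _ _ _
          · cases i with
            | zero => simpa using hmem 0 1 j k
            | succ i =>
              simp only [Fin.zero_eta, Fin.mk_one]
              rw [pow_succ', mul_assoc (u 1 1), ← mul_assoc, h.ad]
              exact hz _ _ _ z_mul_d i j k
        · fin_cases l
          · exact hb _ 0 b_mul_a i j k
          · exact hb _ 1 h.bd i j k
        · fin_cases l
          · exact hc _ 0 c_mul_a i j k
          · exact hc _ 1 h.cd i j k
        · fin_cases l
          · cases i with
            | zero => simpa using hmem 1 1 j k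
            | succ i =>
              simp only [Fin.zero_eta, Fin.mk_one]
              rw [pow_succ', mul_assoc (u 0 0), ← mul_assoc, h.da]
              exact hz _ _ _ z_mul_a i j k
          · rw [← mul_assoc]
            simp only [Fin.mk_one, ← pow_succ']
            exact hmem _ _ _ _
  have h1 : (1 : OSLq2 q) ∈ Submodule.span ℂ (monomials q) := by simpa using hmem 0 0 0 0
  simpa using key x 1 h1

theorem pow_mem_weightSpace {φ : ℂˣ → OSLq2 q →ₐ[ℂ] OSLq2 q} {m : ℤ}
    {x : OSLq2 q} (hx : x ∈ weightSpace φ m) (n : ℕ) : x ^ n ∈ weightSpace φ (n * m) := by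
  induction n with
  | zero => simpa using one_mem_weightSpace φ
  | succ n ih =>
    rw [pow_succ]
    exact mul_mem_weightSpace (by push_cast; ring) ih hx

theorem isInternal_col (hq : ∀ n : ℕ, 0 < n → q ^ n ≠ 1) :
    DirectSum.IsInternal (weightSpace (q := q) colScale) := isInternal_weightSpace hq u_mem_col

theorem isInternal_row (hq : ∀ n : ℕ, 0 < n → q ^ n ≠ 1) :
    DirectSum.IsInternal (weightSpace (q := q) rowScale) := isInternal_weightSpace hq u_mem_row

theorem convAct_f_row {m : ℤ} {x : OSLq2 q} (hx : x ∈ weightSpace rowScale m) (μ : ℂˣ) :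
    convAct (f μ) x ∈ weightSpace rowScale m := fun ν ↦ by
  rw [rowScale_convAct_f, hx, map_smul]

theorem convAct_E_row {s : ℂˣ} (hs : s ^ 2 = q) {m : ℤ} {x : OSLq2 q}
    (hx : x ∈ weightSpace rowScale m) : convAct (E s hs) x ∈ weightSpace rowScale m := fun ν ↦ by
  rw [rowScale_convAct_E, hx, map_smul]

theorem convAct_F_row {s : ℂˣ} (hs : s ^ 2 = q) {m : ℤ} {x : OSLq2 q}
    (hx : x ∈ weightSpace rowScale m) : convAct (F s hs) x ∈ weightSpace rowScale m := fun ν ↦ by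
  rw [rowScale_convAct_F, hx, map_smul]

theorem weightProj_row_mem_col (hq : ∀ n : ℕ, 0 < n → q ^ n ≠ 1) {m : ℤ} {x : OSLq2 q}
    (hx : x ∈ weightSpace colScale m) (n : ℤ) :
    weightProj (isInternal_row hq) n x ∈ weightSpace colScale m := fun μ ↦ by
  rw [colScale_apply, ← weightProj_comm (isInternal_row hq) (T := convAct (f μ)) (k := 0)
    (m := n) (n := n) (fun m x hx ↦ by simpa using convAct_f_row hx μ) (by simp), ← colScale_apply, hx,
    map_smul]

/-- Every monomial is homogeneous for both torus actions, so projecting to a biweight discards the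
monomials of other biweights. Only spanning is used, not independence. -/
theorem mem_of_monomials_mem (hq : ∀ n : ℕ, 0 < n → q ^ n ≠ 1) {m n : ℤ}
    {M : Submodule ℂ (OSLq2 q)} (hM : ∀ (l : Fin 2) (i j k : ℕ),
      i * ![-1, 1] l + (j - k : ℤ) = m → i * ![-1, 1] l + (k - j : ℤ) = n →
      u l l ^ i * (u 0 1 ^ j * u 1 0 ^ k) ∈ M) {x : OSLq2 q}
    (hc : x ∈ weightSpace colScale m) (hr : x ∈ weightSpace rowScale n) : x ∈ M := by
  have h (x : OSLq2 q) : weightProj (isInternal_row hq) n (weightProj (isInternal_col hq) m x) ∈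
      M := by
    induction mem_span_monomials x using Submodule.span_induction with
    | zero => simp
    | add x y _ _ hx hy => rw [map_add, map_add]; exact add_mem hx hy
    | smul c x _ hx => rw [map_smul, map_smul]; exact Submodule.smul_mem _ _ hx
    | mem x hx =>
      obtain ⟨l, i, j, k, rfl⟩ := hx
      have h1 : u (q := q) l l ^ i * (u 0 1 ^ j * u 1 0 ^ k) ∈
          weightSpace colScale (i * ![-1, 1] l + (j - k : ℤ)) :=
        mul_mem_weightSpace rfl (pow_mem_weightSpace (u_mem_col _ _) _)
          (mul_mem_weightSpace (m := j * 1) (n := k * (-1)) (by ring)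
            (pow_mem_weightSpace (u_mem_col 0 1) _) (pow_mem_weightSpace (u_mem_col 1 0) _))
      have h2 : u (q := q) l l ^ i * (u 0 1 ^ j * u 1 0 ^ k) ∈
          weightSpace rowScale (i * ![-1, 1] l + (k - j : ℤ)) :=
        mul_mem_weightSpace rfl (pow_mem_weightSpace (u_mem_row _ _) _)
          (mul_mem_weightSpace (m := j * (-1)) (n := k * 1) (by ring)
            (pow_mem_weightSpace (u_mem_row 0 1) _) (pow_mem_weightSpace (u_mem_row 1 0) _))
      rw [weightProj_of_mem _ h1]
      split_ifs with h3
      · rw [weightProj_of_mem _ h2]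
        split_ifs with h4
        · exact hM l i j k h3.symm h4.symm
        · exact zero_mem _
      · rw [map_zero]
        exact zero_mem _
  simpa [weightProj_of_mem _ hc, weightProj_of_mem _ hr] using h x

/-- Normal form of an element of column weight zero and of nonpositive row weight. -/
theorem exists_normal_form (hq : ∀ n : ℕ, 0 < n → q ^ n ≠ 1) {n : ℤ} (hn : n ≤ 0) {x : OSLq2 q}
    (hc : x ∈ weightSpace colScale 0) (hr : x ∈ weightSpace rowScale n) (hx : x ≠ 0) :
    ∃ i : ℕ, n = -2 * i ∧ ∃ p : ℂ[X], x = u 0 0 ^ i * (u 0 1 ^ i * aeval (z q) p) := by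
  by_cases hi : ∃ i : ℕ, n = -2 * i
  · obtain ⟨i, rfl⟩ := hi
    refine ⟨i, rfl, ?_⟩
    have := mem_of_monomials_mem hq (M := LinearMap.range (LinearMap.mulLeft ℂ (u 0 0 ^ i) ∘ₗ
      LinearMap.mulLeft ℂ (u 0 1 ^ i) ∘ₗ (aeval (R := ℂ) (z q)).toLinearMap)) ?_ hc hr
    · obtain ⟨p, rfl⟩ := this
      exact ⟨p, rfl⟩
    · intro l r j k h1 h2
      -- Adding the two weight equations gives ∓r = -i: either `l = 0` and r = i, or r = i = 0.
      -- Subtracting them gives j = i + k.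
      have h3 : u (q := q) l l ^ r = u 0 0 ^ i ∧ j = i + k := by
        fin_cases l
        · simp only [Fin.zero_eta, Matrix.cons_val_zero] at h1 h2
          exact ⟨by rw [show r = i by omega]; rfl, by omega⟩
        · simp only [Fin.mk_one, Matrix.cons_val_one, Matrix.cons_val_fin_one] at h1 h2
          have h4 : r = 0 := by omega
          have h5 : i = 0 := by omega
          subst h4 h5
          exact ⟨by simp, by omega⟩
      refine ⟨X ^ k, ?_⟩
      rw [h3.1, h3.2, pow_add, mul_assoc (u 0 1 ^ i), b_pow_mul_c_pow]
      simp
  · refine absurd ?_ hx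
    have := mem_of_monomials_mem hq (M := ⊥) ?_ hc hr
    · simpa using this
    · intro l r j k h1 h2
      refine absurd ?_ hi
      fin_cases l
      · simp only [Fin.zero_eta, Matrix.cons_val_zero] at h1 h2
        exact ⟨r, by omega⟩
      · simp only [Fin.mk_one, Matrix.cons_val_one, Matrix.cons_val_fin_one] at h1 h2
        exact ⟨0, by omega⟩

end OSLq2

/-! ### The invariants are the constants -/

namespace OSLq2

variable {q : ℂˣ}

open Polynomial

theorem convAct_f_z (μ : ℂˣ) : convAct (f μ) (z q) = z q := by
  rw [z, convAct_f_mul, convAct_f_u, convAct_f_u]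
  simp [smul_smul]

theorem convAct_f_aeval_z (μ : ℂˣ) (p : ℂ[X]) :
    convAct (f μ) (aeval (z q) p) = aeval (z q) p := by
  rw [← colScale_apply, ← aeval_algHom_apply, colScale_apply, convAct_f_z]

theorem convAct_E_z (s : ℂˣ) (hs : s ^ 2 = q) :
    convAct (E s hs) (z q) = (s : ℂ)⁻¹ • (u 0 1 * u 1 1) := by
  rw [z, convAct_E_mul]
  simp [convAct_E_u, convAct_f_u]

theorem b_mul_d_mul_z : u 0 1 * u 1 1 * z q = ((q : ℂ)⁻¹ ^ 2) • (z q * (u 0 1 * u 1 1)) := by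
  rw [mul_assoc, ← mul_assoc (z q), commute_z_b.eq, mul_assoc, z_mul_d, mul_smul_comm, smul_smul,
    ← mul_pow, inv_mul_cancel₀ q.ne_zero, one_pow, one_smul]

/-- The product rule yields a geometric sum in q⁻². Multiplying by 1 - q⁻² sums it, and multiplying
by z avoids the exponent n - 1. -/
theorem convAct_E_z_pow (s : ℂˣ) (hs : s ^ 2 = q) (n : ℕ) :
    (1 - (q : ℂ)⁻¹ ^ 2) • (z q * convAct (E s hs) (z q ^ n)) =
      ((s : ℂ)⁻¹ * (1 - ((q : ℂ)⁻¹ ^ 2) ^ n)) • (z q ^ n * (u 0 1 * u 1 1)) := by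
  induction n with
  | zero => simp [convAct_E_one]
  | succ n ih =>
    have h : convAct (f s⁻¹) (z q ^ n) = z q ^ n := by
      simpa using convAct_f_aeval_z (q := q) s⁻¹ (X ^ n)
    rw [pow_succ (z q), pow_succ (_ : ℂ) n, convAct_E_mul, convAct_f_z, h, mul_add, smul_add,
      ← mul_assoc, ← smul_mul_assoc,
      ih, smul_mul_assoc, mul_assoc (z q ^ n), b_mul_d_mul_z, convAct_E_z]
    have h2 : z q * (z q ^ n * (s : ℂ)⁻¹ • (u 0 1 * u 1 1)) =
        (s : ℂ)⁻¹ • (z q ^ n * (z q * (u 0 1 * u 1 1))) := by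
      rw [mul_smul_comm, mul_smul_comm, ← mul_assoc, ← pow_succ', pow_succ, mul_assoc]
    rw [h2]
    simp only [mul_smul_comm, smul_smul, ← add_smul, mul_assoc]
    congr 1
    ring

/-- On polynomials in bc, E is a q⁻²-difference quotient times bd. -/
theorem convAct_E_aeval_z (s : ℂˣ) (hs : s ^ 2 = q) (p : ℂ[X]) :
    (1 - (q : ℂ)⁻¹ ^ 2) • (z q * convAct (E s hs) (aeval (z q) p)) =
      (s : ℂ)⁻¹ • (aeval (z q) (p - p.comp (C ((q : ℂ)⁻¹ ^ 2) * X)) * (u 0 1 * u 1 1)) := by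
  induction p using Polynomial.induction_on' with
  | add p r hp hr =>
    rw [map_add, map_add, mul_add, smul_add, hp, hr, ← smul_add, ← add_mul, ← map_add]
    congr 3
    simp only [add_comp]
    ring
  | monomial n c =>
    rw [← C_mul_X_pow_eq_monomial]
    simp only [map_mul, aeval_C, map_pow, aeval_X, Algebra.algebraMap_eq_smul_one, smul_mul_assoc,
      one_mul, map_smul, mul_smul_comm, map_sub, mul_comp, C_comp, pow_comp, X_comp, mul_pow,
      _root_.smul_pow, one_pow]
    rw [smul_comm _ c, convAct_E_z_pow]
    simp only [smul_smul, ← sub_smul, smul_mul_assoc]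
    congr 1
    ring

theorem b_mul_d_mul_c_mul_a : u 0 1 * u 1 1 * (u 1 0 * u 0 0) =
    aeval (z q) (C (q : ℂ)⁻¹ * X * (1 + C (q : ℂ)⁻¹ * X)) := by
  have h := isQuantumSL2Matrix_u q
  have hdc : u (q := q) 1 1 * u 1 0 = (q : ℂ)⁻¹ • (u 1 0 * u 1 1) := by
    rw [h.cd, smul_smul, inv_mul_cancel₀ q.ne_zero, one_smul]
  rw [mul_assoc, ← mul_assoc (u 1 1), hdc, smul_mul_assoc, mul_smul_comm, mul_assoc (u 1 0), h.da,
    ← mul_assoc]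
  simp [z, Algebra.algebraMap_eq_smul_one]

theorem sq_ne_one (hq : ∀ n : ℕ, 0 < n → q ^ n ≠ 1) : (q : ℂ) ^ 2 ≠ 1 := fun h ↦
  hq 2 (by norm_num) (by ext; simpa using h)

/-- Right multiplication by ca turns the factor bd into a nonzero polynomial in z, which can be
cancelled. Then p(z) = p(q⁻²z), and every coefficient of positive degree vanishes since q is not a
root of unity. -/
theorem eq_C_of_convAct_E_eq_zero (hq : ∀ n : ℕ, 0 < n → q ^ n ≠ 1) (s : ℂˣ) (hs : s ^ 2 = q)
    {p : ℂ[X]} (hp : convAct (E s hs) (aeval (z q) p) = 0) : p = C (p.coeff 0) := by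
  have h1 := convAct_E_aeval_z s hs p
  rw [hp, mul_zero, smul_zero, eq_comm, smul_eq_zero] at h1
  have h2 := congrArg (· * (u 1 0 * u 0 0)) (h1.resolve_left (inv_ne_zero s.ne_zero))
  simp only [mul_assoc, zero_mul] at h2
  rw [← mul_assoc (u 0 1), b_mul_d_mul_c_mul_a, ← map_mul,
    map_eq_zero_iff _ (aeval_z_injective hq), mul_eq_zero] at h2
  have h3 : (C (q : ℂ)⁻¹ * X * (1 + C (q : ℂ)⁻¹ * X) : ℂ[X]) ≠ 0 := by
    intro h
    have := congrArg (coeff · 1) h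
    simp [coeff_X, mul_add, mul_assoc] at this
  have h4 := h2.resolve_right h3
  ext n
  rw [coeff_C]
  split_ifs with hn
  · rw [hn]
  · have h5 := congrArg (coeff · n) h4
    simp only [coeff_sub, comp_C_mul_X_coeff, coeff_zero] at h5
    have h6 : p.coeff n * (1 - ((q : ℂ)⁻¹ ^ 2) ^ n) = 0 := by linear_combination h5
    refine (mul_eq_zero.mp h6).resolve_right fun h ↦ ?_
    refine hq (2 * n) (by omega) ?_
    ext
    rw [sub_eq_zero, ← pow_mul, inv_pow, eq_comm, inv_eq_one] at h
    simpa using h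

theorem aeval_z_mul_d (g : ℂ[X]) :
    aeval (z q) g * u 1 1 = u 1 1 * aeval (z q) (g.comp (C ((q : ℂ) ^ 2) * X)) := by
  induction g using Polynomial.induction_on' with
  | add p r hp hr => rw [map_add, add_mul, hp, hr, add_comp, map_add, mul_add]
  | monomial n c =>
    have h (n : ℕ) : z q ^ n * u 1 1 = ((q : ℂ) ^ 2) ^ n • (u 1 1 * z q ^ n) := by
      induction n with
      | zero => simp
      | succ n ih =>
        rw [pow_succ', mul_assoc, ih, mul_smul_comm, ← mul_assoc, z_mul_d, smul_mul_assoc,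
          smul_smul, mul_assoc, ← pow_succ]
    rw [← C_mul_X_pow_eq_monomial]
    simp [Algebra.algebraMap_eq_smul_one, mul_pow, h, _root_.smul_pow, smul_smul, mul_comm c]

/-- Moving d to the left past g(z) replaces z by q²z, and then ad = 1 + qz. Neither step loses a
nonzero polynomial or a zero at the origin. -/
theorem exists_a_pow_mul_aeval_mul_d_pow (i : ℕ) (g : ℂ[X]) :
    ∃ h : ℂ[X], u 0 0 ^ i * (aeval (z q) g * u 1 1 ^ i) = aeval (z q) h ∧ (h = 0 → g = 0) ∧
      (g.eval 0 = 0 → h.eval 0 = 0) := by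
  induction i generalizing g with
  | zero => exact ⟨g, by simp, id, id⟩
  | succ i ih =>
    obtain ⟨h, h1, h2, h3⟩ := ih ((1 + C (q : ℂ) * X) * g.comp (C ((q : ℂ) ^ 2) * X))
    refine ⟨h, ?_, fun h0 ↦ ?_, fun h0 ↦ h3 (by simp [h0])⟩
    · rw [← h1, pow_succ (u 0 0), pow_succ' (u 1 1), ← mul_assoc (aeval (z q) g), aeval_z_mul_d,
        mul_assoc (u 0 0 ^ i), ← mul_assoc (u 0 0), ← mul_assoc (u 0 0),
        (isQuantumSL2Matrix_u q).ad]
      simp [z, Algebra.algebraMap_eq_smul_one]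
    · have h4 := (mul_eq_zero.mp (h2 h0)).resolve_left fun h ↦ by
        have := congrArg (eval 0) h
        simp at this
      ext n
      have h5 := congrArg (coeff · n) h4
      rw [comp_C_mul_X_coeff, coeff_zero] at h5
      simpa using h5

theorem commute_aeval_z {x : OSLq2 q} (hx : Commute (z q) x) (p : ℂ[X]) :
    Commute (aeval (z q) p) x := by
  induction p using Polynomial.induction_on' with
  | add p r hp hr => rw [map_add]; exact hp.add_left hr
  | monomial n c =>
    rw [aeval_monomial]
    exact Commute.mul_left (Algebra.commutes c x) (hx.pow_left n)

theorem rev_z : rev q (z q) = z q := by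
  rw [z, rev_mul, rev_u, rev_u]
  rfl

theorem rev_aeval_z (p : ℂ[X]) : rev q (aeval (z q) p) = aeval (z q) p := by
  induction p using Polynomial.induction_on' with
  | add p r hp hr => rw [map_add, map_add, hp, hr]
  | monomial n c =>
    rw [aeval_monomial, rev_mul, rev_pow, rev_z, Algebra.algebraMap_eq_smul_one, map_smul,
      rev_one]
    simp

/-- In row weight 0, x is a polynomial in bc killed by E. In row weight -2i < 0, the element x · rev
x is again such a polynomial and has no constant term, so it vanishes and forces p = 0. This avoids
knowing that 𝒜 has no zero divisors. -/
theorem eq_smul_one_of_invariant_of_row (hq : ∀ n : ℕ, 0 < n → q ^ n ≠ 1) {s : ℂˣ}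
    (hs : s ^ 2 = q) {n : ℤ} (hn : n ≤ 0) {x : OSLq2 q} (hc : x ∈ weightSpace colScale 0)
    (hr : x ∈ weightSpace rowScale n) (hE : convAct (E s hs) x = 0)
    (hF : convAct (F s hs) x = 0) : ∃ c : ℂ, x = c • 1 ∧ (n ≠ 0 → c = 0) := by
  by_cases hx : x = 0
  · exact ⟨0, by simp [hx]⟩
  obtain ⟨i, rfl, p, hp⟩ := exists_normal_form hq hn hc hr hx
  rcases Nat.eq_zero_or_pos i with rfl | hi
  · simp only [pow_zero, one_mul] at hp
    rw [hp] at hE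
    have := eq_C_of_convAct_E_eq_zero hq s hs hE
    refine ⟨p.coeff 0, ?_, by simp⟩
    rw [hp, this]
    simp [Algebra.algebraMap_eq_smul_one]
  · exfalso
    have hy : rev q x = aeval (z q) p * u 1 0 ^ i * u 1 1 ^ i := by
      rw [hp, rev_mul, rev_mul, rev_pow, rev_pow, rev_u, rev_u, rev_aeval_z]
      rfl
    -- Since x = aⁱbⁱp(z) and rev x = p(z)cⁱdⁱ, the product is aⁱ · zⁱp(z)² · dⁱ.
    obtain ⟨h, h1, h2, h3⟩ := exists_a_pow_mul_aeval_mul_d_pow (q := q) i (X ^ i * (p * p))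
    have hxy : x * rev q x = aeval (z q) h := by
      have h4 : u 1 0 ^ i * (aeval (z q) p * aeval (z q) p) =
          aeval (z q) p * aeval (z q) p * u 1 0 ^ i := by
        rw [← map_mul]
        exact ((commute_aeval_z commute_z_c _).pow_right i).eq.symm
      rw [← h1, hy, hp]
      simp only [map_mul, map_pow, aeval_X, ← b_pow_mul_c_pow]
      rw [mul_assoc (u 0 1 ^ i), h4]
      simp only [mul_assoc]
    have hE' : convAct (E s hs) (x * rev q x) = 0 := by
      rw [convAct_E_mul, hE, ← rev_convAct_F s hs, hF]
      simp
    rw [hxy] at hE'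
    have h4 := eq_C_of_convAct_E_eq_zero hq s hs hE'
    have h5 := h3 (by simp [hi.ne'])
    rw [h4, eval_C] at h5
    rw [h5, map_zero] at h4
    have h6 := h2 h4
    have h7 : p = 0 := by simpa using h6
    rw [h7] at hp
    exact hx (by rw [hp]; simp)

/-- E and F commute with the row scaling, so each row component of x is invariant by itself;
positive row weights are reflected to negative ones by `rev`. -/
theorem eq_smul_one_of_invariant (hq : ∀ n : ℕ, 0 < n → q ^ n ≠ 1) {s : ℂˣ}
    (hs : s ^ 2 = q) {x : OSLq2 q} (hc : x ∈ weightSpace colScale 0)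
    (hE : convAct (E s hs) x = 0) (hF : convAct (F s hs) x = 0) : ∃ c : ℂ, x = c • 1 := by
  have key (n : ℤ) : ∃ c : ℂ, weightProj (isInternal_row hq) n x = c • 1 := by
    set y := weightProj (isInternal_row hq) n x with hy
    have hyr : y ∈ weightSpace rowScale n := weightProj_mem _ n x
    have hyc : y ∈ weightSpace colScale 0 := weightProj_row_mem_col hq hc n
    have hyE : convAct (E s hs) y = 0 := by
      rw [hy, ← weightProj_comm (isInternal_row hq) (T := convAct (E s hs)) (k := 0)
        (m := n) (n := n) (fun m x hx ↦ by simpa using convAct_E_row hs hx) (by simp), hE, map_zero]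
    have hyF : convAct (F s hs) y = 0 := by
      rw [hy, ← weightProj_comm (isInternal_row hq) (T := convAct (F s hs)) (k := 0)
        (m := n) (n := n) (fun m x hx ↦ by simpa using convAct_F_row hs hx) (by simp), hF, map_zero]
    rcases le_or_gt n 0 with hn | hn
    · obtain ⟨c, hc, -⟩ := eq_smul_one_of_invariant_of_row hq hs hn hyc hyr hyE hyF
      exact ⟨c, hc⟩
    · obtain ⟨c, hc, h0⟩ := eq_smul_one_of_invariant_of_row hq hs (n := -n) (by omega)
        (rev_mem_col (by simp) hyc) (rev_mem_row rfl hyr)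
        (by rw [← rev_convAct_F s hs, hyF, map_zero]) (by rw [← rev_convAct_E s hs, hyE, map_zero])
      refine ⟨0, ?_⟩
      rw [← rev_rev y, hc, h0 (by omega)]
      simp
  choose c hc using key
  obtain ⟨S, hS⟩ := exists_weightProj_sum (isInternal_row hq) x
  refine ⟨∑ m ∈ S, c m, ?_⟩
  rw [hS S subset_rfl, Finset.sum_smul]
  exact Finset.sum_congr rfl fun m _ ↦ hc m

end OSLq2

/-! ### Koszul complexes of three operators -/

/-- The cohomology of the Koszul-type complex `V → V³ → V³ → V` attached to three operators is
spanned by the class of the invariant vector `v` in degrees `0` and `3`. -/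
structure HasTrivialKoszulCohomology {V : Type*} [AddCommGroup V] [Module ℂ V]
    (x₁ x₂ x₃ : V →ₗ[ℂ] V) (α β κ τ σ : ℂ) (v : V) : Prop where
  invariant : x₁ v = 0 ∧ x₂ v = 0 ∧ x₃ v = 0
  zero : ∀ a, x₁ a = 0 → x₂ a = 0 → x₃ a = 0 → ∃ c : ℂ, a = c • v
  one : ∀ a₁ a₂ a₃, x₃ a₁ - α • x₁ a₃ - β • a₁ = 0 →
    x₃ a₂ - α⁻¹ • x₂ a₃ + (α⁻¹ * β) • a₂ = 0 →
    x₂ a₁ - κ • x₁ a₂ - τ • x₃ a₃ - σ • a₃ = 0 → ∃ a, x₁ a = a₁ ∧ x₂ a = a₂ ∧ x₃ a = a₃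
  two : ∀ b₁ b₂ b₃, x₃ b₃ - α⁻¹ • x₂ b₁ + (α * κ) • x₁ b₂ = 0 →
    ∃ a₁ a₂ a₃, x₃ a₁ - α • x₁ a₃ - β • a₁ = b₁ ∧
      x₃ a₂ - α⁻¹ • x₂ a₃ + (α⁻¹ * β) • a₂ = b₂ ∧
      x₂ a₁ - κ • x₁ a₂ - τ • x₃ a₃ - σ • a₃ = b₃
  three : ∀ y, ∃ b₁ b₂ b₃, ∃ c : ℂ, y = x₃ b₃ - α⁻¹ • x₂ b₁ + (α * κ) • x₁ b₂ + c • v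
  three' : ∀ b₁ b₂ b₃, ∀ c : ℂ, x₃ b₃ - α⁻¹ • x₂ b₁ + (α * κ) • x₁ b₂ = c • v → c = 0

/-- A change of generators `x₃ = x₁ x₂ + c x₃'` gives an isomorphic complex. -/
theorem HasTrivialKoszulCohomology.change_generator {V : Type*} [AddCommGroup V] [Module ℂ V]
    {x₁ x₂ x₃ x₃' : V →ₗ[ℂ] V} {α α' β β' κ σ σ' c : ℂ} {v : V}
    (h : HasTrivialKoszulCohomology x₁ x₂ x₃' α' β' α 0 σ' v)
    (h3 : ∀ a, x₃ a = x₁ (x₂ a) + c • x₃' a)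
    (h21 : ∀ a, x₂ (x₁ a) = α • x₁ (x₂ a) + σ' • x₃' a)
    (hα : α ≠ 0) (hα' : α' ≠ 0) (hc : c ≠ 0) (hσ : σ * c = σ') (hκ : α' = κ) (hκσ : κ + σ = α)
    (hβ : β = c * β') :
    HasTrivialKoszulCohomology x₁ x₂ x₃ α β κ 0 σ v := by
  obtain rfl : σ = α - κ := by rw [← hκσ]; ring
  subst hβ hκ hσ
  -- The isomorphism of complexes is (a₁, a₂, a₃) ↦ (a₁, a₂, c a₃ + x₁a₂) in degree one, (b₁, b₂,
  -- b₃) ↦ (c b₁ + x₁b₃, α⁻¹cα' b₂, b₃) in degree two, and the scalar α⁻¹cα' in degree three. The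
  -- identities `t1` to `t4` say that it commutes with the differentials.
  have t1 (a₁ a₂ a₃ : V) : x₃ a₁ - α • x₁ (c • a₃ + x₁ a₂) - (c * β') • a₁ =
      c • (x₃' a₁ - α' • x₁ a₃ - β' • a₁) +
        x₁ (x₂ a₁ - α • x₁ a₂ - (0 : ℂ) • x₃' a₃ - ((α - α') * c) • a₃) := by
    simp only [h3, map_add, map_smul, map_sub]
    match_scalars <;> ring
  have t2 (a₂ a₃ : V) : x₃ a₂ - α⁻¹ • x₂ (c • a₃ + x₁ a₂) + (α⁻¹ * (c * β')) • a₂ =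
      (α⁻¹ * c * α') • (x₃' a₂ - α'⁻¹ • x₂ a₃ + (α'⁻¹ * β') • a₂) := by
    simp only [h3, map_add, map_smul, map_sub, h21]
    match_scalars <;> field_simp <;> ring
  have t3 (a₁ a₂ a₃ : V) : x₂ a₁ - α' • x₁ a₂ - (0 : ℂ) • x₃ (c • a₃ + x₁ a₂) -
      (α - α') • (c • a₃ + x₁ a₂) =
      x₂ a₁ - α • x₁ a₂ - (0 : ℂ) • x₃' a₃ - ((α - α') * c) • a₃ := by
    simp only [zero_smul]
    match_scalars <;> ring
  have t4 (b₁ b₂ b₃ : V) : x₃ b₃ - α⁻¹ • x₂ (c • b₁ + x₁ b₃) +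
      (α * α') • x₁ ((α⁻¹ * c * α') • b₂) = (α⁻¹ * c * α') •
        (x₃' b₃ - α'⁻¹ • x₂ b₁ + (α' * α) • x₁ b₂) := by
    simp only [h3, map_add, map_smul, map_sub, h21]
    match_scalars <;> field_simp <;> ring
  have hu : α⁻¹ * c * α' ≠ 0 := mul_ne_zero (mul_ne_zero (inv_ne_zero hα) hc) hα'
  generalize α⁻¹ * c * α' = w at *
  have e1 (a x : V) : a = c • (c⁻¹ • (a - x)) + x := by
    rw [smul_smul, mul_inv_cancel₀ hc, one_smul, sub_add_cancel]
  have e2 (a : V) : a = w • (w⁻¹ • a) := by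
    rw [smul_smul, mul_inv_cancel₀ hu, one_smul]
  refine ⟨⟨h.invariant.1, h.invariant.2.1, ?_⟩, fun a ha₁ ha₂ ha₃ ↦ ?_, fun a₁ a₂ a₃ h1 h2 h3' ↦ ?_,
    fun b₁ b₂ b₃ hb ↦ ?_, fun y ↦ ?_, fun b₁ b₂ b₃ t hb ↦ ?_⟩
  · rw [h3, h.invariant.2.1, h.invariant.2.2, map_zero, smul_zero, add_zero]
  · refine h.zero a ha₁ ha₂ ?_
    rw [h3, ha₂, map_zero, zero_add, smul_eq_zero] at ha₃
    exact ha₃.resolve_left hc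
  · rw [e1 a₃ (x₁ a₂)] at h1 h2 h3'
    rw [t2, smul_eq_zero] at h2
    rw [t3] at h3'
    rw [t1, h3', map_zero, add_zero, smul_eq_zero] at h1
    obtain ⟨a, k1, k2, k3⟩ := h.one _ _ _ (h1.resolve_left hc) (h2.resolve_left hu) h3'
    refine ⟨a, k1, k2, ?_⟩
    rw [h3, k2, k3, add_comm]
    exact (e1 a₃ (x₁ a₂)).symm
  · rw [e1 b₁ (x₁ b₃), e2 b₂, t4, smul_eq_zero] at hb
    obtain ⟨a₁, a₂, a₃, k1, k2, k3⟩ := h.two _ _ _ (hb.resolve_left hu)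
    refine ⟨a₁, a₂, c • a₃ + x₁ a₂, ?_, ?_, ?_⟩
    · rw [t1, k1, k3]
      exact (e1 b₁ (x₁ b₃)).symm
    · rw [t2, k2]
      exact (e2 b₂).symm
    · rw [t3, k3]
  · obtain ⟨b₁, b₂, b₃, t, hy⟩ := h.three (w⁻¹ • y)
    refine ⟨c • b₁ + x₁ b₃, w • b₂, b₃, w * t, ?_⟩
    rw [t4, mul_smul w t, ← smul_add, ← hy]
    exact e2 y
  · rw [e1 b₁ (x₁ b₃), e2 b₂, t4] at hb
    have := h.three' _ _ _ (w⁻¹ * t) (by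
      rw [mul_smul w⁻¹, ← hb, smul_smul w⁻¹, inv_mul_cancel₀ hu, one_smul])
    simpa [hu] using this

namespace IsQuantumSl2Module

variable {V : Type*} [AddCommGroup V] [Module ℂ V] {W : ℤ → Submodule ℂ V}
  {E F : V →ₗ[ℂ] V} {φ : ℤ → ℂ}

/-- Writing y = E F z gives F y = E F F z, so the sum is E of one vector of weight -2. The mirror
image of `F_eq_invariant` then applies. -/
theorem add_ne_invariant (h : IsQuantumSl2Module W E F φ) {v : V}
    (hinv : ∀ x ∈ W 0, E x = 0 → F x = 0 → ∃ c : ℂ, x = c • v) (hEv : E v = 0) (hFv : F v = 0)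
    {x y : V} (hx : x ∈ W (-2)) (hy : y ∈ W 2) {c : ℂ} (hxy : E x + F y = c • v) : c • v = 0 := by
  obtain ⟨z, hz, hzy⟩ := h.exists_E_F_eq hinv hEv hy
  have hz0 : F z ∈ W 0 := h.F_mem (by norm_num) hz
  refine h.swap.F_eq_invariant (x := x + F (F z)) ?_ ?_ (by rw [map_smul, hFv, smul_zero])
  · exact add_mem hx (h.F_mem (by norm_num) hz0)
  · rw [map_add, h.E_F_of_mem_zero hz0, hzy, hxy]

section

variable {v : V} {x₁ x₂ x₃ : V →ₗ[ℂ] V} {c₁ c₂ g : ℤ → ℂ} {α β κ τ σ : ℂ}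
  (h : IsQuantumSl2Module W E F φ)
  (hinv : ∀ x ∈ W 0, E x = 0 → F x = 0 → ∃ c : ℂ, x = c • v)
  (hv : v ∈ W 0) (hv0 : v ≠ 0) (hEv : E v = 0) (hFv : F v = 0)
  (hc₁ : ∀ m, c₁ m ≠ 0) (hc₂ : ∀ m, c₂ m ≠ 0) (hg : ∀ m, g m = 0 ↔ m = 0)
  (hx₁ : ∀ m, ∀ x ∈ W m, x₁ x = c₁ m • F x) (hx₂ : ∀ m, ∀ x ∈ W m, x₂ x = c₂ m • E x)
  (hx₃ : ∀ m, ∀ x ∈ W m, x₃ x = g m • x)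
  (hα : α ≠ 0) (hgα : ∀ m, g (m - 2) - β = α * g m)
  (hgα' : ∀ m, g (m + 2) + α⁻¹ * β = α⁻¹ * g m)
  (hκ0 : κ ≠ 0) (hκ : κ * (c₁ 2 * c₂ 0) = c₂ (-2) * c₁ 0) (hσ : σ ≠ 0)

include h hinv hv0 hEv hFv hc₁ hc₂ hg hx₁ hx₂ hx₃ hα hgα hgα' hκ0 hκ hσ in
-- By `hgα` and `hgα'` the first two equations become g(m) a₁ = x₁a₃ and g(m) a₂ = x₂a₃. For m ≠ 0
-- the primitive is a₃ / g(m). For m = 0 they make a₃ a multiple of v, the third equation kills it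
-- because σ ≠ 0, and a common preimage for E and F remains to be found.
theorem koszul_one_of_weight {m : ℤ} {a₁ a₂ a₃ : V} (h₁ : a₁ ∈ W (m - 2)) (h₂ : a₂ ∈ W (m + 2))
    (h₃ : a₃ ∈ W m) (e1 : x₃ a₁ - α • x₁ a₃ - β • a₁ = 0)
    (e2 : x₃ a₂ - α⁻¹ • x₂ a₃ + (α⁻¹ * β) • a₂ = 0)
    (e3 : x₂ a₁ - κ • x₁ a₂ - τ • x₃ a₃ - σ • a₃ = 0) :
    ∃ a, x₁ a = a₁ ∧ x₂ a = a₂ ∧ x₃ a = a₃ := by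
  have f1 : g m • a₁ = x₁ a₃ := by
    rw [hx₃ _ _ h₁, sub_right_comm, ← sub_smul, hgα, mul_smul, ← smul_sub, smul_eq_zero,
      sub_eq_zero] at e1
    exact e1.resolve_left hα
  have f2 : g m • a₂ = x₂ a₃ := by
    rw [hx₃ _ _ h₂, sub_add_eq_add_sub, ← add_smul, hgα', mul_smul, ← smul_sub, smul_eq_zero,
      sub_eq_zero] at e2
    exact e2.resolve_left (inv_ne_zero hα)
  by_cases hm : m = 0
  · subst hm
    have hg0 : g 0 = 0 := (hg 0).mpr rfl
    rw [hg0, zero_smul] at f1 f2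
    rw [hx₁ _ _ h₃, eq_comm, smul_eq_zero] at f1
    rw [hx₂ _ _ h₃, eq_comm, smul_eq_zero] at f2
    obtain ⟨c, rfl⟩ := hinv _ h₃ (f2.resolve_left (hc₂ _)) (f1.resolve_left (hc₁ _))
    have h₁' : a₁ ∈ W (-2) := by simpa using h₁
    have h₂' : a₂ ∈ W 2 := by simpa using h₂
    rw [hx₃ _ _ h₃, hg0, zero_smul, smul_zero, sub_zero, hx₂ _ _ h₁', hx₁ _ _ h₂', smul_smul κ,
      ← map_smul, ← map_smul, smul_smul, sub_eq_zero] at e3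
    -- The third equation presents σa₃ as a sum of an E-image and an F-image, which no nonzero
    -- invariant can be.
    have hz : (σ * c) • v = 0 := by
      refine h.add_ne_invariant hinv hEv hFv (x := c₂ (-2) • a₁) (y := -((κ * c₁ 2) • a₂)) ?_ ?_ ?_
      · exact Submodule.smul_mem _ _ h₁'
      · exact neg_mem (Submodule.smul_mem _ _ h₂')
      · rw [map_neg, ← sub_eq_add_neg, e3]
    rw [hz, sub_eq_zero] at e3
    obtain ⟨a, ha, hEa, hFa⟩ := h.exists_common_preimage hinv hEv
      (Submodule.smul_mem _ (κ * c₁ 2) h₂') (Submodule.smul_mem _ (c₂ (-2)) h₁') e3.symm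
    have hc0 : c • v = 0 := by
      rw [smul_eq_zero, mul_eq_zero] at hz
      rcases hz with (hz | hz) | hz
      · exact absurd hz hσ
      · rw [hz, zero_smul]
      · exact absurd hz hv0
    have hu : c₂ (-2) * c₁ 0 ≠ 0 := mul_ne_zero (hc₂ _) (hc₁ _)
    -- By `hκ` one scalar normalizes both the F- and the E-component.
    refine ⟨(c₂ (-2) * c₁ 0)⁻¹ • a, ?_, ?_, ?_⟩
    · rw [map_smul, hx₁ _ _ ha, hFa, smul_smul, smul_smul, mul_assoc, mul_comm (c₁ 0),
        inv_mul_cancel₀ hu, one_smul]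
    · rw [map_smul, hx₂ _ _ ha, hEa, smul_smul, smul_smul, ← hκ, mul_assoc,
        show c₂ 0 * (κ * c₁ 2) = κ * (c₁ 2 * c₂ 0) by ring, hκ, inv_mul_cancel₀ hu, one_smul]
    · rw [map_smul, hx₃ _ _ ha, hg0, zero_smul, smul_zero, hc0]
  · have hgm : g m ≠ 0 := fun h ↦ hm ((hg m).mp h)
    refine ⟨(g m)⁻¹ • a₃, ?_, ?_, ?_⟩
    · rw [map_smul, ← f1, smul_smul, inv_mul_cancel₀ hgm, one_smul]
    · rw [map_smul, ← f2, smul_smul, inv_mul_cancel₀ hgm, one_smul]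
    · rw [map_smul, hx₃ _ _ h₃, smul_smul, inv_mul_cancel₀ hgm, one_smul]

include h hinv hv hEv hFv hc₁ hc₂ hg hx₁ hx₂ hx₃ hα hgα hgα' hκ0 hκ hσ in
-- For m ≠ 0, rescaling b₁ and b₂ and taking a₃ = 0 works; the cocycle equation supplies b₃. For m =
-- 0, a₃ is fixed by b₁ and b₂ up to multiples of v, and b₃ is then matched by a₂ and that multiple.
theorem koszul_two_of_weight {m : ℤ} {b₁ b₂ b₃ : V} (h₁ : b₁ ∈ W (m - 2)) (h₂ : b₂ ∈ W (m + 2))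
    (h₃ : b₃ ∈ W m) (e : x₃ b₃ - α⁻¹ • x₂ b₁ + (α * κ) • x₁ b₂ = 0) :
    ∃ a₁ a₂ a₃, x₃ a₁ - α • x₁ a₃ - β • a₁ = b₁ ∧
      x₃ a₂ - α⁻¹ • x₂ a₃ + (α⁻¹ * β) • a₂ = b₂ ∧
      x₂ a₁ - κ • x₁ a₂ - τ • x₃ a₃ - σ • a₃ = b₃ := by
  by_cases hm : m = 0
  · subst hm
    have hg0 : g 0 = 0 := (hg 0).mpr rfl
    have h₁' : b₁ ∈ W (-2) := by simpa using h₁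
    have h₂' : b₂ ∈ W 2 := by simpa using h₂
    rw [hx₃ _ _ h₃, hg0, zero_smul, zero_sub, neg_add_eq_zero, hx₂ _ _ h₁', hx₁ _ _ h₂', smul_smul,
      smul_smul, ← map_smul, ← map_smul] at e
    obtain ⟨a, ha, hEa, hFa⟩ := h.exists_common_preimage hinv hEv
      (Submodule.smul_mem _ (α * κ * c₁ 2) h₂') (Submodule.smul_mem _ (α⁻¹ * c₂ (-2)) h₁') e.symm
    -- Chosen so that x₁(t a) = -α⁻¹b₁ and, by `hκ`, x₂(t a) = -αb₂.
    set t := -(c₂ (-2) * c₁ 0)⁻¹ with ht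
    have hu : c₂ (-2) * c₁ 0 ≠ 0 := mul_ne_zero (hc₂ _) (hc₁ _)
    -- The part F x will come from a₂; the invariant part c v from the σa₃ term, where σ ≠ 0 is
    -- essential.
    obtain ⟨x, hx, c, hxc⟩ := h.exists_F_add hinv hEv
      (add_mem h₃ (Submodule.smul_mem _ (σ * t) ha))
    have hx₁v : x₁ v = 0 := by rw [hx₁ _ _ hv, hFv, smul_zero]
    have hx₂v : x₂ v = 0 := by rw [hx₂ _ _ hv, hEv, smul_zero]
    have k : κ * c₁ 2 ≠ 0 := mul_ne_zero hκ0 (hc₁ 2)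
    have hg2 : g 2 + α⁻¹ * β = 0 := by simpa [hg0] using hgα' 0
    have e1 : x₁ (t • a - (σ⁻¹ * c) • v) = -α⁻¹ • b₁ := by
      rw [map_sub, map_smul, map_smul, hx₁v, smul_zero, sub_zero, hx₁ _ _ ha, hFa, smul_smul,
        smul_smul]
      congr 1
      rw [ht]
      field_simp [hc₁ 0, hc₂ (-2)]
    have e2 : x₂ (t • a - (σ⁻¹ * c) • v) = -α • b₂ := by
      rw [map_sub, map_smul, map_smul, hx₂v, smul_zero, sub_zero, hx₂ _ _ ha, hEa, smul_smul,
        smul_smul]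
      congr 1
      rw [ht, ← hκ]
      field_simp [hc₁ 2, hc₂ 0]
    refine ⟨0, -((κ * c₁ 2)⁻¹ • x), t • a - (σ⁻¹ * c) • v, ?_, ?_, ?_⟩
    · rw [e1, map_zero, smul_zero, sub_zero, zero_sub, smul_smul, mul_neg, mul_inv_cancel₀ hα,
        neg_one_smul, neg_neg]
    · rw [map_neg, map_smul, hx₃ _ _ hx, e2, smul_comm _ (g 2), smul_neg, sub_add_eq_add_sub,
        ← sub_eq_zero]
      have : -((g 2) • (κ * c₁ 2)⁻¹ • x) + -((α⁻¹ * β) • (κ * c₁ 2)⁻¹ • x) =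
          -((g 2 + α⁻¹ * β) • (κ * c₁ 2)⁻¹ • x) := by rw [add_smul, neg_add]
      rw [this, hg2, zero_smul, neg_zero, zero_sub, smul_smul, mul_neg, inv_mul_cancel₀ hα,
        neg_one_smul, neg_neg, sub_self]
    · have h₃a : x₃ (t • a - (σ⁻¹ * c) • v) = 0 := by
        rw [map_sub, map_smul, map_smul, hx₃ _ _ ha, hx₃ _ _ hv, hg0]
        simp
      rw [h₃a, map_neg, map_smul, hx₁ _ _ hx, eq_sub_of_add_eq hxc, map_zero]
      have hc12 := hc₁ 2
      clear_value t
      match_scalars <;> field_simp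
  · have hgm : g m ≠ 0 := fun h ↦ hm ((hg m).mp h)
    have e' : x₃ b₃ = α⁻¹ • x₂ b₁ - (α * κ) • x₁ b₂ := by
      rw [← sub_eq_zero, ← e]; abel
    rw [hx₃ _ _ h₃] at e'
    refine ⟨(α * g m)⁻¹ • b₁, (α * (g m)⁻¹) • b₂, 0, ?_, ?_, ?_⟩
    · rw [map_zero, smul_zero, sub_zero, map_smul, hx₃ _ _ h₁, smul_comm β, ← smul_sub, ← sub_smul,
        hgα, smul_smul, inv_mul_cancel₀ (mul_ne_zero hα hgm), one_smul]
    · rw [map_zero, smul_zero, sub_zero, map_smul, hx₃ _ _ h₂, smul_comm (α⁻¹ * β), ← smul_add,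
        ← add_smul, hgα', smul_smul]
      convert one_smul ℂ b₂
      field_simp
    · rw [map_zero, smul_zero, smul_zero, sub_zero, sub_zero, ← one_smul ℂ b₃,
        ← inv_mul_cancel₀ hgm, mul_smul (g m)⁻¹, e']
      simp only [map_smul]
      match_scalars <;> field_simp

include h hinv hv hv0 hEv hFv hc₁ hc₂ hg hx₁ hx₂ hx₃ hα hgα hgα' hκ0 hκ hσ in
-- The operators shift weights by -2, 2 and 0, so the complex splits into pieces whose middle terms
-- have weights m - 2, m + 2, m. The coefficient τ plays no role: its term is zero in weight zero
-- and is avoided elsewhere.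
theorem hasTrivialKoszulCohomology (hW : DirectSum.IsInternal W) :
    HasTrivialKoszulCohomology x₁ x₂ x₃ α β κ τ σ v := by
  have m₁ : ∀ m, ∀ x ∈ W m, x₁ x ∈ W (m + (-2)) := fun m x hx ↦ by
    rw [hx₁ _ _ hx]
    exact Submodule.smul_mem _ _ (h.F_mem (by ring) hx)
  have m₂ : ∀ m, ∀ x ∈ W m, x₂ x ∈ W (m + 2) := fun m x hx ↦ by
    rw [hx₂ _ _ hx]
    exact Submodule.smul_mem _ _ (h.E_mem rfl hx)
  have m₃ : ∀ m, ∀ x ∈ W m, x₃ x ∈ W (m + 0) := fun m x hx ↦ by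
    rw [hx₃ _ _ hx, add_zero]
    exact Submodule.smul_mem _ _ hx
  have p₁ (m n : ℤ) (hn : n = m - 2) (x : V) :
      weightProj hW n (x₁ x) = x₁ (weightProj hW m x) := weightProj_comm hW m₁ (by omega) x
  have p₂ (m n : ℤ) (hn : n = m + 2) (x : V) :
      weightProj hW n (x₂ x) = x₂ (weightProj hW m x) := weightProj_comm hW m₂ hn x
  have p₃ (m : ℤ) (x : V) :
      weightProj hW m (x₃ x) = x₃ (weightProj hW m x) := weightProj_comm hW m₃ (by omega) x
  -- One finite index set has to serve all three components, so the supports are shifted back before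
  -- taking the union.
  have split (a₁ a₂ a₃ : V) : ∃ T : Finset ℤ, a₁ = ∑ m ∈ T, weightProj hW (m - 2) a₁ ∧
      a₂ = ∑ m ∈ T, weightProj hW (m + 2) a₂ ∧ a₃ = ∑ m ∈ T, weightProj hW m a₃ := by
    classical
    obtain ⟨S₁, h₁⟩ := exists_weightProj_sum hW a₁
    obtain ⟨S₂, h₂⟩ := exists_weightProj_sum hW a₂
    obtain ⟨S₃, h₃⟩ := exists_weightProj_sum hW a₃
    refine ⟨S₁.image (· + 2) ∪ S₂.image (· - 2) ∪ S₃, ?_, ?_, h₃ _ Finset.subset_union_right⟩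
    · have := h₁ ((S₁.image (· + 2) ∪ S₂.image (· - 2) ∪ S₃).image (· - 2)) fun m hm ↦ by
        simp only [Finset.mem_image, Finset.mem_union]
        exact ⟨m + 2, Or.inl (Or.inl ⟨m, hm, rfl⟩), by ring⟩
      rwa [Finset.sum_image (by simp)] at this
    · have := h₂ ((S₁.image (· + 2) ∪ S₂.image (· - 2) ∪ S₃).image (· + 2)) fun m hm ↦ by
        simp only [Finset.mem_image, Finset.mem_union]
        exact ⟨m - 2, Or.inl (Or.inr ⟨m, hm, rfl⟩), by ring⟩
      rwa [Finset.sum_image (by simp)] at this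
  refine ⟨⟨?_, ?_, ?_⟩, fun a ha₁ ha₂ ha₃ ↦ ?_, fun a₁ a₂ a₃ e1 e2 e3 ↦ ?_,
    fun b₁ b₂ b₃ e ↦ ?_, fun y ↦ ?_, fun b₁ b₂ b₃ c hb ↦ ?_⟩
  · rw [hx₁ _ _ hv, hFv, smul_zero]
  · rw [hx₂ _ _ hv, hEv, smul_zero]
  · rw [hx₃ _ _ hv, (hg 0).mpr rfl, zero_smul]
  · have ha : a = weightProj hW 0 a := by
      obtain ⟨S, hS⟩ := exists_weightProj_sum hW a
      conv_lhs => rw [hS (insert 0 S) (Finset.subset_insert _ _)]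
      refine Finset.sum_eq_single_of_mem 0 (Finset.mem_insert_self _ _) fun m _ hm ↦ ?_
      have := p₃ m a
      rw [ha₃, map_zero, hx₃ _ _ (weightProj_mem hW m a), eq_comm, smul_eq_zero, hg] at this
      exact this.resolve_left hm
    have ha0 : a ∈ W 0 := by
      rw [ha]
      exact weightProj_mem hW 0 a
    rw [hx₁ _ _ ha0, smul_eq_zero] at ha₁
    rw [hx₂ _ _ ha0, smul_eq_zero] at ha₂
    exact hinv a ha0 (ha₂.resolve_left (hc₂ _)) (ha₁.resolve_left (hc₁ _))
  · obtain ⟨T, k1, k2, k3⟩ := split a₁ a₂ a₃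
    have key (m : ℤ) := h.koszul_one_of_weight hinv hv0 hEv hFv hc₁ hc₂ hg hx₁ hx₂ hx₃ hα hgα hgα'
      hκ0 hκ hσ (τ := τ) (weightProj_mem hW (m - 2) a₁) (weightProj_mem hW (m + 2) a₂)
      (weightProj_mem hW m a₃)
      (by
        have := congrArg (weightProj hW (m - 2)) e1
        rwa [map_sub, map_sub, map_smul, map_smul, p₃, p₁ m _ rfl, map_zero] at this)
      (by
        have := congrArg (weightProj hW (m + 2)) e2
        rwa [map_add, map_sub, map_smul, map_smul, p₃, p₂ m _ rfl, map_zero] at this)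
      (by
        have := congrArg (weightProj hW m) e3
        rwa [map_sub, map_sub, map_sub, map_smul, map_smul, map_smul, p₃, p₂ (m - 2) _ (by ring),
          p₁ (m + 2) _ (by ring), map_zero] at this)
    choose a l1 l2 l3 using key
    refine ⟨∑ m ∈ T, a m, ?_, ?_, ?_⟩
    · rw [map_sum]
      exact (Finset.sum_congr rfl fun m _ ↦ l1 m).trans k1.symm
    · rw [map_sum]
      exact (Finset.sum_congr rfl fun m _ ↦ l2 m).trans k2.symm
    · rw [map_sum]
      exact (Finset.sum_congr rfl fun m _ ↦ l3 m).trans k3.symm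
  · obtain ⟨T, k1, k2, k3⟩ := split b₁ b₂ b₃
    have key (m : ℤ) := h.koszul_two_of_weight hinv hv hEv hFv hc₁ hc₂ hg hx₁ hx₂ hx₃ hα hgα hgα'
      hκ0 hκ hσ (τ := τ) (weightProj_mem hW (m - 2) b₁) (weightProj_mem hW (m + 2) b₂)
      (weightProj_mem hW m b₃)
      (by
        have := congrArg (weightProj hW m) e
        rwa [map_add, map_sub, map_smul, map_smul, p₃, p₂ (m - 2) _ (by ring),
          p₁ (m + 2) _ (by ring), map_zero] at this)
    choose a₁ a₂ a₃ l1 l2 l3 using key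
    refine ⟨∑ m ∈ T, a₁ m, ∑ m ∈ T, a₂ m, ∑ m ∈ T, a₃ m, ?_, ?_, ?_⟩
    · refine Eq.trans ?_ k1.symm
      simp only [map_sum, Finset.smul_sum, ← Finset.sum_sub_distrib]
      exact Finset.sum_congr rfl fun m _ ↦ l1 m
    · refine Eq.trans ?_ k2.symm
      simp only [map_sum, Finset.smul_sum, ← Finset.sum_sub_distrib, ← Finset.sum_add_distrib]
      exact Finset.sum_congr rfl fun m _ ↦ l2 m
    · refine Eq.trans ?_ k3.symm
      simp only [map_sum, Finset.smul_sum, ← Finset.sum_sub_distrib]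
      exact Finset.sum_congr rfl fun m _ ↦ l3 m
  · induction y using weight_induction hW with
    | hp m y hy =>
      by_cases hm : m = 0
      · subst hm
        obtain ⟨x, hx, c, rfl⟩ := h.exists_F_add hinv hEv hy
        refine ⟨0, (α * κ * c₁ 2)⁻¹ • x, 0, c, ?_⟩
        rw [map_zero, map_zero, smul_zero, sub_zero, zero_add, map_smul, hx₁ _ _ hx, smul_smul,
          smul_smul, mul_right_comm, mul_inv_cancel₀ (mul_ne_zero (mul_ne_zero hα hκ0) (hc₁ 2)),
          one_smul]
      · refine ⟨0, 0, (g m)⁻¹ • y, 0, ?_⟩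
        have hgm : g m ≠ 0 := fun h ↦ hm ((hg m).mp h)
        rw [map_smul, hx₃ _ _ hy, smul_smul, inv_mul_cancel₀ hgm]
        simp
    | h0 => exact ⟨0, 0, 0, 0, by simp⟩
    | ha x y hx hy =>
      obtain ⟨b₁, b₂, b₃, c, rfl⟩ := hx
      obtain ⟨d₁, d₂, d₃, t, rfl⟩ := hy
      refine ⟨b₁ + d₁, b₂ + d₂, b₃ + d₃, c + t, ?_⟩
      simp only [map_add]
      module
  -- In weight zero the x₃-term drops out, leaving an invariant that is a sum of an E-image and an
  -- F-image.
  · have e := congrArg (weightProj hW 0) hb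
    rw [map_add, map_sub, map_smul, map_smul, map_smul, p₃, p₂ (-2) _ (by ring),
      p₁ 2 _ (by ring), weightProj_of_mem hW hv, if_pos rfl, hx₃ _ _ (weightProj_mem hW _ _),
      (hg 0).mpr rfl, zero_smul, zero_sub, hx₁ _ _ (weightProj_mem hW _ _),
      hx₂ _ _ (weightProj_mem hW _ _), smul_smul, smul_smul, ← neg_smul, ← map_smul E,
      ← map_smul F] at e
    have := h.add_ne_invariant hinv hEv hFv (Submodule.smul_mem _ _ (weightProj_mem hW _ _))
      (Submodule.smul_mem _ _ (weightProj_mem hW _ _)) e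
    exact (smul_eq_zero.mp this).resolve_right hv0

end

end IsQuantumSl2Module

/-! ### The Koszul complex of quantum sl₂ acting on 𝒜 -/

theorem convAct_sub {k A : Type*} [Field k] [Ring A] [Bialgebra k A] (X Y : WithConv (A →ₗ[k] k)) :
    convAct (X - Y) = convAct X - convAct Y := map_sub (convActHom k A) X Y

namespace OSLq2

variable {q : ℂˣ}

theorem convAct_f_of_mem {m : ℤ} {x : OSLq2 q} (hx : x ∈ weightSpace colScale m) (μ : ℂˣ) :
    convAct (f μ) x = (μ : ℂ) ^ m • x := hx μ

theorem convAct_E_mem_col (s : ℂˣ) (hs : s ^ 2 = q) {m n : ℤ} (hn : n = m + 2) {x : OSLq2 q}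
    (hx : x ∈ weightSpace colScale m) : convAct (E s hs) x ∈ weightSpace colScale n := fun μ ↦ by
  rw [colScale_apply, convAct_f_convAct_E, convAct_f_of_mem hx, map_smul, smul_smul, hn,
    zpow_add₀ μ.ne_zero, mul_comm]
  norm_cast

theorem convAct_F_mem_col (s : ℂˣ) (hs : s ^ 2 = q) {m n : ℤ} (hn : n = m - 2) {x : OSLq2 q}
    (hx : x ∈ weightSpace colScale m) : convAct (F s hs) x ∈ weightSpace colScale n := fun μ ↦ by
  rw [colScale_apply, convAct_f_convAct_F, convAct_f_of_mem hx, map_smul, smul_smul, hn,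
    zpow_sub₀ μ.ne_zero, mul_comm, div_eq_mul_inv, inv_pow]
  norm_cast

theorem sub_inv_ne_zero (hq : ∀ n : ℕ, 0 < n → q ^ n ≠ 1) : (q : ℂ) - (q : ℂ)⁻¹ ≠ 0 := fun h ↦ by
  apply sq_ne_one hq
  have := q.ne_zero
  field_simp at h
  linear_combination h

/-- The action of the quantum group `U_q(sl₂)` on `O(SL_q(2))`. -/
theorem isQuantumSl2Module (hq : ∀ n : ℕ, 0 < n → q ^ n ≠ 1) (s : ℂˣ) (hs : s ^ 2 = q) :
    IsQuantumSl2Module (weightSpace colScale) (convAct (E s hs)) (convAct (F s hs))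
      (fun m ↦ ((q : ℂ) ^ (m + 1) + ((q : ℂ) ^ (m + 1))⁻¹) / ((q : ℂ) - (q : ℂ)⁻¹) ^ 2) where
  indep := iSupIndep_weightSpace hq _
  E_mem := fun hn _ hx ↦ convAct_E_mem_col s hs hn hx
  F_mem := fun hn _ hx ↦ convAct_F_mem_col s hs hn hx
  comm := fun m x hx ↦ by
    have h := congrArg (fun X : Functional q ↦ convAct X x) (E_mul_F_sub s hs (sq_ne_one hq))
    have hq0 := q.ne_zero
    have hl := sub_inv_ne_zero hq
    have hm : (q : ℂ) ^ m ≠ 0 := zpow_ne_zero _ hq0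
    simp only [convAct_add, convAct_smul, convAct_sub,
      convAct_comp, LinearMap.add_apply, LinearMap.sub_apply, LinearMap.smul_apply, Module.End.mul_apply,
      convAct_f_of_mem hx, Units.val_inv_eq_inv_val, inv_zpow] at h
    rw [h, ← sub_smul, smul_smul]
    congr 2
    rw [show m - 2 + 1 = m - 1 by ring, zpow_add₀ hq0, zpow_sub₀ hq0, zpow_one]
    generalize (q : ℂ) ^ m = y at *
    rw [eq_comm, ← sub_div, div_eq_iff (pow_ne_zero 2 hl), sq ((q : ℂ) - _), ← mul_assoc,
      mul_right_comm _ (y - _), inv_mul_cancel₀ hl]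
    field_simp
    ring
  φ_inj := fun m n h ↦ by
    have hq0 := q.ne_zero
    have hl := sub_inv_ne_zero hq
    have hm : (q : ℂ) ^ (m + 1) ≠ 0 := zpow_ne_zero _ hq0
    have hn : (q : ℂ) ^ (n + 1) ≠ 0 := zpow_ne_zero _ hq0
    -- With y = q^{m+1} and y' = q^{n+1}, the equation y + y⁻¹ = y' + y'⁻¹ factors as (y - y')(yy' -
    -- 1) = 0.
    have h' : ((q : ℂ) ^ (m + 1) - (q : ℂ) ^ (n + 1)) * ((q : ℂ) ^ (m + n + 2) - (q : ℂ) ^ (0 : ℤ))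
        = 0 := by
      rw [div_left_inj' (pow_ne_zero 2 hl)] at h
      rw [show m + n + 2 = (m + 1) + (n + 1) by ring, zpow_add₀ hq0 (m + 1), zpow_zero]
      field_simp at h
      linear_combination h
    rcases mul_eq_zero.mp h' with h' | h'
    · have := zpow_injective hq (sub_eq_zero.mp h')
      exact Or.inl (by omega)
    · exact Or.inr (zpow_injective hq (sub_eq_zero.mp h'))
  φ_symm := fun m ↦ by
    rw [show -m - 2 + 1 = -(m + 1) by ring, zpow_neg, inv_inv, add_comm]
  exists_finite := fun x ↦ by
    obtain ⟨U, h1, h2, h3⟩ := exists_finite_convAct_stable (k := ℂ) x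
    exact ⟨U, h1, h2, fun y hy ↦ h3 _ y hy, fun y hy ↦ h3 _ y hy⟩

theorem one_ne_zero' : (1 : OSLq2 q) ≠ 0 := fun h ↦ by
  simpa using congrArg (Coalgebra.counit (R := ℂ)) h

/-- The Koszul complex of `F f_μ`, `f_ν E`, `f_γ - 1`. -/
theorem hasTrivialKoszulCohomology (hq : ∀ n : ℕ, 0 < n → q ^ n ≠ 1) (s : ℂˣ) (hs : s ^ 2 = q)
    (μ ν γ : ℂˣ) (hγ : ∀ m : ℤ, (γ : ℂ) ^ m = 1 → m = 0) {σ τ : ℂ} (hσ : σ ≠ 0) :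
    HasTrivialKoszulCohomology (convAct (F s hs * f μ)) (convAct (f ν * E s hs))
      (convAct (f γ - 1)) ((γ : ℂ) ^ 2)⁻¹ (((γ : ℂ) ^ 2)⁻¹ - 1) (((μ : ℂ) * ν) ^ 2)⁻¹ τ σ 1 := by
  have hγ0 := γ.ne_zero
  -- The exponent in `c₂` is m + 2 because f_ν acts after E has raised the weight, while f_μ acts
  -- before F.
  refine (isQuantumSl2Module hq s hs).hasTrivialKoszulCohomology (c₁ := fun m ↦ (μ : ℂ) ^ m)
    (c₂ := fun m ↦ (ν : ℂ) ^ (m + 2)) (g := fun m ↦ (γ : ℂ) ^ m - 1)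
    (fun x hx h1 h2 ↦ eq_smul_one_of_invariant hq hs hx h1 h2) (one_mem_weightSpace _)
    one_ne_zero' (convAct_E_one s hs) (convAct_F_one s hs) (fun m ↦ zpow_ne_zero _ μ.ne_zero)
    (fun m ↦ zpow_ne_zero _ ν.ne_zero) (fun m ↦ ⟨fun h ↦ hγ m (sub_eq_zero.mp h), ?_⟩)
    (fun m x hx ↦ ?_) (fun m x hx ↦ ?_) (fun m x hx ↦ ?_) (inv_ne_zero (pow_ne_zero 2 hγ0))
    (fun m ↦ ?_) (fun m ↦ ?_) (inv_ne_zero (pow_ne_zero 2 (mul_ne_zero μ.ne_zero ν.ne_zero)))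
    ?_ hσ (isInternal_col hq)
  · rintro rfl
    simp
  · rw [convAct_comp, Module.End.mul_apply, convAct_f_of_mem hx, map_smul]
  · rw [convAct_comp, Module.End.mul_apply, convAct_f_of_mem (convAct_E_mem_col s hs rfl hx)]
  · rw [convAct_sub, convAct_one, LinearMap.sub_apply, convAct_f_of_mem hx, sub_smul, one_smul]
    rfl
  · simp only [zpow_sub₀ hγ0]
    field_simp
    norm_cast
    ring
  · simp only [zpow_add₀ hγ0]
    field_simp
    norm_cast
    push_cast
    ring
  · have h1 := μ.ne_zero
    have h2 := ν.ne_zero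
    norm_num
    field_simp

end OSLq2

/-! ### Quadratic-linear relations and their duals -/

/-- The coefficients of the quadratic relations `x₂x₀ - αx₀x₂`, `x₂x₁ - α⁻¹x₁x₂`,
`x₁x₀ - κx₀x₁ - τx₂²`. -/
def koszulCoeff {k : Type*} [Field k] (α κ τ : k) : Fin 3 → Matrix (Fin 3) (Fin 3) k :=
  ![!![0, 0, -α; 0, 0, 0; 1, 0, 0], !![0, 0, 0; 0, 0, -α⁻¹; 0, 1, 0],
    !![0, -κ, 0; 1, 0, 0; 0, 0, -τ]]

/-- The linear and quadratic monomials spanning the functionals of degree at most two. -/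
def quadraticMonomials {R : Type*} [Mul R] (x : Fin 3 → R) : Fin 9 → R :=
  ![x 0, x 1, x 2, x 0 * x 0, x 1 * x 1, x 2 * x 2, x 0 * x 2, x 1 * x 2, x 0 * x 1]

section

variable {k A : Type*} [Field k] [Ring A] [Bialgebra k A]

/-- Functionals `X i` with coproducts `1 ⊗ X i + ∑ X j ⊗ f j i`, spanning a quantum tangent space,
which satisfy quadratic-linear relations of Koszul type. -/
structure IsKoszulTangent (X : Fin 3 → WithConv (A →ₗ[k] k)) (f : Fin 3 → Fin 3 → WithConv (A →ₗ[k] k))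
    (α β κ τ σ : k) : Prop where
  ne_zero : α ≠ 0
  X_one : ∀ i, X i 1 = 0
  X_mul : ∀ i x y, X i (x * y) = Coalgebra.counit (R := k) x * X i y + ∑ j, X j x * f j i y
  rel_zero : X 2 * X 0 = α • (X 0 * X 2) + β • X 0
  rel_one : X 1 * X 2 = α • (X 2 * X 1) + β • X 1
  rel_two : X 1 * X 0 = κ • (X 0 * X 1) + τ • (X 2 * X 2) + σ • X 2
  indep : LinearIndependent k (quadraticMonomials X)

theorem LinearIndependent.exists_dual_vectors_conv {ι : Type*} [Finite ι] [DecidableEq ι]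
    {X : ι → WithConv (A →ₗ[k] k)} (h : LinearIndependent k X) :
    ∃ r : ι → A, ∀ i j, X i (r j) = if i = j then 1 else 0 :=
  LinearIndependent.exists_dual_vectors (X := fun i ↦ (X i).ofConv)
    (h.map' (WithConv.linearEquiv k (A →ₗ[k] k)).toLinearMap (LinearEquiv.ker _))

namespace IsKoszulTangent

variable {X : Fin 3 → WithConv (A →ₗ[k] k)} {f : Fin 3 → Fin 3 → WithConv (A →ₗ[k] k)}
  {α β κ τ σ : k} (h : IsKoszulTangent X f α β κ τ σ)
include h

theorem exists_dual_quadratic :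
    ∃ r : Fin 9 → A, ∀ i j, quadraticMonomials X i (r j) = if i = j then 1 else 0 :=
  h.indep.exists_dual_vectors_conv

theorem indep_X : LinearIndependent k X := by
  have := h.indep.comp (Fin.castLE (by norm_num) : Fin 3 → Fin 9) (Fin.castLE_injective _)
  convert this using 1
  ext i
  fin_cases i <;> rfl

theorem exists_dual : ∃ r : Fin 3 → A, ∀ i j, X i (r j) = if i = j then 1 else 0 :=
  h.indep_X.exists_dual_vectors_conv

/-- Expand X_j(rᵢ · x · y) in both bracketings with rᵢ dual to the X's and compare: associativity
makes the matrix of the f's multiplicative. -/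
theorem f_mul (i j : Fin 3) (x y : A) : f i j (x * y) = ∑ l, f i l x * f l j y := by
  obtain ⟨r, hr⟩ := h.exists_dual
  have e := h.X_mul j (r i * x) y
  rw [mul_assoc, h.X_mul j (r i), h.X_mul j x y] at e
  simp only [h.X_mul _ (r i) x, hr, Bialgebra.counit_mul, ite_mul, one_mul, zero_mul,
    Finset.sum_ite_eq', Finset.mem_univ, if_true, add_mul, Finset.sum_add_distrib] at e
  rw [mul_add, mul_assoc, add_assoc, add_right_inj, Finset.mul_sum] at e
  simpa only [mul_assoc, add_right_inj] using e

theorem f_one (i j : Fin 3) : f i j 1 = if i = j then 1 else 0 := by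
  obtain ⟨r, hr⟩ := h.exists_dual
  have e := h.X_mul j (r i) 1
  simp only [mul_one, h.X_one, hr] at e
  simpa [eq_comm] using e

theorem convAct_X_mul (i : Fin 3) (x y : A) : convAct (X i) (x * y) =
    x * convAct (X i) y + ∑ j, convAct (X j) x * convAct (f j i) y := by
  have e := convAct_mul (ι := Option (Fin 3)) (X := X i) (P := fun o ↦ o.elim 1 X)
    (Q := fun o ↦ o.elim (X i) fun j ↦ f j i) (fun x y ↦ by
      rw [Fintype.sum_option, h.X_mul]
      simp) x y
  rw [Fintype.sum_option] at e
  simpa [convAct_one] using e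

theorem convAct_f_mul (i j : Fin 3) (x y : A) :
    convAct (f i j) (x * y) = ∑ l, convAct (f i l) x * convAct (f l j) y :=
  convAct_mul (h.f_mul i j) x y

theorem mul_apply_mul (i j : Fin 3) (x y : A) : (X i * X j) (x * y) =
    Coalgebra.counit (R := k) x * (X i * X j) y + ∑ l, X l x * (f l i * X j) y +
      ∑ m, (X m x * (X i * f m j) y + ∑ l, (X l * X m) x * (f l i * f m j) y) := by
  simp only [← counit_convAct, convAct_comp, Module.End.mul_apply, h.convAct_X_mul, map_add,
    map_sum, Bialgebra.counit_mul]

theorem rel (n : Fin 3) : ∑ i, ∑ j, koszulCoeff α κ τ n i j • (X i * X j) =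
    ![β, -(α⁻¹ * β), σ] n • X n := by
  have hα := h.ne_zero
  fin_cases n
  · simp [koszulCoeff, Fin.sum_univ_three, h.rel_zero]
  · simp [koszulCoeff, Fin.sum_univ_three, h.rel_one]
    match_scalars <;> field_simp
    simp
  · simp [koszulCoeff, Fin.sum_univ_three, h.rel_two]
    module

/-- Comultiplying the quadratic relations. -/
theorem sum_f_mul_f {r : A} (hr : ∀ l, X l r = 0) (n : Fin 3) :
    ∑ l, ∑ m, (X l * X m) r • ∑ i, ∑ j, koszulCoeff α κ τ n i j • (f l i * f m j) = 0 := by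
  ext y
  -- The relation is evaluated at r · y. As all `X l` vanish at r, only ε(r) times the relation at y
  -- and the terms quadratic in r survive.
  have e := congrArg (fun Y : WithConv (A →ₗ[k] k) ↦ Y (r * y)) (h.rel n)
  have e' := congrArg (fun Y : WithConv (A →ₗ[k] k) ↦ Y y) (h.rel n)
  simp only [WithConv.ofConv_sum, WithConv.ofConv_smul, WithConv.ofConv_zero, LinearMap.sum_apply,
    LinearMap.smul_apply, LinearMap.zero_apply, h.mul_apply_mul, h.X_mul, hr, zero_mul,
    Finset.sum_const_zero, add_zero, zero_add, smul_eq_mul] at e e' ⊢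
  have key : ∑ l, ∑ m, (X l * X m) r * ∑ i, ∑ j, koszulCoeff α κ τ n i j * (f l i * f m j) y =
      ∑ i, ∑ j, koszulCoeff α κ τ n i j * ∑ m, ∑ l, (X l * X m) r * (f l i * f m j) y := by
    simp only [Fin.sum_univ_three]
    ring
  rw [key]
  simp only [mul_add, Finset.sum_add_distrib, mul_left_comm (koszulCoeff α κ τ n _ _)
    (Coalgebra.counit (R := k) r), ← Finset.mul_sum, e'] at e
  linear_combination e

/-- Elements satisfying the relations dual to those of the functionals. -/
theorem mul_eq_sum_koszulCoeff {R : Type*} [Ring R] [Algebra k R] {W : Fin 3 → R}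
    (hW : ∀ r, (∀ l, X l r = 0) → ∑ l, ∑ m, (X l * X m) r • (W l * W m) = 0) (i j : Fin 3) :
    W i * W j = ∑ n, koszulCoeff α κ τ n i j • ![W 2 * W 0, W 2 * W 1, W 1 * W 0] n := by
  obtain ⟨r, hr⟩ := h.exists_dual_quadratic
  have e20 (x : A) : (X 2 * X 0) x = α • (X 0 * X 2) x + β • X 0 x := by rw [h.rel_zero]; rfl
  have e21 (x : A) : (X 2 * X 1) x = α⁻¹ • ((X 1 * X 2) x - β • X 1 x) := by
    rw [h.rel_one]
    simp [h.ne_zero]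
  have e10 (x : A) : (X 1 * X 0) x =
      κ • (X 0 * X 1) x + τ • (X 2 * X 2) x + σ • X 2 x := by rw [h.rel_two]; rfl
  -- The monomials 0, 1, 2 are the linear ones, so the remaining six dual elements are killed by all
  -- `X l`. Each of them yields one of the six relations of the dual quadratic algebra.
  have key (t : Fin 9) (ht : 3 ≤ t) : ∑ l, ∑ m, (X l * X m) (r t) • (W l * W m) = 0 := by
    refine hW _ fun l ↦ ?_
    have h1 := hr (Fin.castLE (by norm_num) l) t
    rw [if_neg (by
      rintro rfl
      have : 3 ≤ l.1 := ht
      omega)] at h1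
    rw [← h1]
    fin_cases l <;> rfl
  have r0 (t) : X 0 (r t) = if 0 = t then 1 else 0 := hr 0 t
  have r1 (t) : X 1 (r t) = if 1 = t then 1 else 0 := hr 1 t
  have r2 (t) : X 2 (r t) = if 2 = t then 1 else 0 := hr 2 t
  have r3 (t) : (X 0 * X 0) (r t) = if 3 = t then 1 else 0 := hr 3 t
  have r4 (t) : (X 1 * X 1) (r t) = if 4 = t then 1 else 0 := hr 4 t
  have r5 (t) : (X 2 * X 2) (r t) = if 5 = t then 1 else 0 := hr 5 t
  have r6 (t) : (X 0 * X 2) (r t) = if 6 = t then 1 else 0 := hr 6 t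
  have r7 (t) : (X 1 * X 2) (r t) = if 7 = t then 1 else 0 := hr 7 t
  have r8 (t) : (X 0 * X 1) (r t) = if 8 = t then 1 else 0 := hr 8 t
  simp only [Fin.sum_univ_three, e20, e21, e10, r0, r1, r2, r3, r4, r5, r6, r7, r8] at key
  have k3 := key 3 (by decide)
  have k4 := key 4 (by decide)
  have k5 := key 5 (by decide)
  have k6 := key 6 (by decide)
  have k7 := key 7 (by decide)
  have k8 := key 8 (by decide)
  simp at k3 k4 k5 k6 k7 k8
  fin_cases i <;> fin_cases j <;> simp [koszulCoeff, Fin.sum_univ_three]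
  · exact k3
  · linear_combination (norm := module) k8
  · linear_combination (norm := module) k6
  · exact k4
  · linear_combination (norm := module) k7
  · linear_combination (norm := module) k5

end IsKoszulTangent

end

/-! ### Left-covariant calculi as free modules on invariant forms -/

theorem comul_convAct {k A : Type*} [Field k] [Ring A] [Bialgebra k A] (X : WithConv (A →ₗ[k] k))
    (a : A) : Coalgebra.comul (convAct X a) = (convAct X).lTensor A (Coalgebra.comul (R := k) a) := by
  have key (t : A ⊗[k] A) : TensorProduct.rid k _ (X.ofConv.lTensor (A ⊗[k] A)
      (Coalgebra.comul.rTensor A t)) =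
      Coalgebra.comul (TensorProduct.rid k A (X.ofConv.lTensor A t)) := by
    induction t with
    | zero => simp
    | add s t hs ht => simp only [map_add, hs, ht]
    | tmul x y => simp
  have key2 (t : A ⊗[k] A) : TensorProduct.rid k _ (X.ofConv.lTensor (A ⊗[k] A)
      ((TensorProduct.assoc k A A A).symm (Coalgebra.comul.lTensor A t))) =
      (convAct X).lTensor A t := by
    induction t with
    | zero => simp
    | add s t hs ht => simp only [map_add, hs, ht]
    | tmul x y =>
      have r := Coalgebra.Repr.arbitrary k y
      rw [LinearMap.lTensor_tmul, LinearMap.lTensor_tmul, convAct_repr X r, ← r.eq]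
      simp [TensorProduct.tmul_sum]
  rw [convAct_apply, ← key, ← Coalgebra.coassoc_symm_apply, key2]

/-- Needed where 𝒜 acts through an algebra map, such as the coproduct on 𝒜 ⊗ Γ or the inclusion into
the forms, and no module instance is at hand. -/
theorem sum_apply_smul_eq_zero_of_algHom {k A ι N : Type*} [Field k] [Ring A] [HopfAlgebra k A]
    [Fintype ι] [AddCommGroup N] [Module k N] (ρ : A →ₐ[k] Module.End k N)
    {X : ι → WithConv (A →ₗ[k] k)} {v : ι → N}
    (h : ∀ a, ∑ i, ρ (convAct (X i) a) (v i) = 0) (a : A) : ∑ i, X i a • v i = 0 := by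
  let _ : Module A N := Module.compHom N ρ.toRingHom
  have : IsScalarTower k A N := ⟨fun c a n ↦ by
    change ρ (c • a) n = c • ρ a n
    rw [map_smul, LinearMap.smul_apply]⟩
  exact sum_apply_smul_eq_zero h a

namespace FODC

variable {k : Type u} {A : Type v} {Γ : Type w} [Field k] [Ring A] [AddCommGroup Γ] [Module k Γ]
  [Module A Γ] [Module Aᵐᵒᵖ Γ] [HopfAlgebra k A] [IsScalarTower k A Γ] [IsScalarTower k Aᵐᵒᵖ Γ]
  (C : FODC k A Γ)

theorem ω_repr {ι : Type*} {a : A} (r : Coalgebra.Repr k a ι) :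
    C.ω a = ∑ i ∈ r.index, HopfAlgebra.antipode k (r.left i) • C.d (r.right i) := by
  rw [ω, LinearMap.comp_apply, ← r.eq]
  simp

theorem ω_one : C.ω 1 = 0 := by
  simp [ω, Algebra.TensorProduct.one_def, d_one]

/-- In Sweedler notation a₍₁₎S(a₍₂₎) da₍₃₎ = da. -/
theorem sum_smul_ω {ι : Type*} {a : A} (r : Coalgebra.Repr k a ι) :
    ∑ i ∈ r.index, r.left i • C.ω (r.right i) = C.d a := by
  have key (t : A ⊗[k] A) : TensorProduct.lift (LinearMap.mk₂ k (fun (a b : A) ↦ a • C.ω b)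
      (by simp [add_smul]) (by simp) (by simp)
      (fun c a b ↦ by rw [map_smul, smul_algebra_smul_comm])) t =
      C.smulD ((LinearMap.mul' k A ∘ₗ (HopfAlgebra.antipode k).lTensor A).rTensor A
          ((TensorProduct.assoc k A A A).symm (Coalgebra.comul.lTensor A t))) := by
    induction t with
    | zero => simp
    | add s t hs ht => simp only [map_add, hs, ht]
    | tmul x y =>
      have r := Coalgebra.Repr.arbitrary k y
      rw [LinearMap.lTensor_tmul, ← r.eq]
      simp [C.ω_repr r, TensorProduct.tmul_sum, Finset.smul_sum, mul_smul]
  have h := key (Coalgebra.comul a)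
  rw [Coalgebra.coassoc_symm_apply, ← LinearMap.comp_apply (LinearMap.rTensor A _),
    ← LinearMap.rTensor_comp, LinearMap.comp_assoc,
    HopfAlgebra.mul_antipode_lTensor_comul, LinearMap.rTensor_comp, LinearMap.comp_apply,
    Coalgebra.rTensor_counit_comul, ← r.eq] at h
  simpa using h

theorem leftMul_tmul (a b c : A) (ρ : Γ) :
    leftMul k A Γ (a ⊗ₜ b) (c ⊗ₜ ρ) = (a * c) ⊗ₜ (b • ρ) := rfl

theorem leftMul_mul (s t : A ⊗[k] A) (x : A ⊗[k] Γ) :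
    leftMul k A Γ (s * t) x = leftMul k A Γ s (leftMul k A Γ t x) := by
  induction s with
  | zero => simp
  | add s s' hs hs' => simp only [add_mul, map_add, LinearMap.add_apply, hs, hs']
  | tmul a b =>
    induction t with
    | zero => simp
    | add s s' hs hs' => simp only [mul_add, map_add, LinearMap.add_apply, hs, hs']
    | tmul c d =>
      induction x with
      | zero => simp
      | add s s' hs hs' => simp only [map_add, hs, hs']
      | tmul x ρ => simp [leftMul_tmul, mul_assoc, mul_smul]

theorem leftMul_one (x : A ⊗[k] Γ) : leftMul k A Γ 1 x = x := by
  induction x with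
  | zero => simp
  | add s s' hs hs' => simp only [map_add, hs, hs']
  | tmul x ρ => simp [Algebra.TensorProduct.one_def, leftMul_tmul]

theorem rightMul_one (x : A ⊗[k] Γ) : rightMul k A Γ 1 x = x := by
  induction x with
  | zero => simp
  | add s s' hs hs' => simp only [map_add, hs, hs']
  | tmul x ρ =>
    rw [Algebra.TensorProduct.one_def]
    change (x * 1) ⊗ₜ[k] (MulOpposite.op (1 : A) • ρ) = _
    simp

variable (k A Γ) in
/-- The diagonal left action of `A` on `A ⊗ Γ`. -/
noncomputable def comulAct : A →ₐ[k] Module.End k (A ⊗[k] Γ) :=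
  AlgHom.ofLinearMap (leftMul k A Γ ∘ₗ Coalgebra.comul)
    (LinearMap.ext fun x ↦ by
      rw [LinearMap.comp_apply, Bialgebra.comul_one, leftMul_one, Module.End.one_apply])
    (fun a b ↦ LinearMap.ext fun x ↦ by
      rw [LinearMap.comp_apply, Bialgebra.comul_mul, leftMul_mul]
      rfl)

theorem comulAct_apply (a : A) (x : A ⊗[k] Γ) :
    comulAct k A Γ a x = leftMul k A Γ (Coalgebra.comul a) x := rfl

variable {C} {X : Fin 3 → WithConv (A →ₗ[k] k)} {f : Fin 3 → Fin 3 → WithConv (A →ₗ[k] k)}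
  {α β κ τ σ : k}

/-- A left-covariant calculus is free over `A`, with a basis of left-invariant one-forms. -/
theorem IsLeftCovariant.exists_basis [SMulCommClass A Aᵐᵒᵖ Γ] (hC : C.IsLeftCovariant)
    (h : IsKoszulTangent X f α β κ τ σ) (hX : C.tangentSpace = Submodule.span k (Set.range X)) :
    ∃ w : Module.Basis (Fin 3) A Γ, (∀ a, C.d a = ∑ i, convAct (X i) a • w i) ∧
      ∀ i a, MulOpposite.op a • w i = ∑ j, convAct (f i j) a • w j := by
  obtain ⟨r, hr⟩ := h.exists_dual
  set w : Fin 3 → Γ := fun i ↦ C.ω (r i) with hw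
  have hφ (i : Fin 3) : ∃ φ : Γ →ₗ[k] k, X i = .toConv (φ ∘ₗ C.ω) := by
    have : X i ∈ C.tangentSpace := hX ▸ Submodule.subset_span ⟨i, rfl⟩
    exact this
  choose φ hφ using hφ
  have hφw (i j : Fin 3) : φ i (w j) = if i = j then 1 else 0 := by
    rw [← hr, hφ]
    rfl
  -- Tested against every linear ψ on Γ: ψ ∘ ω lies in the span of the X's, and its coefficients are
  -- read off at the dual elements.
  have hω (a : A) : C.ω a = ∑ i, X i a • w i := by
    rw [← sub_eq_zero, ← Module.forall_dual_apply_eq_zero_iff k]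
    intro ψ
    have : WithConv.toConv (ψ ∘ₗ C.ω) ∈ C.tangentSpace := ⟨ψ, rfl⟩
    rw [hX, Submodule.mem_span_range_iff_exists_fun] at this
    obtain ⟨c, hc⟩ := this
    have h1 (x : A) : ψ (C.ω x) = ∑ i, c i * X i x := by
      have := congrArg (fun Y : WithConv (A →ₗ[k] k) ↦ Y x) hc
      simpa using this.symm
    rw [map_sub, map_sum, h1]
    simp [hw, h1, hr, mul_comm]
  have hd (a : A) : C.d a = ∑ i, convAct (X i) a • w i := by
    have t := Coalgebra.Repr.arbitrary k a
    rw [← C.sum_smul_ω t]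
    simp only [hω, convAct_repr _ t, Finset.smul_sum, Finset.sum_smul, smul_assoc]
    rw [Finset.sum_comm]
    simp only [smul_algebra_smul_comm]
  obtain ⟨ΔL, hΔ⟩ := hC
  have hΔ' (a : A) (ρ : Γ) : ΔL (a • ρ) = comulAct k A Γ a (ΔL ρ) := by
    have e (a b : A) : ΔL (a • C.d b) =
        comulAct k A Γ a (C.d.lTensor A (Coalgebra.comul b)) := by
      have := hΔ a b 1
      rwa [MulOpposite.op_one, one_smul, Bialgebra.comul_one, rightMul_one] at this
    obtain ⟨t, rfl⟩ := C.smulD_surjective ρ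
    induction t with
    | zero => simp
    | add s t hs ht => simp only [map_add, smul_add, hs, ht]
    | tmul x y => rw [smulD_tmul, ← mul_smul, e, e, map_mul, Module.End.mul_apply]
  -- The coaction of da, computed from covariance and from da = ∑ (Xᵢ ▷ a) wᵢ, gives a relation with
  -- coefficients Xᵢ ▷ a; stripping these leaves the invariance of each wⱼ.
  have hΔw (j : Fin 3) : ΔL (w j) = 1 ⊗ₜ w j := by
    have e := sum_apply_smul_eq_zero_of_algHom (comulAct k A Γ) (X := X)
      (v := fun i ↦ ΔL (w i) - 1 ⊗ₜ w i) (fun a ↦ by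
        have e1 : C.d.lTensor A (Coalgebra.comul a) =
            ∑ i, comulAct k A Γ (convAct (X i) a) (1 ⊗ₜ w i) := by
          simp only [comulAct_apply, comul_convAct]
          induction Coalgebra.comul (R := k) a with
          | zero => simp
          | add s t hs ht =>
            simp only [map_add, hs, ht, LinearMap.add_apply, Finset.sum_add_distrib]
          | tmul x y => simp [leftMul_tmul, hd, TensorProduct.tmul_sum]
        have e2 := hΔ 1 a 1
        rw [MulOpposite.op_one, one_smul, one_smul, Bialgebra.comul_one, rightMul_one, leftMul_one,
          e1, hd, map_sum] at e2
        simp only [hΔ'] at e2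
        simp only [map_sub, Finset.sum_sub_distrib, e2, sub_self]) (r j)
    simpa [hr, sub_eq_zero] using e
  -- P ∘ ΔL sends a wᵢ to ε(a) wᵢ. Applied to the second leg of ΔL(a wᵢ) it returns a ⊗ wᵢ, from
  -- which the coefficient a can be recovered; this gives freeness.
  set P : A ⊗[k] Γ →ₗ[k] Γ := TensorProduct.lift (LinearMap.mk₂ k
    (fun (a : A) (ρ : Γ) ↦ HopfAlgebra.antipode k a • ρ) (by simp [add_smul]) (by simp)
    (by simp) (fun c a b ↦ by rw [smul_algebra_smul_comm])) with hP
  have hPΔ (a : A) (i : Fin 3) : P (ΔL (a • w i)) = Coalgebra.counit (R := k) a • w i := by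
    have key (t : A ⊗[k] A) : P (leftMul k A Γ t (1 ⊗ₜ w i)) =
        LinearMap.mul' k A ((HopfAlgebra.antipode k).rTensor A t) • w i := by
      induction t with
      | zero => simp
      | add s t hs ht => simp only [map_add, LinearMap.add_apply, hs, ht, add_smul]
      | tmul x y => simp [hP, leftMul_tmul, mul_smul]
    rw [hΔ', hΔw, comulAct_apply, key, HopfAlgebra.mul_antipode_rTensor_comul_apply, algebraMap_smul]
  have hT (a : A) (i : Fin 3) : (P ∘ₗ ΔL).lTensor A (ΔL (a • w i)) = a ⊗ₜ w i := by
    have key (t : A ⊗[k] A) : (P ∘ₗ ΔL).lTensor A (leftMul k A Γ t (1 ⊗ₜ w i)) =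
        TensorProduct.rid k A (Coalgebra.counit.lTensor A t) ⊗ₜ w i := by
      induction t with
      | zero => simp
      | add s t hs ht => simp only [map_add, LinearMap.add_apply, hs, ht, TensorProduct.add_tmul]
      | tmul x y => simp [leftMul_tmul, hPΔ, TensorProduct.smul_tmul']
    rw [hΔ', hΔw, comulAct_apply, key, Coalgebra.lTensor_counit_comul]
    simp
  have hli : LinearIndependent A w := by
    rw [Fintype.linearIndependent_iff]
    intro a ha j
    have e := congrArg (fun x ↦ TensorProduct.rid k A ((φ j).lTensor A
      ((P ∘ₗ ΔL).lTensor A (ΔL x)))) ha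
    simpa only [map_sum, hT, LinearMap.lTensor_tmul, hφw, TensorProduct.rid_tmul, ite_smul,
      one_smul, zero_smul, Finset.sum_ite_eq, Finset.mem_univ, if_true, map_zero] using e
  have hsp : ⊤ ≤ Submodule.span A (Set.range w) := by
    intro ρ _
    obtain ⟨t, rfl⟩ := C.smulD_surjective ρ
    induction t with
    | zero => simp
    | add s t hs ht => rw [map_add]; exact add_mem (hs trivial) (ht trivial)
    | tmul x y =>
      rw [smulD_tmul, hd]
      exact Submodule.smul_mem _ _ (Submodule.sum_mem _ fun i _ ↦ Submodule.smul_mem _ _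
        (Submodule.subset_span ⟨i, rfl⟩))
  refine ⟨Module.Basis.mk hli hsp, fun a ↦ by simpa using hd a, fun i a ↦ ?_⟩
  simp only [Module.Basis.mk_apply]
  -- The Leibniz rule for d(xa), compared with the product rule of the X's, is a relation with
  -- coefficients Xᵢ ▷ x.
  have e := sum_apply_smul_eq_zero (X := X)
    (v := fun i ↦ MulOpposite.op a • w i - ∑ j, convAct (f i j) a • w j) (fun x ↦ by
      have e1 := C.leibniz x a
      simp only [hd, h.convAct_X_mul, add_smul, Finset.sum_add_distrib, Finset.smul_sum,
        Finset.sum_smul, mul_smul] at e1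
      rw [add_comm, add_left_inj, Finset.sum_comm] at e1
      simp only [smul_sub, Finset.smul_sum, Finset.sum_sub_distrib]
      simp only [fun (b : A) ρ ↦ smul_comm b (MulOpposite.op a) (ρ : Γ)]
      rw [← e1, sub_self]) (r i)
  simpa [hr, sub_eq_zero] using e

end FODC

/-! ### Maurer-Cartan relations and a model of the forms -/

namespace FODC

variable {k : Type u} {A : Type v} {Γ : Type w} [Field k] [Ring A] [AddCommGroup Γ] [Module k Γ]
  [Module A Γ] [Module Aᵐᵒᵖ Γ] [HopfAlgebra k A] [IsScalarTower k A Γ] [IsScalarTower k Aᵐᵒᵖ Γ]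
  {C : FODC k A Γ}

/-- A basis of one-forms for which the functionals `X i` give the differential and the functionals
`f i j` the right action. -/
structure IsFrame (C : FODC k A Γ) (X : Fin 3 → WithConv (A →ₗ[k] k))
    (f : Fin 3 → Fin 3 → WithConv (A →ₗ[k] k)) (w : Module.Basis (Fin 3) A Γ) : Prop where
  d_eq : ∀ a, C.d a = ∑ i, convAct (X i) a • w i
  op_smul : ∀ i a, MulOpposite.op a • w i = ∑ j, convAct (f i j) a • w j

variable {X : Fin 3 → WithConv (A →ₗ[k] k)} {f : Fin 3 → Fin 3 → WithConv (A →ₗ[k] k)}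
  {α β κ τ σ : k} (h : IsKoszulTangent X f α β κ τ σ) {w : Module.Basis (Fin 3) A Γ}
  (hw : C.IsFrame X f w)

section relations

include hw

theorem IsFrame.ofForm_d (a : A) :
    C.ofForm (C.d a) = ∑ i, C.ofAlg (convAct (X i) a) * C.ofForm (w i) := by
  simp only [hw.d_eq, map_sum, ofAlg_mul_ofForm]

/-- The Maurer-Cartan formula. -/
theorem IsFrame.maurerCartan [SMulCommClass A Aᵐᵒᵖ Γ] (a : A) :
    ∑ j, ∑ i, (X j * X i) a • (C.ofForm (w j) * C.ofForm (w i)) +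
      ∑ i, X i a • C.D (C.ofForm (w i)) = 0 := by
  -- The identity d(da) = 0 has coefficients XⱼXᵢ ▷ a and Xᵢ ▷ a, which are stripped to scalars.
  have e := sum_apply_smul_eq_zero_of_algHom ((Algebra.lmul k C.Forms).comp C.ofAlg)
    (X := Sum.elim (fun p : Fin 3 × Fin 3 ↦ X p.1 * X p.2) X)
    (v := Sum.elim (fun p ↦ C.ofForm (w p.1) * C.ofForm (w p.2)) fun i ↦ C.D (C.ofForm (w i)))
    (fun a ↦ by
      have e1 := C.D_D (C.ofAlg a)
      simp only [D_ofAlg, hw.ofForm_d, map_sum, D_mul, parity_ofAlg, Finset.sum_mul,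
        Finset.sum_add_distrib] at e1
      rw [Finset.sum_comm] at e1
      simpa [Fintype.sum_sum_type, Fintype.sum_prod_type, convAct_comp, mul_assoc] using e1) a
  simpa [Fintype.sum_sum_type, Fintype.sum_prod_type] using e

include h

theorem IsFrame.ofForm_mul_ofForm [SMulCommClass A Aᵐᵒᵖ Γ] (i j : Fin 3) :
    C.ofForm (w i) * C.ofForm (w j) = ∑ n, koszulCoeff α κ τ n i j •
      ![C.ofForm (w 2) * C.ofForm (w 0), C.ofForm (w 2) * C.ofForm (w 1),
        C.ofForm (w 1) * C.ofForm (w 0)] n :=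
  h.mul_eq_sum_koszulCoeff (W := fun i ↦ C.ofForm (w i)) (fun r hr ↦ by
    simpa [hr] using hw.maurerCartan r) i j

/-- Maurer-Cartan at the dual element rₙ isolates dwₙ. The quadratic part, reordered into the three
chosen products, evaluates the quadratic relations of the X's at rₙ, which leave just their linear
terms. -/
theorem IsFrame.D_ofForm_basis [SMulCommClass A Aᵐᵒᵖ Γ] (n : Fin 3) :
    C.D (C.ofForm (w n)) = -![β, -(α⁻¹ * β), σ] n •
      ![C.ofForm (w 2) * C.ofForm (w 0), C.ofForm (w 2) * C.ofForm (w 1),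
        C.ofForm (w 1) * C.ofForm (w 0)] n := by
  obtain ⟨r, hr⟩ := h.exists_dual
  have e := hw.maurerCartan (r n)
  simp only [hr, ite_smul, one_smul, zero_smul, Finset.sum_ite_eq', Finset.mem_univ, if_true] at e
  rw [eq_comm, neg_smul, neg_eq_iff_add_eq_zero, ← e, add_left_inj]
  have e2 (l : Fin 3) : ∑ i, ∑ j, koszulCoeff α κ τ l i j * (X i * X j) (r n) =
      ![β, -(α⁻¹ * β), σ] l * if l = n then 1 else 0 := by
    rw [← hr]
    simpa using congrArg (fun Y : WithConv (A →ₗ[k] k) ↦ Y (r n)) (h.rel l)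
  have hm := hw.ofForm_mul_ofForm h
  generalize ![C.ofForm (w 2) * C.ofForm (w 0), C.ofForm (w 2) * C.ofForm (w 1),
        C.ofForm (w 1) * C.ofForm (w 0)] = θ at hm ⊢
  simp only [hm]
  have e3 : ∑ j, ∑ i, (X j * X i) (r n) • ∑ l, koszulCoeff α κ τ l j i • θ l =
      ∑ l, (∑ i, ∑ j, koszulCoeff α κ τ l i j * (X i * X j) (r n)) • θ l := by
    simp only [Fin.sum_univ_three]
    module
  rw [e3]
  simp only [e2, mul_ite, mul_one, mul_zero, ite_smul, zero_smul, Finset.sum_ite_eq',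
    Finset.mem_univ, if_true]

end relations

section model

variable {M : Type*} [Ring M] [Algebra k M]

/-- The value of the one-form `w i` in a model of the algebra of forms. -/
noncomputable def modelForm (f : Fin 3 → Fin 3 → WithConv (A →ₗ[k] k)) (e : Fin 3 → M) (i : Fin 3) :
    Module.End k A ⊗[k] M := ∑ j, convAct (f i j) ⊗ₜ e j

/-- Left multiplication. -/
noncomputable def modelAlg (k A M : Type*) [Field k] [Ring A] [Algebra k A] [Ring M] [Algebra k M] :
    A →ₐ[k] Module.End k A ⊗[k] M :=
  Algebra.TensorProduct.includeLeft.comp (Algebra.lmul k A)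

theorem modelAlg_apply (a : A) : modelAlg k A M a = Algebra.lmul k A a ⊗ₜ 1 := rfl

/-- A one-form in the model. -/
noncomputable def modelMap (w : Module.Basis (Fin 3) A Γ) (f : Fin 3 → Fin 3 → WithConv (A →ₗ[k] k))
    (e : Fin 3 → M) : Γ →ₗ[k] Module.End k A ⊗[k] M where
  toFun := fun ρ ↦ ∑ i, modelAlg k A M (w.repr ρ i) * modelForm f e i
  map_add' := fun x y ↦ by simp [add_mul, Finset.sum_add_distrib]
  map_smul' := fun c x ↦ by
    have e1 (i : Fin 3) : w.repr (c • x) i = c • w.repr x i := by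
      rw [algebra_compatible_smul A c x, map_smul, Finsupp.smul_apply, algebraMap_smul]
    simp only [e1, map_smul, smul_mul_assoc, ← Finset.smul_sum, RingHom.id_apply]

theorem modelMap_apply (e : Fin 3 → M) (ρ : Γ) :
    modelMap w f e ρ = ∑ i, modelAlg k A M (w.repr ρ i) * modelForm f e i := rfl

theorem modelMap_basis (e : Fin 3 → M) (i : Fin 3) :
    modelMap w f e (w i) = modelForm f e i := by
  rw [modelMap_apply, Finset.sum_eq_single i] <;> simp +contextual [Finsupp.single_apply, eq_comm]

theorem modelMap_smul (e : Fin 3 → M) (a : A) (ρ : Γ) :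
    modelMap w f e (a • ρ) = modelAlg k A M a * modelMap w f e ρ := by
  simp [modelMap_apply, Finset.mul_sum, mul_assoc]

include h in
theorem modelForm_mul_modelAlg (e : Fin 3 → M) (i : Fin 3) (a : A) :
    modelForm f e i * modelAlg k A M a =
      ∑ j, modelAlg k A M (convAct (f i j) a) * modelForm f e j := by
  have key (j : Fin 3) : convAct (f i j) * Algebra.lmul k A a =
      ∑ l, Algebra.lmul k A (convAct (f i l) a) * convAct (f l j) :=
    LinearMap.ext fun x ↦ by simpa using h.convAct_f_mul i j a x
  simp only [modelForm, modelAlg_apply, Finset.sum_mul, Finset.mul_sum,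
    Algebra.TensorProduct.tmul_mul_tmul, mul_one, one_mul, key, TensorProduct.sum_tmul]
  exact Finset.sum_comm

include h hw in
theorem modelMap_op_smul [SMulCommClass A Aᵐᵒᵖ Γ] (e : Fin 3 → M) (a : A) (ρ : Γ) :
    modelMap w f e (MulOpposite.op a • ρ) = modelMap w f e ρ * modelAlg k A M a := by
  have key (b : A) (i : Fin 3) : modelMap w f e (MulOpposite.op a • b • w i) =
      modelMap w f e (b • w i) * modelAlg k A M a := by
    rw [← smul_comm, hw.op_smul, Finset.smul_sum, map_sum, modelMap_smul, modelMap_basis, mul_assoc,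
      modelForm_mul_modelAlg h, Finset.mul_sum]
    simp only [modelMap_smul, modelMap_basis]
  rw [← w.sum_repr ρ, Finset.smul_sum, map_sum, map_sum, Finset.sum_mul]
  exact Finset.sum_congr rfl fun i _ ↦ key _ i

variable {e : Fin 3 → M} (he : ∀ i j, e i * e j = ∑ n, koszulCoeff α κ τ n i j •
  ![e 2 * e 0, e 2 * e 1, e 1 * e 0] n)

include h he in
-- Multiplied out, the coefficient of each product of generators is the expression in
-- `IsKoszulTangent.sum_f_mul_f`: the twist by the f's respects the quadratic relations.
theorem modelForm_mul_modelForm (i j : Fin 3) : modelForm f e i * modelForm f e j =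
    ∑ n, koszulCoeff α κ τ n i j • ![modelForm f e 2 * modelForm f e 0,
      modelForm f e 2 * modelForm f e 1, modelForm f e 1 * modelForm f e 0] n := by
  refine h.mul_eq_sum_koszulCoeff (W := modelForm f e) (fun r hr ↦ ?_) i j
  generalize ![e 2 * e 0, e 2 * e 1, e 1 * e 0] = θ at he
  have key (l m : Fin 3) : modelForm f e l * modelForm f e m = ∑ n, (∑ i, ∑ j,
      koszulCoeff α κ τ n i j • convAct (f l i * f m j)) ⊗ₜ[k] θ n := by
    simp only [modelForm, Finset.sum_mul_sum, Algebra.TensorProduct.tmul_mul_tmul, he,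
      TensorProduct.sum_tmul, TensorProduct.tmul_sum, TensorProduct.tmul_smul,
      ← TensorProduct.smul_tmul', convAct_comp]
    simp only [Fin.sum_univ_three]
    abel
  have key2 (n : Fin 3) : ∑ l, ∑ m, (X l * X m) r • ∑ i, ∑ j,
      koszulCoeff α κ τ n i j • convAct (f l i * f m j) = 0 := by
    have := congrArg (convActHom k A) (h.sum_f_mul_f hr n)
    simpa only [map_sum, map_smul, convActHom_apply, map_zero] using this
  have key3 (P : Fin 3 → Fin 3 → k) (Y : Fin 3 → Fin 3 → Fin 3 → Module.End k A) :
      ∑ l, ∑ m, P l m • ∑ n, Y n l m ⊗ₜ[k] θ n = ∑ n, (∑ l, ∑ m, P l m • Y n l m) ⊗ₜ[k] θ n := by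
    simp only [TensorProduct.sum_tmul, ← TensorProduct.smul_tmul', Fin.sum_univ_three, smul_add,
      TensorProduct.add_tmul]
    abel
  simp only [key, key3 (fun l m ↦ (X l * X m) r) (fun n l m ↦ ∑ i, ∑ j,
    koszulCoeff α κ τ n i j • convAct (f l i * f m j)), key2, TensorProduct.zero_tmul,
    Finset.sum_const_zero]

include hw in
theorem modelMap_d (e : Fin 3 → M) (a : A) : modelMap w f e (C.d a) =
    ∑ i, modelAlg k A M (convAct (X i) a) * modelForm f e i := by
  simp only [hw.d_eq, map_sum, modelMap_smul, modelMap_basis]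

include h hw he in
-- For t = ∑ x ⊗ y, the image of ∑ dx ⊗ dy depends only on the coefficients ∑ x (Xⱼ ▷ y) of ∑ x dy,
-- as `main` shows. Hence no relation beyond the quadratic ones has to be checked in the model.
theorem modelMap_dd [SMulCommClass A Aᵐᵒᵖ Γ] (t : A ⊗[k] A) (ht : C.smulD t = 0) :
    LinearMap.mul' k (Module.End k A ⊗[k] M) (TensorProduct.map (modelMap w f e ∘ₗ C.d)
      (modelMap w f e ∘ₗ C.d) t) = 0 := by
  set S : Fin 3 → A ⊗[k] A →ₗ[k] A := fun j ↦ LinearMap.mul' k A ∘ₗ (convAct (X j)).lTensor A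
    with hS
  set θ := ![modelForm f e 2 * modelForm f e 0, modelForm f e 2 * modelForm f e 1,
    modelForm f e 1 * modelForm f e 0] with hθ
  have hm := modelForm_mul_modelForm h he
  rw [← hθ] at hm
  clear_value θ
  have hSt : ∀ j, S j t = 0 := by
    have (t : A ⊗[k] A) : C.smulD t = ∑ j, S j t • w j := by
      induction t with
      | zero => simp
      | add s t hs ht => simp only [map_add, hs, ht, add_smul, Finset.sum_add_distrib]
      | tmul x y => simp [hS, hw.d_eq, Finset.smul_sum, mul_smul]
    rw [this] at ht
    exact Fintype.linearIndependent_iff.mp w.linearIndependent _ ht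
  have hrel (y : A) : ∑ i, ∑ j, modelAlg k A M (convAct (X j) (convAct (X i) y)) *
      (modelForm f e j * modelForm f e i) =
      ∑ n, ![β, -(α⁻¹ * β), σ] n • (modelAlg k A M (convAct (X n) y) * θ n) := by
    have e1 (n : Fin 3) : ∑ i, ∑ j, koszulCoeff α κ τ n i j •
        modelAlg k A M (convAct (X i) (convAct (X j) y)) =
        ![β, -(α⁻¹ * β), σ] n • modelAlg k A M (convAct (X n) y) := by
      have := congrArg (fun Y ↦ modelAlg k A M (convActHom k A Y y)) (h.rel n)
      simpa only [map_sum, map_smul, map_mul, convActHom_apply, LinearMap.sum_apply,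
        LinearMap.smul_apply, Module.End.mul_apply] using this
    simp only [← smul_mul_assoc, ← e1, hm]
    simp only [Fin.sum_univ_three, mul_add, add_mul, smul_mul_assoc, mul_smul_comm]
    abel
  have main (t : A ⊗[k] A) : LinearMap.mul' k (Module.End k A ⊗[k] M)
      (TensorProduct.map (modelMap w f e ∘ₗ C.d) (modelMap w f e ∘ₗ C.d) t) =
      ∑ j, modelMap w f e (C.d (S j t)) * modelForm f e j -
        ∑ n, ![β, -(α⁻¹ * β), σ] n • (modelAlg k A M (S n t) * θ n) := by
    induction t with
    | zero => simp
    | add s t hs ht =>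
      simp only [map_add, hs, ht, add_mul, Finset.sum_add_distrib, smul_add]
      abel
    | tmul x y =>
      have e1 (j : Fin 3) : S j (x ⊗ₜ y) = x * convAct (X j) y := rfl
      simp only [TensorProduct.map_tmul, LinearMap.comp_apply, LinearMap.mul'_apply, e1, map_mul,
        C.leibniz, map_add, add_mul, modelMap_op_smul h hw, modelMap_smul, Finset.sum_add_distrib,
        mul_assoc]
      rw [← Finset.mul_sum, ← modelMap_d hw]
      simp only [← mul_smul_comm, ← Finset.mul_sum] at hrel ⊢
      rw [← hrel]
      simp only [modelMap_d hw, Finset.sum_mul, mul_assoc]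
      rw [eq_comm, sub_eq_iff_eq_add]
  rw [main]
  simp [hSt]

end model

end FODC

/-! ### Independence of the invariant two- and three-forms -/

section

variable {k : Type*} [Field k]

/-- Left multiplication by the generators of the quadratic algebra with the relations
`koszulCoeff α κ τ`, with respect to the basis
`1, e₀, e₁, e₂, e₂e₀, e₂e₁, e₁e₀, e₂e₁e₀`. -/
def koszulMatrix (α κ τ : k) : Fin 3 → Matrix (Fin 8) (Fin 8) k :=
  ![.single 1 0 1 + .single 6 2 (-κ) + .single 4 3 (-α) + .single 7 5 (α * κ),
    .single 2 0 1 + .single 6 1 1 + .single 5 3 (-α⁻¹) + .single 7 4 (-α⁻¹),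
    .single 3 0 1 + .single 4 1 1 + .single 5 2 1 + .single 6 3 (-τ) + .single 7 6 1]

theorem koszulMatrix_mul (α κ τ : k) (hα : α ≠ 0) (i j : Fin 3) :
    koszulMatrix α κ τ i * koszulMatrix α κ τ j = ∑ n, koszulCoeff α κ τ n i j •
      ![koszulMatrix α κ τ 2 * koszulMatrix α κ τ 0, koszulMatrix α κ τ 2 * koszulMatrix α κ τ 1,
        koszulMatrix α κ τ 1 * koszulMatrix α κ τ 0] n := by
  have hn (p r : Fin 8) (c : k) : Matrix.single p r (-c) = -Matrix.single p r c :=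
    map_neg (Matrix.singleAddMonoidHom p r) c
  have hκ : α * κ * α⁻¹ = κ := by field_simp
  fin_cases i <;> fin_cases j <;>
    simp [hn, hκ, koszulMatrix, koszulCoeff, mul_add, add_mul, Fin.sum_univ_three, Matrix.smul_single,
      Matrix.single_mul_single_of_ne, hα]

end

namespace FODC

variable {k : Type u} {A : Type v} {Γ : Type w} [Field k] [Ring A] [AddCommGroup Γ] [Module k Γ]
  [Module A Γ] [Module Aᵐᵒᵖ Γ] [HopfAlgebra k A] [IsScalarTower k A Γ] [IsScalarTower k Aᵐᵒᵖ Γ]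
  {C : FODC k A Γ} {X : Fin 3 → WithConv (A →ₗ[k] k)} {f : Fin 3 → Fin 3 → WithConv (A →ₗ[k] k)}
  {α β κ τ σ : k} (h : IsKoszulTangent X f α β κ τ σ) {w : Module.Basis (Fin 3) A Γ}
  (hw : C.IsFrame X f w)

section model

variable {M : Type*} [Ring M] [Algebra k M] {e : Fin 3 → M}

variable (k A M) in
/-- Evaluation of the model at the unit. -/
noncomputable def unitEval : Module.End k A ⊗[k] M →ₗ[k] A ⊗[k] M :=
  (LinearMap.applyₗ (1 : A)).rTensor M

theorem unitEval_modelAlg_mul (a : A) {Y : Module.End k A ⊗[k] M} {y : M}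
    (hY : unitEval k A M Y = 1 ⊗ₜ y) : unitEval k A M (modelAlg k A M a * Y) = a ⊗ₜ y := by
  have key (Y : Module.End k A ⊗[k] M) : unitEval k A M (modelAlg k A M a * Y) =
      (Algebra.lmul k A a).rTensor M (unitEval k A M Y) := by
    induction Y with
    | zero => simp
    | add s t hs ht => simp only [mul_add, map_add, hs, ht]
    | tmul T m => simp [unitEval, modelAlg_apply]
  rw [key, hY]
  simp

include h in
-- Since fᵢⱼ ▷ 1 = δᵢⱼ, the twist disappears at the unit and the product in the untwisted quadratic
-- algebra is seen.
theorem unitEval_modelForm_mul (i : Fin 3) {Y : Module.End k A ⊗[k] M} {y : M}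
    (hY : unitEval k A M Y = 1 ⊗ₜ y) :
    unitEval k A M (modelForm f e i * Y) = 1 ⊗ₜ (e i * y) := by
  have key (T : Module.End k A) (m : M) (Y : Module.End k A ⊗[k] M) :
      unitEval k A M ((T ⊗ₜ m) * Y) = TensorProduct.map T (Algebra.lmul k M m)
        (unitEval k A M Y) := by
    induction Y with
    | zero => simp
    | add s t hs ht => simp only [mul_add, map_add, hs, ht]
    | tmul T m => simp [unitEval]
  simp only [modelForm, Finset.sum_mul, map_sum, key, hY, TensorProduct.map_tmul, convAct_one_apply,
    h.f_one]
  rw [Finset.sum_eq_single i] <;> simp +contextual [eq_comm]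

variable (he : ∀ i j, e i * e j = ∑ n, koszulCoeff α κ τ n i j •
  ![e 2 * e 0, e 2 * e 1, e 1 * e 0] n)

/-- The algebra homomorphism into the model. -/
noncomputable def modelHom [SMulCommClass A Aᵐᵒᵖ Γ] : C.Forms →ₐ[k] Module.End k A ⊗[k] M :=
  C.lift (B := Module.End k A ⊗[k] M) (modelAlg k A M) (modelMap w f e) (modelMap_smul e)
    (modelMap_op_smul h hw e) (modelMap_dd h hw he)

theorem modelHom_ofAlg [SMulCommClass A Aᵐᵒᵖ Γ] (a : A) :
    modelHom h hw he (C.ofAlg a) = modelAlg k A M a :=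
  C.lift_ofAlg (B := Module.End k A ⊗[k] M) a

theorem modelHom_ofForm [SMulCommClass A Aᵐᵒᵖ Γ] (i : Fin 3) :
    modelHom h hw he (C.ofForm (w i)) = modelForm f e i :=
  (C.lift_ofForm (B := Module.End k A ⊗[k] M) (w i)).trans (modelMap_basis e i)

end model

include h in
theorem unitEval_modelForm {M : Type*} [Ring M] [Algebra k M] {e : Fin 3 → M} (i : Fin 3) :
    unitEval k A M (modelForm f e i) = 1 ⊗ₜ e i := by
  have := unitEval_modelForm_mul h (e := e) i (Y := 1) (y := 1) (by
    simp [unitEval, Algebra.TensorProduct.one_def])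
  simpa using this

include h hw in
theorem IsFrame.eq_zero_of_two_form [SMulCommClass A Aᵐᵒᵖ Γ] {b : Fin 3 → A}
    (hb : C.ofAlg (b 0) * (C.ofForm (w 2) * C.ofForm (w 0)) +
      C.ofAlg (b 1) * (C.ofForm (w 2) * C.ofForm (w 1)) +
      C.ofAlg (b 2) * (C.ofForm (w 1) * C.ofForm (w 0)) = 0) : b = 0 := by
  have key := congrArg (fun x ↦ unitEval k A (Matrix (Fin 8) (Fin 8) k)
    (modelHom h hw (koszulMatrix_mul α κ τ h.ne_zero) x)) hb
  have e2 (b : A) (i j : Fin 3) : unitEval k A (Matrix (Fin 8) (Fin 8) k) (modelAlg k A _ b *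
      (modelForm f (koszulMatrix α κ τ) i * modelForm f (koszulMatrix α κ τ) j)) =
      b ⊗ₜ (koszulMatrix α κ τ i * koszulMatrix α κ τ j) :=
    unitEval_modelAlg_mul b (unitEval_modelForm_mul h i (unitEval_modelForm h j))
  simp only [map_add, map_mul, modelHom_ofAlg, modelHom_ofForm, map_zero, e2] at key
  -- Column 0 of a product of the matrices is its coordinate vector, being its action on the basis
  -- vector 1. Rows 4, 5, 6 belong to e₂e₀, e₂e₁, e₁e₀.
  have key2 (p : Fin 8) := congrArg (fun x ↦ TensorProduct.rid k A
    ((Matrix.entryLinearMap k k p 0).lTensor A x)) key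
  simp only [map_add, LinearMap.lTensor_tmul, TensorProduct.rid_tmul, map_zero,
    Matrix.entryLinearMap_apply] at key2
  have k4 := key2 4
  have k5 := key2 5
  have k6 := key2 6
  simp [koszulMatrix, mul_add, add_mul, Matrix.single_mul_single_of_ne,
    Matrix.single_apply_of_ne] at k4 k5 k6
  ext n
  fin_cases n
  · exact k4
  · exact k5
  · exact k6

include h hw in
theorem IsFrame.eq_zero_of_three_form [SMulCommClass A Aᵐᵒᵖ Γ] {b : A}
    (hb : C.ofAlg b * (C.ofForm (w 2) * (C.ofForm (w 1) * C.ofForm (w 0))) = 0) : b = 0 := by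
  have key := congrArg (fun x ↦ unitEval k A (Matrix (Fin 8) (Fin 8) k)
    (modelHom h hw (koszulMatrix_mul α κ τ h.ne_zero) x)) hb
  have e3 : unitEval k A (Matrix (Fin 8) (Fin 8) k) (modelAlg k A _ b *
      (modelForm f (koszulMatrix α κ τ) 2 * (modelForm f (koszulMatrix α κ τ) 1 *
        modelForm f (koszulMatrix α κ τ) 0))) =
      b ⊗ₜ (koszulMatrix α κ τ 2 * (koszulMatrix α κ τ 1 * koszulMatrix α κ τ 0)) :=
    unitEval_modelAlg_mul b (unitEval_modelForm_mul h 2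
      (unitEval_modelForm_mul h 1 (unitEval_modelForm h 0)))
  simp only [map_mul, modelHom_ofAlg, modelHom_ofForm, map_zero, e3] at key
  -- Row 7 belongs to e₂e₁e₀.
  have key2 := congrArg (fun x ↦ TensorProduct.rid k A
    ((Matrix.entryLinearMap k k 7 0).lTensor A x)) key
  simpa [koszulMatrix, mul_add, add_mul, Matrix.single_mul_single_of_ne,
    Matrix.single_apply_of_ne] using key2

end FODC

/-! ### The de Rham complex in coordinates -/

namespace FODC

section

variable {k : Type u} {A : Type v} {Γ : Type w} [Field k] [Ring A] [AddCommGroup Γ] [Module k Γ]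
  [Module A Γ] [Module Aᵐᵒᵖ Γ] [HopfAlgebra k A] [IsScalarTower k A Γ] [IsScalarTower k Aᵐᵒᵖ Γ]
  {C : FODC k A Γ} {X : Fin 3 → WithConv (A →ₗ[k] k)} {f : Fin 3 → Fin 3 → WithConv (A →ₗ[k] k)}
  {α β κ τ σ : k} (h : IsKoszulTangent X f α β κ τ σ) {w : Module.Basis (Fin 3) A Γ}
  (hw : C.IsFrame X f w)

/-- The invariant two-forms. -/
noncomputable def twoForm (C : FODC k A Γ) (w : Module.Basis (Fin 3) A Γ) : Fin 3 → C.Forms :=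
  ![C.ofForm (w 2) * C.ofForm (w 0), C.ofForm (w 2) * C.ofForm (w 1),
    C.ofForm (w 1) * C.ofForm (w 0)]

/-- The invariant volume form. -/
noncomputable def threeForm (C : FODC k A Γ) (w : Module.Basis (Fin 3) A Γ) : C.Forms :=
  C.ofForm (w 2) * (C.ofForm (w 1) * C.ofForm (w 0))

theorem mem_range_mul_span {ι : Type*} [Fintype ι] {g : ι → C.Forms} {x : C.Forms} :
    x ∈ LinearMap.range C.ofAlg.toLinearMap * Submodule.span k (Set.range g) ↔
      ∃ b : ι → A, x = ∑ i, C.ofAlg (b i) * g i := by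
  classical
  constructor
  · intro hx
    induction hx using Submodule.mul_induction_on' with
    | mem_mul_mem a ha y hy =>
      obtain ⟨a, rfl⟩ := ha
      obtain ⟨c, rfl⟩ := (Submodule.mem_span_range_iff_exists_fun k).mp hy
      exact ⟨fun i ↦ c i • a, by simp [Finset.mul_sum]⟩
    | add x hx y hy hx' hy' =>
      obtain ⟨b, rfl⟩ := hx'
      obtain ⟨c, rfl⟩ := hy'
      exact ⟨b + c, by simp [add_mul, Finset.sum_add_distrib]⟩
  · rintro ⟨b, rfl⟩
    exact Submodule.sum_mem _ fun i _ ↦ Submodule.mul_mem_mul ⟨_, rfl⟩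
      (Submodule.subset_span ⟨i, rfl⟩)

theorem range_ofForm (w : Module.Basis (Fin 3) A Γ) : LinearMap.range C.ofForm =
    LinearMap.range C.ofAlg.toLinearMap * Submodule.span k (Set.range fun i ↦ C.ofForm (w i)) := by
  ext x
  rw [mem_range_mul_span]
  constructor
  · rintro ⟨ρ, rfl⟩
    refine ⟨w.repr ρ, ?_⟩
    conv_lhs => rw [← w.sum_repr ρ]
    simp only [map_sum, ofAlg_mul_ofForm]
  · rintro ⟨b, rfl⟩
    exact ⟨∑ i, b i • w i, by simp only [map_sum, ofAlg_mul_ofForm]⟩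

/-- The right action on the basis is by functions on the left, V·𝒜 ⊆ 𝒜·V, so all functions can be
collected on the left. -/
theorem forms_eq (w : Module.Basis (Fin 3) A Γ) (n : ℕ) : C.forms n =
    LinearMap.range C.ofAlg.toLinearMap *
      Submodule.span k (Set.range fun i ↦ C.ofForm (w i)) ^ n := by
  have hG := range_ofForm (C := C) w
  rw [forms]
  set G := LinearMap.range C.ofAlg.toLinearMap with hG0
  set V := Submodule.span k (Set.range fun i ↦ C.ofForm (w i)) with hV
  have hGG : G * G ≤ G := Submodule.mul_le.mpr (by
    rintro _ ⟨a, rfl⟩ _ ⟨b, rfl⟩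
    exact ⟨a * b, by simp⟩)
  have hVle : V ≤ LinearMap.range C.ofForm := Submodule.span_le.mpr (by
    rintro _ ⟨i, rfl⟩
    exact ⟨w i, rfl⟩)
  have hVG : V * G ≤ G * V := by
    rw [← hG]
    refine (mul_le_mul' hVle le_rfl).trans (Submodule.mul_le.mpr ?_)
    rintro _ ⟨ρ, rfl⟩ _ ⟨a, rfl⟩
    exact ⟨_, (C.ofForm_mul_ofAlg ρ a).symm⟩
  have hVG' (n : ℕ) : V ^ n * G ≤ G * V ^ n := by
    induction n with
    | zero => simp
    | succ n ih =>
      rw [pow_succ, mul_assoc]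
      refine (mul_le_mul' le_rfl hVG).trans ?_
      rw [← mul_assoc, ← mul_assoc]
      exact mul_le_mul' ih le_rfl
  refine le_antisymm ?_ (mul_le_mul' le_rfl (pow_le_pow_left' hVle n))
  induction n with
  | zero => simp
  | succ n ih =>
    rw [pow_succ, ← mul_assoc]
    refine (mul_le_mul' ih le_rfl).trans ?_
    rw [hG, mul_assoc, ← mul_assoc (V ^ n)]
    refine (mul_le_mul' le_rfl (mul_le_mul' (hVG' n) le_rfl)).trans ?_
    rw [mul_assoc G, ← mul_assoc G G, ← pow_succ]
    exact mul_le_mul' hGG le_rfl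

theorem mem_forms_zero {x : C.Forms} : x ∈ C.forms 0 ↔ ∃ a, x = C.ofAlg a := by
  rw [forms, pow_zero, mul_one]
  exact ⟨fun ⟨a, ha⟩ ↦ ⟨a, ha.symm⟩, fun ⟨a, ha⟩ ↦ ⟨a, ha.symm⟩⟩

theorem mem_forms_one (w : Module.Basis (Fin 3) A Γ) {x : C.Forms} : x ∈ C.forms 1 ↔
    ∃ a : Fin 3 → A, x = ∑ i, C.ofAlg (a i) * C.ofForm (w i) := by
  rw [forms_eq w, pow_one, mem_range_mul_span]

section relations

variable [SMulCommClass A Aᵐᵒᵖ Γ]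

include h hw

theorem IsFrame.mul_eq (i j : Fin 3) :
    C.ofForm (w i) * C.ofForm (w j) = ∑ n, koszulCoeff α κ τ n i j • twoForm C w n :=
  hw.ofForm_mul_ofForm h i j

theorem IsFrame.D_eq (n : Fin 3) :
    C.D (C.ofForm (w n)) = -![β, -(α⁻¹ * β), σ] n • twoForm C w n :=
  hw.D_ofForm_basis h n

/-- Reordering with the quadratic relations; the matrix records the only nonzero products w₀·w₂w₁,
w₁·w₂w₀ and w₂·w₁w₀. -/
theorem IsFrame.mul_twoForm (i n : Fin 3) : C.ofForm (w i) * twoForm C w n =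
    (!![0, α * κ, 0; -α⁻¹, 0, 0; 0, 0, 1] : Matrix (Fin 3) (Fin 3) k) i n • threeForm C w := by
  have hm := hw.mul_eq h
  have h00 := hm 0 0
  have h01 := hm 0 1
  have h02 := hm 0 2
  have h11 := hm 1 1
  have h12 := hm 1 2
  have h22 := hm 2 2
  simp [koszulCoeff, Fin.sum_univ_three, twoForm] at h00 h01 h02 h11 h12 h22
  fin_cases i <;> fin_cases n <;> simp [twoForm, threeForm]
  · rw [← mul_assoc, h02, neg_mul, smul_mul_assoc, mul_assoc, h00, mul_zero, smul_zero, neg_zero]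
  · rw [← mul_assoc, h02, neg_mul, smul_mul_assoc, mul_assoc, h01]
    simp [smul_smul]
  · rw [← mul_assoc, h01, neg_mul, smul_mul_assoc, mul_assoc, h00, mul_zero, smul_zero, neg_zero]
  · rw [← mul_assoc, h12, neg_mul, smul_mul_assoc, mul_assoc]
  · rw [← mul_assoc, h12, neg_mul, smul_mul_assoc, mul_assoc, h11, mul_zero, smul_zero, neg_zero]
  · rw [← mul_assoc, h11, zero_mul]
  · rw [← mul_assoc, h22, neg_mul, smul_mul_assoc, mul_assoc, h00, mul_zero, smul_zero, neg_zero]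
  · rw [← mul_assoc, h22, neg_mul, smul_mul_assoc, mul_assoc, h01, mul_neg, mul_smul_comm,
      ← mul_assoc, h11, zero_mul, smul_zero, neg_zero, smul_zero, neg_zero]

theorem IsFrame.mul_threeForm (i : Fin 3) : C.ofForm (w i) * threeForm C w = 0 := by
  have hm := hw.mul_eq h i 2
  have h3 (i : Fin 3) := hw.mul_twoForm h i 2
  simp [twoForm] at h3
  rw [threeForm, ← mul_assoc, hm]
  fin_cases i <;> simp [koszulCoeff, Fin.sum_univ_three, twoForm, mul_assoc, h3]

theorem IsFrame.mem_forms_two {x : C.Forms} : x ∈ C.forms 2 ↔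
    ∃ b : Fin 3 → A, x = ∑ n, C.ofAlg (b n) * twoForm C w n := by
  rw [← mem_range_mul_span, forms_eq w]
  suffices Submodule.span k (Set.range fun i ↦ C.ofForm (w i)) ^ 2 =
    Submodule.span k (Set.range (twoForm C w)) by rw [this]
  rw [sq, Submodule.span_mul_span]
  apply le_antisymm
  · rw [Submodule.span_le]
    rintro _ ⟨_, ⟨i, rfl⟩, _, ⟨j, rfl⟩, rfl⟩
    change C.ofForm (w i) * C.ofForm (w j) ∈ _
    rw [hw.mul_eq h]
    exact Submodule.sum_mem _ fun n _ ↦ Submodule.smul_mem _ _ (Submodule.subset_span ⟨n, rfl⟩)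
  · apply Submodule.span_mono
    rintro _ ⟨n, rfl⟩
    fin_cases n
    · exact ⟨_, ⟨2, rfl⟩, _, ⟨0, rfl⟩, rfl⟩
    · exact ⟨_, ⟨2, rfl⟩, _, ⟨1, rfl⟩, rfl⟩
    · exact ⟨_, ⟨1, rfl⟩, _, ⟨0, rfl⟩, rfl⟩

theorem IsFrame.span_pow_three : Submodule.span k (Set.range fun i ↦ C.ofForm (w i)) ^ 3 =
    Submodule.span k {threeForm C w} := by
  rw [pow_succ', sq, Submodule.span_mul_span, Submodule.span_mul_span]
  apply le_antisymm
  · rw [Submodule.span_le]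
    rintro _ ⟨_, ⟨i, rfl⟩, _, ⟨_, ⟨j, rfl⟩, _, ⟨l, rfl⟩, rfl⟩, rfl⟩
    change C.ofForm (w i) * (C.ofForm (w j) * C.ofForm (w l)) ∈ _
    rw [hw.mul_eq h, Finset.mul_sum]
    refine Submodule.sum_mem _ fun n _ ↦ ?_
    rw [mul_smul_comm, hw.mul_twoForm h]
    exact Submodule.smul_mem _ _ (Submodule.smul_mem _ _ (Submodule.mem_span_singleton_self _))
  · apply Submodule.span_mono
    rintro _ rfl
    exact ⟨_, ⟨2, rfl⟩, _, ⟨_, ⟨1, rfl⟩, _, ⟨0, rfl⟩, rfl⟩, rfl⟩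

theorem IsFrame.mem_forms_three {x : C.Forms} : x ∈ C.forms 3 ↔
    ∃ b : A, x = C.ofAlg b * threeForm C w := by
  rw [forms_eq w, hw.span_pow_three h, ← Set.range_const (ι := Unit), mem_range_mul_span]
  exact ⟨fun ⟨b, hb⟩ ↦ ⟨b (), by simpa using hb⟩, fun ⟨b, hb⟩ ↦ ⟨fun _ ↦ b, by simpa using hb⟩⟩

theorem IsFrame.forms_eq_bot {n : ℕ} (hn : 3 < n) : C.forms n = ⊥ := by
  obtain ⟨m, rfl⟩ : ∃ m, n = m + (1 + 3) := ⟨n - 4, by omega⟩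
  have : Submodule.span k (Set.range fun i ↦ C.ofForm (w i)) ^ (1 + 3) = ⊥ := by
    rw [pow_add, pow_one, hw.span_pow_three h, Submodule.span_mul_span, Submodule.span_eq_bot]
    rintro _ ⟨_, ⟨i, rfl⟩, _, rfl, rfl⟩
    exact hw.mul_threeForm h i
  rw [forms_eq w, pow_add, this, Submodule.mul_bot, Submodule.mul_bot]

theorem IsFrame.D_ofAlg_mul (a : A) (Y : C.Forms) : C.D (C.ofAlg a * Y) =
    ∑ j, C.ofAlg (convAct (X j) a) * (C.ofForm (w j) * Y) + C.ofAlg a * C.D Y := by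
  simp only [D_mul, D_ofAlg, parity_ofAlg, hw.ofForm_d, Finset.sum_mul, mul_assoc]

theorem IsFrame.D_one_form (a : Fin 3 → A) : C.D (∑ i, C.ofAlg (a i) * C.ofForm (w i)) =
    ∑ n, C.ofAlg (![convAct (X 2) (a 0) - α • convAct (X 0) (a 2) - β • a 0,
      convAct (X 2) (a 1) - α⁻¹ • convAct (X 1) (a 2) + (α⁻¹ * β) • a 1,
      convAct (X 1) (a 0) - κ • convAct (X 0) (a 1) - τ • convAct (X 2) (a 2) - σ • a 2] n) *
        twoForm C w n := by
  simp only [map_sum, hw.D_ofAlg_mul h, hw.mul_eq h, hw.D_eq h]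
  generalize twoForm C w = θ
  simp [koszulCoeff, Fin.sum_univ_three, sub_mul, add_mul]
  module

/-- The contributions of the two factors cancel or vanish. Consequently the last differential has no
zeroth-order term, which lets the constants survive in the top degree. -/
theorem IsFrame.D_twoForm (n : Fin 3) : C.D (twoForm C w n) = 0 := by
  have h3 (i j l : Fin 3) : C.ofForm (w i) * (C.ofForm (w j) * C.ofForm (w l)) =
      ∑ n, koszulCoeff α κ τ n j l • (!![0, α * κ, 0; -α⁻¹, 0, 0; 0, 0, 1] :
        Matrix (Fin 3) (Fin 3) k) i n • threeForm C w := by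
    rw [hw.mul_eq h, Finset.mul_sum]
    simp only [mul_smul_comm, hw.mul_twoForm h]
  have hα := h.ne_zero
  fin_cases n <;>
    simp [twoForm, D_mul, parity_ofForm, hw.D_eq h, mul_assoc, h3, Fin.sum_univ_three, koszulCoeff,
      smul_smul, hα, mul_comm β]

theorem IsFrame.D_threeForm : C.D (threeForm C w) = 0 := by
  have h1 := hw.D_twoForm h 2
  have h2 := hw.mul_twoForm h 0 2
  simp [twoForm] at h1 h2
  simp [threeForm, D_mul C (C.ofForm (w 2)), hw.D_eq h, h1, twoForm, mul_assoc, h2]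

theorem IsFrame.D_two_form (b : Fin 3 → A) : C.D (∑ n, C.ofAlg (b n) * twoForm C w n) =
    C.ofAlg (convAct (X 2) (b 2) - α⁻¹ • convAct (X 1) (b 0) + (α * κ) • convAct (X 0) (b 1)) *
      threeForm C w := by
  simp only [map_sum, hw.D_ofAlg_mul h, hw.D_twoForm h, hw.mul_twoForm h]
  simp [Fin.sum_univ_three, sub_mul, add_mul]
  module

end relations

end

end FODC

/-! ### Cohomology from the Koszul complex -/

theorem nonempty_quotient_linearEquiv {V : Type*} [AddCommGroup V] [Module ℂ V] {Z B : Submodule ℂ V}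
    {v : V} (hv : v ∈ Z) (h0 : ∀ c : ℂ, c • v ∈ B → c = 0)
    (h1 : ∀ x ∈ Z, ∃ c : ℂ, x - c • v ∈ B) : Nonempty ((Z ⧸ B.submoduleOf Z) ≃ₗ[ℂ] ℂ) := by
  refine ⟨(LinearEquiv.ofBijective (LinearMap.toSpanSingleton ℂ _
    (Submodule.Quotient.mk (p := B.submoduleOf Z) ⟨v, hv⟩)) ⟨?_, ?_⟩).symm⟩
  · rw [← LinearMap.ker_eq_bot, LinearMap.ker_eq_bot']
    intro c hc
    apply h0
    rw [LinearMap.toSpanSingleton_apply, ← Submodule.Quotient.mk_smul,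
      Submodule.Quotient.mk_eq_zero] at hc
    exact hc
  · intro y
    obtain ⟨⟨x, hx⟩, rfl⟩ := Submodule.Quotient.mk_surjective _ y
    obtain ⟨c, hc⟩ := h1 x hx
    refine ⟨c, ?_⟩
    rw [LinearMap.toSpanSingleton_apply, ← Submodule.Quotient.mk_smul, eq_comm,
      Submodule.Quotient.eq]
    exact hc

namespace FODC

variable {A : Type v} {Γ : Type w} [Ring A] [AddCommGroup Γ] [Module ℂ Γ]
  [Module A Γ] [Module Aᵐᵒᵖ Γ] [HopfAlgebra ℂ A] [IsScalarTower ℂ A Γ] [IsScalarTower ℂ Aᵐᵒᵖ Γ]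
  [SMulCommClass A Aᵐᵒᵖ Γ]
  {C : FODC ℂ A Γ} {X : Fin 3 → WithConv (A →ₗ[ℂ] ℂ)} {f : Fin 3 → Fin 3 → WithConv (A →ₗ[ℂ] ℂ)}
  {α β κ τ σ : ℂ} (h : IsKoszulTangent X f α β κ τ σ) {w : Module.Basis (Fin 3) A Γ}
  (hw : C.IsFrame X f w) (H : HasTrivialKoszulCohomology (convAct (X 0)) (convAct (X 1))
    (convAct (X 2)) α β κ τ σ (1 : A))

include h hw in
theorem IsFrame.two_form_injective {a b : Fin 3 → A}
    (hab : ∑ n, C.ofAlg (a n) * twoForm C w n = ∑ n, C.ofAlg (b n) * twoForm C w n) : a = b := by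
  rw [← sub_eq_zero]
  apply hw.eq_zero_of_two_form h
  rw [← sub_eq_zero, ← Finset.sum_sub_distrib] at hab
  simp only [← sub_mul, ← map_sub] at hab
  rw [Fin.sum_univ_three] at hab
  exact hab

theorem mem_cocycles {n : ℕ} {x : C.Forms} : x ∈ C.cocycles n ↔ x ∈ C.forms n ∧ C.D x = 0 := Iff.rfl

include h hw H

theorem IsFrame.cohomology_zero : Nonempty (C.Cohomology 0 ≃ₗ[ℂ] ℂ) := by
  have h1 : C.ofAlg 1 ∈ C.cocycles 0 := by
    refine mem_cocycles.mpr ⟨mem_forms_zero.mpr ⟨1, rfl⟩, ?_⟩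
    rw [D_ofAlg, d_one, map_zero]
  refine nonempty_quotient_linearEquiv h1 (fun c hc ↦ ?_) fun x hx ↦ ?_
  · have : (c • C.ofAlg 1 : C.Forms) = 0 := hc
    rw [← map_smul, ← map_zero C.ofAlg] at this
    have := congrArg (Coalgebra.counit (R := ℂ)) (C.ofAlg_injective this)
    simpa using this
  · obtain ⟨hx, hxD⟩ := mem_cocycles.mp hx
    obtain ⟨a, rfl⟩ := mem_forms_zero.mp hx
    rw [D_ofAlg, ← map_zero C.ofForm] at hxD
    have := C.ofForm_injective hxD
    rw [hw.d_eq] at this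
    have h2 := Fintype.linearIndependent_iff.mp w.linearIndependent _ this
    obtain ⟨c, rfl⟩ := H.zero a (h2 0) (h2 1) (h2 2)
    refine ⟨c, ?_⟩
    rw [map_smul, sub_self]
    exact zero_mem _

theorem IsFrame.cohomology_one : Subsingleton (C.Cohomology 1) := by
  rw [Submodule.Quotient.subsingleton_iff, Submodule.submoduleOf_eq_top]
  intro x hx
  obtain ⟨hx, hxD⟩ := mem_cocycles.mp hx
  obtain ⟨a, rfl⟩ := (mem_forms_one w).mp hx
  rw [hw.D_one_form h] at hxD
  have e := hw.two_form_injective h (b := 0) (hxD.trans (by simp))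
  obtain ⟨b, h1, h2, h3⟩ := H.one _ _ _ (congrFun e 0) (congrFun e 1) (congrFun e 2)
  refine ⟨C.ofAlg b, mem_forms_zero.mpr ⟨b, rfl⟩, ?_⟩
  rw [D_ofAlg, hw.ofForm_d]
  simp only [Fin.sum_univ_three, h1, h2, h3]

theorem IsFrame.cohomology_two : Subsingleton (C.Cohomology 2) := by
  rw [Submodule.Quotient.subsingleton_iff, Submodule.submoduleOf_eq_top]
  intro x hx
  obtain ⟨hx, hxD⟩ := mem_cocycles.mp hx
  obtain ⟨b, rfl⟩ := (hw.mem_forms_two h).mp hx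
  rw [hw.D_two_form h] at hxD
  obtain ⟨a₁, a₂, a₃, h1, h2, h3⟩ := H.two _ _ _ (hw.eq_zero_of_three_form h hxD)
  refine ⟨_, (mem_forms_one w).mpr ⟨![a₁, a₂, a₃], rfl⟩, ?_⟩
  rw [hw.D_one_form h]
  simp [Fin.sum_univ_three, h1, h2, h3]

theorem IsFrame.cohomology_three : Nonempty (C.Cohomology 3 ≃ₗ[ℂ] ℂ) := by
  have h1 : threeForm C w ∈ C.cocycles 3 :=
    ⟨(hw.mem_forms_three h).mpr ⟨1, by simp⟩, hw.D_threeForm h⟩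
  have e1 (c : ℂ) : c • threeForm C w = C.ofAlg (c • 1) * threeForm C w := by simp
  refine nonempty_quotient_linearEquiv h1 (fun c hc ↦ ?_) fun x hx ↦ ?_
  · obtain ⟨y, hy, hyc⟩ := hc
    obtain ⟨b, rfl⟩ := (hw.mem_forms_two h).mp hy
    rw [hw.D_two_form h, e1, ← sub_eq_zero, ← sub_mul, ← map_sub] at hyc
    exact H.three' _ _ _ c (sub_eq_zero.mp (hw.eq_zero_of_three_form h hyc))
  · obtain ⟨b, rfl⟩ := (hw.mem_forms_three h).mp hx.1
    obtain ⟨b₁, b₂, b₃, c, hb⟩ := H.three b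
    refine ⟨c, _, (hw.mem_forms_two h).mpr ⟨![b₁, b₂, b₃], rfl⟩, ?_⟩
    rw [hw.D_two_form h, hb, e1, ← sub_mul, ← map_sub, add_sub_cancel_right]
    rfl

/-- The cohomology of the universal differential calculus of a left-covariant first order
calculus of Koszul type. -/
theorem IsFrame.deRham : (∀ n : ℕ, 3 < n → C.forms n = ⊥) ∧
    Nonempty (C.Cohomology 0 ≃ₗ[ℂ] ℂ) ∧ Subsingleton (C.Cohomology 1) ∧
    Subsingleton (C.Cohomology 2) ∧ Nonempty (C.Cohomology 3 ≃ₗ[ℂ] ℂ) :=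
  ⟨fun _ hn ↦ hw.forms_eq_bot h hn, hw.cohomology_zero h H, hw.cohomology_one h H,
    hw.cohomology_two h H, hw.cohomology_three h H⟩

omit hw in
-- The coideal fixes the tangent space: inside it, the tangent functionals are exactly those that
-- vanish at 1, as `ω_one` and `X_one` show.
theorem deRham_of_tangentCoideal (hC : C.IsLeftCovariant)
    (hX : C.tangentCoideal = Submodule.span ℂ (Set.range X) ⊔ Submodule.span ℂ {1}) :
    (∀ n : ℕ, 3 < n → C.forms n = ⊥) ∧
    Nonempty (C.Cohomology 0 ≃ₗ[ℂ] ℂ) ∧ Subsingleton (C.Cohomology 1) ∧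
    Subsingleton (C.Cohomology 2) ∧ Nonempty (C.Cohomology 3 ≃ₗ[ℂ] ℂ) := by
  set ev : WithConv (A →ₗ[ℂ] ℂ) →ₗ[ℂ] ℂ :=
    LinearMap.applyₗ (1 : A) ∘ₗ (WithConv.linearEquiv ℂ (A →ₗ[ℂ] ℂ)).toLinearMap with hev
  have h1 : ev 1 = 1 := by simp [hev]
  have hle {S T : Submodule ℂ (WithConv (A →ₗ[ℂ] ℂ))} (hS : S ≤ LinearMap.ker ev)
      (hT : T ≤ LinearMap.ker ev) (hST : S ⊔ Submodule.span ℂ {1} = T ⊔ Submodule.span ℂ {1}) :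
      S ≤ T := fun x hx ↦ by
    obtain ⟨y, hy, z, hz, rfl⟩ := Submodule.mem_sup.mp (hST ▸ Submodule.mem_sup_left hx)
    obtain ⟨c, rfl⟩ := Submodule.mem_span_singleton.mp hz
    have := hS hx
    rw [LinearMap.mem_ker, map_add, hT hy, map_smul, h1, zero_add, smul_eq_mul, mul_one] at this
    rwa [this, zero_smul, add_zero]
  have hS : C.tangentSpace ≤ LinearMap.ker ev := by
    rintro _ ⟨φ, rfl⟩
    simp [hev, ω_one]
  have hT : Submodule.span ℂ (Set.range X) ≤ LinearMap.ker ev := by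
    rw [Submodule.span_le]
    rintro _ ⟨i, rfl⟩
    exact h.X_one i
  obtain ⟨w, h2, h3⟩ := hC.exists_basis h (le_antisymm (hle hS hT hX) (hle hT hS hX.symm))
  exact IsFrame.deRham h ⟨h2, h3⟩ H

end FODC

/-! ### Independence of quadratic monomials by bidegree -/

namespace OSLq2

variable {q : ℂˣ}

/-- The counit is unchanged by scaling columns by q and rows by q⁻¹, since it sees only the diagonal
generators, where the two scalings cancel. -/
theorem counit_eq_zero (hq : ∀ n : ℕ, 0 < n → q ^ n ≠ 1) {r c : ℤ} (hrc : r ≠ c) {x : OSLq2 q}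
    (hr : x ∈ weightSpace rowScale r) (hc : x ∈ weightSpace colScale c) :
    Coalgebra.counit (R := ℂ) x = 0 := by
  have key : ((Bialgebra.counitAlgHom ℂ (OSLq2 q)).comp (rowScale q⁻¹)).comp (colScale q) =
      Bialgebra.counitAlgHom ℂ (OSLq2 q) := algHom_ext fun i j ↦ by
    have hq0 := q.ne_zero
    simp only [AlgHom.comp_apply, colScale_apply, convAct_f_u, map_smul, rowScale_u,
      Bialgebra.counitAlgHom_apply, counit_u]
    fin_cases i <;> fin_cases j <;> simp
  have := congrArg (fun T : OSLq2 q →ₐ[ℂ] ℂ ↦ T x) key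
  simp only [AlgHom.comp_apply, hc q, map_smul, hr q⁻¹, Bialgebra.counitAlgHom_apply,
    smul_smul] at this
  by_contra hx
  rw [smul_eq_mul, mul_eq_right₀ hx, Units.val_inv_eq_inv_val, inv_zpow', ← zpow_add₀ q.ne_zero,
    ← zpow_zero (q : ℂ)] at this
  have := zpow_injective hq this
  omega

/-- Functionals whose action shifts the column weight by `n`. -/
def HasDegree (Y : Functional q) (n : ℤ) : Prop :=
  ∀ r c x, x ∈ weightSpace rowScale r → x ∈ weightSpace colScale c →
    convAct Y x ∈ weightSpace rowScale r ∧ convAct Y x ∈ weightSpace colScale (c + n)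

theorem HasDegree.mul {Y Z : Functional q} {m n l : ℤ} (hY : HasDegree Y m) (hZ : HasDegree Z n)
    (hl : l = m + n) : HasDegree (Y * Z) l := fun r c x hr hc ↦ by
  obtain ⟨h1, h2⟩ := hZ r c x hr hc
  have := hY r _ _ h1 h2
  rwa [convAct_comp, Module.End.mul_apply, hl, add_comm m, ← add_assoc]

theorem HasDegree.add {Y Z : Functional q} {n : ℤ} (hY : HasDegree Y n) (hZ : HasDegree Z n) :
    HasDegree (Y + Z) n := fun r c x hr hc ↦ by
  rw [convAct_add]
  exact ⟨add_mem (hY r c x hr hc).1 (hZ r c x hr hc).1,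
    add_mem (hY r c x hr hc).2 (hZ r c x hr hc).2⟩

theorem HasDegree.smul {Y : Functional q} {n : ℤ} (hY : HasDegree Y n) (t : ℂ) :
    HasDegree (t • Y) n := fun r c x hr hc ↦ by
  rw [convAct_smul]
  exact ⟨Submodule.smul_mem _ _ (hY r c x hr hc).1, Submodule.smul_mem _ _ (hY r c x hr hc).2⟩

theorem hasDegree_f (μ : ℂˣ) : HasDegree (f (q := q) μ) 0 := fun r c x hr hc ↦ by
  rw [convAct_f_of_mem hc, add_zero]
  exact ⟨Submodule.smul_mem _ _ hr, Submodule.smul_mem _ _ hc⟩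

theorem hasDegree_one : HasDegree (1 : Functional q) 0 := by
  rw [← f_one]
  exact hasDegree_f 1

theorem hasDegree_E (s : ℂˣ) (hs : s ^ 2 = q) : HasDegree (E s hs) 2 := fun _ _ _ hr hc ↦
  ⟨convAct_E_row hs hr, convAct_E_mem_col s hs rfl hc⟩

theorem hasDegree_F (s : ℂˣ) (hs : s ^ 2 = q) : HasDegree (F s hs) (-2) := fun _ _ _ hr hc ↦
  ⟨convAct_F_row hs hr, convAct_F_mem_col s hs rfl hc⟩

theorem HasDegree.apply_eq_zero (hq : ∀ n : ℕ, 0 < n → q ^ n ≠ 1) {Y : Functional q} {n r c : ℤ}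
    (hY : HasDegree Y n) {x : OSLq2 q} (hr : x ∈ weightSpace rowScale r)
    (hc : x ∈ weightSpace colScale c) (h : r ≠ c + n) : Y x = 0 := by
  rw [← counit_convAct]
  exact counit_eq_zero hq h (hY r c x hr hc).1 (hY r c x hr hc).2

/-- The homogeneous components of a linear relation between quadratic monomials. -/
theorem quadratic_relation (hq : ∀ n : ℕ, 0 < n → q ^ n ≠ 1) {X : Fin 3 → Functional q}
    (h0 : HasDegree (X 0) (-2)) (h1 : HasDegree (X 1) 2) (h2 : HasDegree (X 2) 0) {t : Fin 9 → ℂ}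
    (ht : ∑ i, t i • quadraticMonomials X i = 0) {r c : ℤ} {x : OSLq2 q}
    (hr : x ∈ weightSpace rowScale r) (hc : x ∈ weightSpace colScale c) :
    (r = c - 2 → t 0 * X 0 x + t 6 * (X 0 * X 2) x = 0) ∧
    (r = c + 2 → t 1 * X 1 x + t 7 * (X 1 * X 2) x = 0) ∧
    (r = c - 4 → t 3 * (X 0 * X 0) x = 0) ∧
    (r = c + 4 → t 4 * (X 1 * X 1) x = 0) ∧
    (r = c → t 2 * X 2 x + t 5 * (X 2 * X 2) x + t 8 * (X 0 * X 1) x = 0) := by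
  have e : t 0 * X 0 x + t 1 * X 1 x + t 2 * X 2 x + t 3 * (X 0 * X 0) x + t 4 * (X 1 * X 1) x +
      t 5 * (X 2 * X 2) x + t 6 * (X 0 * X 2) x + t 7 * (X 1 * X 2) x + t 8 * (X 0 * X 1) x = 0 := by
    simp only [Fin.sum_univ_succ, Fin.sum_univ_zero] at ht
    have := congrArg (fun Y : Functional q ↦ Y x) ht
    refine Eq.trans ?_ this
    simp only [add_assoc, add_zero]
    rfl
  have z0 := fun h ↦ h0.apply_eq_zero hq hr hc h
  have z1 := fun h ↦ h1.apply_eq_zero hq hr hc h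
  have z2 := fun h ↦ h2.apply_eq_zero hq hr hc h
  have z3 := fun h ↦ (h0.mul (l := -4) h0 (by norm_num)).apply_eq_zero hq hr hc h
  have z4 := fun h ↦ (h1.mul (l := 4) h1 (by norm_num)).apply_eq_zero hq hr hc h
  have z5 := fun h ↦ (h2.mul (l := 0) h2 (by norm_num)).apply_eq_zero hq hr hc h
  have z6 := fun h ↦ (h0.mul (l := -2) h2 (by norm_num)).apply_eq_zero hq hr hc h
  have z7 := fun h ↦ (h1.mul (l := 2) h2 (by norm_num)).apply_eq_zero hq hr hc h
  have z8 := fun h ↦ (h0.mul (l := 0) h1 (by norm_num)).apply_eq_zero hq hr hc h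
  generalize X 0 x = a0 at *
  generalize X 1 x = a1 at *
  generalize X 2 x = a2 at *
  generalize (X 0 * X 0) x = a3 at *
  generalize (X 1 * X 1) x = a4 at *
  generalize (X 2 * X 2) x = a5 at *
  generalize (X 0 * X 2) x = a6 at *
  generalize (X 1 * X 2) x = a7 at *
  generalize (X 0 * X 1) x = a8 at *
  refine ⟨fun h ↦ ?_, fun h ↦ ?_, fun h ↦ ?_, fun h ↦ ?_, fun h ↦ ?_⟩
  · rw [z1 (by omega), z2 (by omega), z3 (by omega), z4 (by omega), z5 (by omega), z7 (by omega),
      z8 (by omega)] at e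
    linear_combination e
  · rw [z0 (by omega), z2 (by omega), z3 (by omega), z4 (by omega), z5 (by omega), z6 (by omega),
      z8 (by omega)] at e
    linear_combination e
  · rw [z0 (by omega), z1 (by omega), z2 (by omega), z4 (by omega), z5 (by omega), z6 (by omega),
      z7 (by omega), z8 (by omega)] at e
    linear_combination e
  · rw [z0 (by omega), z1 (by omega), z2 (by omega), z3 (by omega), z5 (by omega), z6 (by omega),
      z7 (by omega), z8 (by omega)] at e
    linear_combination e
  · rw [z0 (by omega), z1 (by omega), z3 (by omega), z4 (by omega), z6 (by omega),
      z7 (by omega)] at e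
    linear_combination e

/-- Bidegree splits a relation into degrees ±2, ±4 and 0. These are tested on b, bd; c, cd; b²; c²;
and d, d², a. On d and d² the monomial X₀X₁ vanishes as E kills both, and the distinct values of g
on weights 1 and 2 separate X₂ from X₂². -/
theorem linearIndependent_quadraticMonomials (hq : ∀ n : ℕ, 0 < n → q ^ n ≠ 1) {s : ℂˣ}
    (hs : s ^ 2 = q) (μ ν : ℂˣ) {X : Fin 3 → Functional q} (hX0 : X 0 = F s hs * f μ)
    (hX1 : X 1 = f ν * E s hs) (hX2 : HasDegree (X 2) 0) {g : ℤ → ℂ}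
    (hg : ∀ m x, x ∈ weightSpace colScale m → convAct (E s hs) x = 0 → convAct (X 2) x = g m • x)
    (hg1 : g 1 ≠ 0) (hg2 : g 2 ≠ 0) (hg12 : g 1 ≠ g 2) {α β : ℂ} (hα : α ≠ 0)
    (hrel : X 1 * X 2 = α • (X 2 * X 1) + β • X 1) : LinearIndependent ℂ (quadraticMonomials X) := by
  have hs0 := s.ne_zero
  have hμ := μ.ne_zero
  have hν := ν.ne_zero
  -- This is q + q⁻¹, the factor arising from F² on b² and E² on c²; its vanishing would give q⁴ =
  -- 1.
  have hq4 : (s : ℂ) ^ 2 + ((s : ℂ) ^ 2)⁻¹ ≠ 0 := fun h ↦ by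
    apply hq 4 (by norm_num)
    ext
    rw [← hs]
    push_cast
    field_simp at h
    linear_combination ((s : ℂ) ^ 4 - 1) * h
  rw [Fintype.linearIndependent_iff]
  intro t ht
  have rel := fun {r c x} ↦ quadratic_relation (r := r) (c := c) (x := x) hq
    (hX0 ▸ (hasDegree_F s hs).mul (hasDegree_f μ) (by norm_num))
    (hX1 ▸ (hasDegree_f ν).mul (hasDegree_E s hs) (by norm_num)) hX2 ht
  have r0 (j : Fin 2) : u (q := q) 0 j ∈ weightSpace rowScale (-1) := u_mem_row 0 j
  have r1 (j : Fin 2) : u (q := q) 1 j ∈ weightSpace rowScale 1 := u_mem_row 1 j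
  have c0 (i : Fin 2) : u (q := q) i 0 ∈ weightSpace colScale (-1) := u_mem_col i 0
  have c1 (i : Fin 2) : u (q := q) i 1 ∈ weightSpace colScale 1 := u_mem_col i 1
  have y1 (i : Fin 2) : convAct (X 2) (u i 1) = g 1 • u i 1 :=
    hg 1 _ (c1 i) (by simp [convAct_E_u])
  have y2 (i j : Fin 2) : convAct (X 2) (u i 1 * u j 1) = g 2 • (u i 1 * u j 1) :=
    hg 2 _ (mul_mem_weightSpace rfl (c1 i) (c1 j)) (by simp [convAct_E_u, convAct_E_mul])
  have kb := (rel (r0 1) (c1 0)).1 (by norm_num)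
  have kbd := (rel (mul_mem_weightSpace rfl (r0 1) (r1 1))
    (mul_mem_weightSpace rfl (c1 0) (c1 1))).1 (by norm_num)
  have kc := (rel (r1 0) (c0 1)).2.1 (by norm_num)
  have kcd := (rel (mul_mem_weightSpace rfl (r1 0) (r1 1)) (mul_mem_weightSpace rfl (c0 1) (c1 1))).2.1 (by norm_num)
  have kbb := (rel (mul_mem_weightSpace rfl (r0 1) (r0 1))
    (mul_mem_weightSpace rfl (c1 0) (c1 0))).2.2.1 (by norm_num)
  have kcc := (rel (mul_mem_weightSpace rfl (r1 0) (r1 0)) (mul_mem_weightSpace rfl (c0 1) (c0 1))).2.2.2.1 (by norm_num)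
  have kd := (rel (r1 1) (c1 1)).2.2.2.2 (by norm_num)
  have kdd := (rel (mul_mem_weightSpace rfl (r1 1) (r1 1))
    (mul_mem_weightSpace rfl (c1 1) (c1 1))).2.2.2.2 (by norm_num)
  have ka := (rel (r0 0) (c0 0)).2.2.2.2 (by norm_num)
  clear rel ht
  have ev (Y : Functional q) (x : OSLq2 q) : Y x = Coalgebra.counit (R := ℂ) (convAct Y x) :=
    (counit_convAct Y x).symm
  have ev0 (x : OSLq2 q) : convAct (X 0) x = convAct (F s hs) (convAct (f μ) x) := by
    rw [hX0, convAct_comp, Module.End.mul_apply]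
  have ev1 (x : OSLq2 q) : convAct (X 1) x = convAct (f ν) (convAct (E s hs) x) := by
    rw [hX1, convAct_comp, Module.End.mul_apply]
  -- X₂ is known only on vectors killed by E, so X₁ is made to act first: it takes c and cd to
  -- multiples of d and d².
  have e12 (x : OSLq2 q) : (X 1 * X 2) x = α * (X 2 * X 1) x + β * X 1 x := by
    rw [hrel]; rfl
  rw [ev, ev (X 0 * X 2), convAct_comp, Module.End.mul_apply, y1, map_smul, ev0] at kb
  rw [ev, ev (X 0 * X 2), convAct_comp, Module.End.mul_apply, y2, map_smul, ev0] at kbd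
  rw [e12, ev, ev (X 2 * X 1), convAct_comp, Module.End.mul_apply, ev1] at kc
  rw [e12, ev, ev (X 2 * X 1), convAct_comp, Module.End.mul_apply, ev1] at kcd
  rw [ev, convAct_comp, Module.End.mul_apply, ev0, ev0] at kbb
  rw [ev, convAct_comp, Module.End.mul_apply, ev1, ev1] at kcc
  rw [ev, ev (X 2 * X 2), ev (X 0 * X 1), convAct_comp, convAct_comp, Module.End.mul_apply,
    Module.End.mul_apply, y1, map_smul (convAct (X 2)), y1, ev0, ev1] at kd
  rw [ev, ev (X 2 * X 2), ev (X 0 * X 1), convAct_comp, convAct_comp, Module.End.mul_apply,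
    Module.End.mul_apply, y2, map_smul (convAct (X 2)), y2, ev0, ev1] at kdd
  rw [ev, ev (X 2 * X 2), ev (X 0 * X 1), convAct_comp, convAct_comp, Module.End.mul_apply,
    Module.End.mul_apply, ev0, ev1] at ka
  simp [convAct_E_u, convAct_F_u, convAct_f_u, convAct_f_mul, convAct_E_mul,
    convAct_F_mul, counit_u] at kb kbd
  simp [convAct_E_u, convAct_F_u, convAct_f_u, convAct_f_mul, convAct_E_mul,
    convAct_F_mul, y1, y2, counit_u] at kc kcd
  simp [convAct_E_u, convAct_F_u, convAct_f_u, convAct_f_mul, convAct_E_mul,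
    convAct_F_mul, counit_u] at kbb kcc
  simp [convAct_E_u, convAct_F_u, convAct_f_u, convAct_f_mul, convAct_E_mul,
    convAct_F_mul, counit_u] at kd kdd
  clear ev e12 ev0 ev1
  have hg12' := sub_ne_zero.mpr hg12
  have t6 : t 6 = 0 := by
    refine (mul_eq_zero.mp ?_).resolve_right (mul_ne_zero (mul_ne_zero hμ (mul_ne_zero hμ hs0)) hg12')
    linear_combination μ * s * kb - kbd
  have t0 : t 0 = 0 := by simpa [t6, hμ] using kb
  have t7 : t 7 = 0 := by
    refine (mul_eq_zero.mp ?_).resolve_right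
      (mul_ne_zero (mul_ne_zero hν (mul_ne_zero hν hs0)) (mul_ne_zero hα hg12'))
    linear_combination ν * s * kc - kcd
  have t1 : t 1 = 0 := by simpa [t7, hν] using kc
  have t3 : t 3 = 0 := kbb.resolve_right fun h ↦ mul_ne_zero (pow_ne_zero 2 hμ) hq4 <| by
    rw [← inv_pow]
    linear_combination h
  have t4 : t 4 = 0 := kcc.resolve_right fun h ↦ mul_ne_zero (pow_ne_zero 2 hν) hq4 <| by
    rw [← inv_pow]
    linear_combination h
  have t5 : t 5 = 0 := by
    refine (mul_eq_zero.mp ?_).resolve_right (mul_ne_zero (mul_ne_zero hg1 hg2) hg12')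
    linear_combination g 2 * kd - g 1 * kdd
  have t2 : t 2 = 0 := by simpa [t5, hg1] using kd
  have t8 : t 8 = 0 := by
    simpa [t2, t5, convAct_E_u, convAct_F_u, convAct_f_u, counit_u, hμ, hν] using ka
  intro i
  fin_cases i <;> assumption

end OSLq2

theorem IsKoszulTangent.of_three {k A : Type*} [Field k] [Ring A] [Bialgebra k A]
    {x₀ x₁ x₂ : WithConv (A →ₗ[k] k)} {g : Fin 3 → Fin 3 → WithConv (A →ₗ[k] k)} {α β κ τ σ : k}
    (hα : α ≠ 0) (h₀ : x₀ 1 = 0) (h₁ : x₁ 1 = 0) (h₂ : x₂ 1 = 0)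
    (h₀' : ∀ x y, x₀ (x * y) = Coalgebra.counit (R := k) x * x₀ y +
      (x₀ x * g 0 0 y + x₁ x * g 1 0 y + x₂ x * g 2 0 y))
    (h₁' : ∀ x y, x₁ (x * y) = Coalgebra.counit (R := k) x * x₁ y +
      (x₀ x * g 0 1 y + x₁ x * g 1 1 y + x₂ x * g 2 1 y))
    (h₂' : ∀ x y, x₂ (x * y) = Coalgebra.counit (R := k) x * x₂ y +
      (x₀ x * g 0 2 y + x₁ x * g 1 2 y + x₂ x * g 2 2 y))
    (r₀ : x₂ * x₀ = α • (x₀ * x₂) + β • x₀) (r₁ : x₁ * x₂ = α • (x₂ * x₁) + β • x₁)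
    (r₂ : x₁ * x₀ = κ • (x₀ * x₁) + τ • (x₂ * x₂) + σ • x₂)
    (hi : LinearIndependent k (quadraticMonomials ![x₀, x₁, x₂])) :
    IsKoszulTangent ![x₀, x₁, x₂] g α β κ τ σ where
  ne_zero := hα
  X_one := fun i ↦ by fin_cases i <;> assumption
  X_mul := fun i x y ↦ by
    rw [Fin.sum_univ_three]
    fin_cases i
    · exact h₀' x y
    · exact h₁' x y
    · exact h₂' x y
  rel_zero := r₀
  rel_one := r₁
  rel_two := r₂
  indep := hi

/-! ### Tangent spaces spanned by F f_μ, f_ν E and f_γ - 1 -/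

namespace OSLq2

variable {q : ℂˣ}

theorem f_apply_mul (μ : ℂˣ) (x y : OSLq2 q) : f μ (x * y) = f μ x * f μ y := by
  simp only [f_apply, map_mul]

theorem F_mul_f_apply_mul {s : ℂˣ} (hs : s ^ 2 = q) (μ : ℂˣ) (x y : OSLq2 q) :
    (F s hs * f μ : Functional q) (x * y) =
      (F s hs * f μ : Functional q) x * f (s * μ) y +
        f (s⁻¹ * μ) x * (F s hs * f μ : Functional q) y := by
  simp only [← counit_convAct, convAct_comp, Module.End.mul_apply, convAct_f_mul, convAct_F_mul,
    map_add, Bialgebra.counit_mul, convAct_f_convAct_f]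

theorem f_mul_E_apply_mul {s : ℂˣ} (hs : s ^ 2 = q) (ν : ℂˣ) (x y : OSLq2 q) :
    (f ν * E s hs : Functional q) (x * y) =
      (f ν * E s hs : Functional q) x * f (s * ν) y +
        f (s⁻¹ * ν) x * (f ν * E s hs : Functional q) y := by
  simp only [← counit_convAct, convAct_comp, Module.End.mul_apply, convAct_f_mul, convAct_E_mul,
    map_add, Bialgebra.counit_mul, convAct_f_convAct_f, mul_comm]

theorem sub_one_mul_F_mul_f {s : ℂˣ} (hs : s ^ 2 = q) (μ γ : ℂˣ) :
    (f γ - 1) * (F s hs * f μ) = ((γ : ℂ) ^ 2)⁻¹ • (F s hs * f μ * (f γ - 1)) +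
      (((γ : ℂ) ^ 2)⁻¹ - 1) • (F s hs * f μ) := by
  rw [sub_mul, ← mul_assoc, f_mul_F, mul_sub, smul_mul_assoc, mul_assoc, mul_assoc, f_mul_f,
    f_mul_f, mul_comm γ]
  simp only [one_mul, mul_one, inv_pow]
  module

theorem f_mul_E_mul_sub_one {s : ℂˣ} (hs : s ^ 2 = q) (ν γ : ℂˣ) :
    (f ν * E s hs) * (f γ - 1) = ((γ : ℂ) ^ 2)⁻¹ • ((f γ - 1) * (f ν * E s hs)) +
      (((γ : ℂ) ^ 2)⁻¹ - 1) • (f ν * E s hs) := by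
  have hγ := γ.ne_zero
  have h : f γ * (f ν * E s hs) = (γ : ℂ) ^ 2 • (f ν * E s hs * f γ) := by
    rw [← mul_assoc, f_mul_f, mul_comm γ, ← f_mul_f, mul_assoc, f_mul_E, mul_smul_comm, mul_assoc]
  rw [sub_mul, h, mul_sub, one_mul, mul_one, smul_sub, smul_smul,
    inv_mul_cancel₀ (pow_ne_zero 2 hγ), one_smul]
  module

theorem f_mul_E_mul_F_mul_f (hq : ∀ n : ℕ, 0 < n → q ^ n ≠ 1) {s : ℂˣ} (hs : s ^ 2 = q)
    (μ ν : ℂˣ) : (f ν * E s hs) * (F s hs * f μ) =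
      (((μ : ℂ) * ν) ^ 2)⁻¹ • ((F s hs * f μ) * (f ν * E s hs)) +
      ((q : ℂ) - (q : ℂ)⁻¹)⁻¹ • (f (μ * ν * q) - f (μ * ν * q⁻¹)) := by
  have hμ := μ.ne_zero
  have hν := ν.ne_zero
  have h1 : (F s hs * f μ) * (f ν * E s hs) =
      (((μ : ℂ) * ν) ^ 2) • (f ν * (F s hs * E s hs) * f μ) := by
    rw [mul_assoc (F s hs), ← mul_assoc (f μ), f_mul_f, mul_comm μ, ← f_mul_f, mul_assoc (f ν),
      f_mul_E, ← mul_assoc (f ν) (F s hs), f_mul_F]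
    simp only [smul_mul_assoc, mul_smul_comm, smul_smul, mul_assoc]
    congr 1
    field_simp
  rw [h1, smul_smul, inv_mul_cancel₀ (by positivity), one_smul, mul_assoc, ← mul_assoc (E s hs),
    E_mul_F_sub s hs (sq_ne_one hq), ← mul_assoc, mul_add, add_mul]
  congr 1
  simp only [smul_mul_assoc, mul_smul_comm, mul_sub, sub_mul, f_mul_f]
  rw [mul_comm (ν * q), mul_comm (ν * q⁻¹), ← mul_assoc, ← mul_assoc]

/-- Binomial expansion of (1 + X₂)^m; the bound on m keeps the result within the quadratic span. -/
theorem f_pow_eq (γ : ℂˣ) {m : ℕ} (hm : m ≤ 2) : f (q := q) (γ ^ m) =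
    1 + (m : ℂ) • (f γ - 1) + (m.choose 2 : ℂ) • ((f γ - 1) * (f γ - 1)) := by
  interval_cases m
  · simp [f_one]
  · simp
  · rw [sq, ← f_mul_f]
    simp only [sub_mul, mul_sub, one_mul, mul_one, Nat.choose_self, Nat.cast_one, Nat.cast_ofNat]
    module

theorem convAct_f_sub_one_of_mem {m : ℤ} {x : OSLq2 q} (hx : x ∈ weightSpace colScale m) (γ : ℂˣ) :
    convAct (f γ - 1) x = ((γ : ℂ) ^ m - 1) • x := by
  rw [convAct_sub, convAct_one, LinearMap.sub_apply, convAct_f_of_mem hx, sub_smul, one_smul]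
  rfl

theorem hasDegree_f_sub_one (γ : ℂˣ) : HasDegree (f (q := q) γ - 1) 0 := by
  rw [sub_eq_add_neg, ← neg_one_smul ℂ]
  exact (hasDegree_f γ).add (hasDegree_one.smul _)

theorem smul_functional_apply (t : ℂ) (Y : Functional q) (x : OSLq2 q) : (t • Y) x = t * Y x := rfl

theorem one_functional_apply (x : OSLq2 q) :
    (1 : Functional q) x = Coalgebra.counit (R := ℂ) x := by
  rw [← counit_convAct, convAct_one, Module.End.one_apply]

theorem sub_one_apply (Y : Functional q) (x : OSLq2 q) :
    (Y - 1 : Functional q) x = Y x - Coalgebra.counit (R := ℂ) x := by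
  rw [← one_functional_apply]
  rfl

theorem f_apply_of_eq {s γ ρ : ℂˣ} {t : ℂ} (h : ρ = s ∧ t = 0 ∨ ρ = s * γ ∧ t = 1) (x : OSLq2 q) :
    f (s⁻¹ * ρ) x = Coalgebra.counit (R := ℂ) x + t * (f γ - 1 : Functional q) x := by
  rw [sub_one_apply]
  rcases h with ⟨rfl, rfl⟩ | ⟨rfl, rfl⟩
  · rw [inv_mul_cancel, f_one, zero_mul, add_zero, one_functional_apply]
  · rw [inv_mul_cancel_left]
    ring

theorem zpow_one_ne_zpow_two {γ : ℂˣ} (hγ : ∀ m : ℤ, (γ : ℂ) ^ m = 1 → m = 0) :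
    (γ : ℂ) ^ (1 : ℤ) ≠ (γ : ℂ) ^ (2 : ℤ) := fun h ↦ by
  have h2 : (γ : ℂ) ^ (2 : ℤ) = (γ : ℂ) ^ (1 : ℤ) * (γ : ℂ) ^ (1 : ℤ) := by
    rw [← zpow_add₀ γ.ne_zero]
    rfl
  refine one_ne_zero (hγ 1 (mul_left_cancel₀ (zpow_ne_zero 1 γ.ne_zero) ?_))
  rw [mul_one, ← h2, h]

/-- The choice μ, ν ∈ {s, sγ} makes f_{s⁻¹μ} and f_{s⁻¹ν} equal to 1 or 1 + X₂, so the coproducts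
close up; p and r record which. The commutator of E and F produces f_{γ^m} - f_{γ^n}, whose linear
and quadratic parts in X₂ are σ and τ. -/
theorem isKoszulTangent_diagonal (hq : ∀ n : ℕ, 0 < n → q ^ n ≠ 1) {s : ℂˣ} (hs : s ^ 2 = q)
    {μ ν γ : ℂˣ} (hγ : ∀ m : ℤ, (γ : ℂ) ^ m = 1 → m = 0) {p r : ℂ}
    (hμ : μ = s ∧ p = 0 ∨ μ = s * γ ∧ p = 1) (hν : ν = s ∧ r = 0 ∨ ν = s * γ ∧ r = 1)
    {m n : ℕ} (hm : m ≤ 2) (hn : n ≤ 2) (hμm : μ * ν * q = γ ^ m) (hμn : μ * ν * q⁻¹ = γ ^ n) :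
    IsKoszulTangent ![F s hs * f μ, f ν * E s hs, f γ - 1]
      ![![f (s * μ), 0, 0], ![0, f (s * ν), 0], ![p • (F s hs * f μ), r • (f ν * E s hs), f γ]]
      ((γ : ℂ) ^ 2)⁻¹ (((γ : ℂ) ^ 2)⁻¹ - 1) (((μ : ℂ) * ν) ^ 2)⁻¹
      (((q : ℂ) - (q : ℂ)⁻¹)⁻¹ * ((m.choose 2 : ℂ) - n.choose 2))
      (((q : ℂ) - (q : ℂ)⁻¹)⁻¹ * ((m : ℂ) - n)) := by
  refine IsKoszulTangent.of_three (inv_ne_zero (pow_ne_zero 2 γ.ne_zero)) ?_ ?_ ?_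
    (fun x y ↦ ?_) (fun x y ↦ ?_) (fun x y ↦ ?_) (sub_one_mul_F_mul_f hs μ γ)
    (f_mul_E_mul_sub_one hs ν γ) ?_ ?_
  · simp [← counit_convAct, convAct_comp, convAct_f_one, convAct_F_one]
  · simp [← counit_convAct, convAct_comp, convAct_f_one, convAct_E_one]
  · simp [← counit_convAct, convAct_sub, convAct_f_one, convAct_one]
  · rw [F_mul_f_apply_mul hs μ x y, f_apply_of_eq hμ]
    change _ = _ + (_ * f (s * μ) y + _ * 0 + _ * (p • (F s hs * f μ) : Functional q) y)
    rw [smul_functional_apply]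
    ring
  · rw [f_mul_E_apply_mul hs ν x y, f_apply_of_eq hν]
    change _ = _ + (_ * 0 + _ * f (s * ν) y + _ * (r • (f ν * E s hs) : Functional q) y)
    rw [smul_functional_apply]
    ring
  · change _ = _ + (_ * 0 + _ * 0 + _ * f γ y)
    simp only [sub_one_apply, f_apply_mul, Bialgebra.counit_mul]
    ring
  · refine (f_mul_E_mul_F_mul_f hq hs μ ν).trans ?_
    rw [hμm, hμn, f_pow_eq γ hm, f_pow_eq γ hn]
    module
  · refine linearIndependent_quadraticMonomials hq hs μ ν rfl rfl (hasDegree_f_sub_one γ)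
      (g := fun m : ℤ ↦ (γ : ℂ) ^ m - 1) (fun _ _ hx _ ↦ convAct_f_sub_one_of_mem hx γ)
      (fun h ↦ ?_) (fun h ↦ ?_) (fun h ↦ ?_) (inv_ne_zero (pow_ne_zero 2 γ.ne_zero)) (f_mul_E_mul_sub_one hs ν γ)
    · exact one_ne_zero (hγ 1 (sub_eq_zero.mp h))
    · exact two_ne_zero (hγ 2 (sub_eq_zero.mp h))
    · exact zpow_one_ne_zpow_two hγ (sub_left_injective h)

end OSLq2

theorem span_range_sup_span_singleton {R M : Type*} [Ring R] [AddCommGroup M] [Module R M]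
    (x y z w : M) (t : R) : Submodule.span R (Set.range ![x, y, z - t • w]) ⊔ Submodule.span R {w} =
      Submodule.span R {x, y, z, w} := by
  have hr : Set.range ![x, y, z - t • w] = {x, y, z - t • w} := by
    ext v
    simp only [Set.mem_range, Fin.exists_fin_succ, Set.mem_insert_iff, Set.mem_singleton_iff,
      @eq_comm _ v]
    simp
  rw [hr, ← Submodule.span_union]
  have m {v : M} {S : Set M} (h : v ∈ S) : v ∈ Submodule.span R S := Submodule.subset_span h
  apply le_antisymm <;> rw [Submodule.span_le]
  · rintro v ((rfl | rfl | rfl) | rfl)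
    · exact m (by simp)
    · exact m (by simp)
    · exact sub_mem (m (by simp)) (Submodule.smul_mem _ _ (m (by simp)))
    · exact m (by simp)
  · rintro v (rfl | rfl | rfl | rfl)
    · exact m (by simp)
    · exact m (by simp)
    · rw [← sub_add_cancel v (t • w)]
      exact add_mem (m (by simp)) (Submodule.smul_mem _ _ (m (by simp)))
    · exact m (by simp)

namespace OSLq2

variable {q : ℂˣ}

/-- Stated for γ² so that the calculi involving ε₋, where γ is minus a power of s, are covered. -/
theorem zpow_eq_one_of_sq (hq : ∀ n : ℕ, 0 < n → q ^ n ≠ 1) {γ : ℂˣ} {j : ℤ} (hj : j ≠ 0)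
    (h : γ ^ 2 = q ^ j) (m : ℤ) (hm : (γ : ℂ) ^ m = 1) : m = 0 := by
  have h1 : (q : ℂ) ^ (j * m) = (q : ℂ) ^ (0 : ℤ) := by
    have h2 : ((γ : ℂ) ^ 2) ^ m = ((q : ℂ) ^ j) ^ m := by
      have := congrArg (fun x : ℂˣ ↦ ((x ^ m : ℂˣ) : ℂ)) h
      simpa using this
    rw [zpow_mul, ← h2, ← zpow_natCast, ← zpow_mul, mul_comm, zpow_mul, hm, one_zpow, zpow_zero]
  exact (mul_eq_zero.mp (zpow_injective hq h1)).resolve_left hj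

section

variable {Γ : Type*} [AddCommGroup Γ] [Module ℂ Γ] [Module (OSLq2 q) Γ] [Module (OSLq2 q)ᵐᵒᵖ Γ]
  [IsScalarTower ℂ (OSLq2 q) Γ] [IsScalarTower ℂ (OSLq2 q)ᵐᵒᵖ Γ]
  [SMulCommClass (OSLq2 q) (OSLq2 q)ᵐᵒᵖ Γ] {C : FODC ℂ (OSLq2 q) Γ}

theorem deRham_diagonal (hq : ∀ n : ℕ, 0 < n → q ^ n ≠ 1) {s : ℂˣ} (hs : s ^ 2 = q)
    (hC : C.IsLeftCovariant) {μ ν γ : ℂˣ} {j : ℤ} (hj : j ≠ 0) (hγ : γ ^ 2 = q ^ j)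
    (hμ : μ = s ∨ μ = s * γ) (hν : ν = s ∨ ν = s * γ) {m n : ℕ} (hm : m ≤ 2) (hn : n ≤ 2)
    (hmn : m ≠ n) (hμm : μ * ν * q = γ ^ m) (hμn : μ * ν * q⁻¹ = γ ^ n)
    (hX : C.tangentCoideal = Submodule.span ℂ {F s hs * f μ, f ν * E s hs, f γ, 1}) :
    (∀ n : ℕ, 3 < n → C.forms n = ⊥) ∧ Nonempty (C.Cohomology 0 ≃ₗ[ℂ] ℂ) ∧
      Subsingleton (C.Cohomology 1) ∧ Subsingleton (C.Cohomology 2) ∧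
      Nonempty (C.Cohomology 3 ≃ₗ[ℂ] ℂ) := by
  have hγ' := zpow_eq_one_of_sq hq hj hγ
  have ex {ρ : ℂˣ} (h : ρ = s ∨ ρ = s * γ) : ∃ t : ℂ, ρ = s ∧ t = 0 ∨ ρ = s * γ ∧ t = 1 := by
    rcases h with h | h
    · exact ⟨0, Or.inl ⟨h, rfl⟩⟩
    · exact ⟨1, Or.inr ⟨h, rfl⟩⟩
  obtain ⟨p, hp⟩ := ex hμ
  obtain ⟨r, hr⟩ := ex hν
  -- This makes σ = (m - n)/(q - q⁻¹) nonzero.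
  have hmn' : (m : ℂ) - n ≠ 0 := sub_ne_zero.mpr (by exact_mod_cast hmn)
  refine FODC.deRham_of_tangentCoideal
    (isKoszulTangent_diagonal hq hs hγ' hp hr hm hn hμm hμn)
    (hasTrivialKoszulCohomology hq s hs μ ν γ hγ'
      (mul_ne_zero (inv_ne_zero (sub_inv_ne_zero hq)) hmn')) hC ?_
  rw [hX, ← span_range_sup_span_singleton _ _ _ _ 1, one_smul]

theorem F_mul_E_apply_mul {s : ℂˣ} (hs : s ^ 2 = q) (x y : OSLq2 q) :
    ((F s hs * f s) * (f s * E s hs) : Functional q) (x * y) =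
      Coalgebra.counit (R := ℂ) x * ((F s hs * f s) * (f s * E s hs) : Functional q) y +
      ((F s hs * f s : Functional q) x * (f (s ^ 2) * (f s * E s hs) : Functional q) y +
      (f s * E s hs : Functional q) x * (F s hs * f s * f (s ^ 2) : Functional q) y +
      ((F s hs * f s) * (f s * E s hs) : Functional q) x * f (s ^ 4) y) := by
  have h1 (x : OSLq2 q) : convAct (f (s * (s * s⁻¹))) x = convAct (f s) x := by
    rw [mul_inv_cancel, mul_one]
  have h2 (x : OSLq2 q) : convAct (f (s⁻¹ * s)) x = x := by
    rw [inv_mul_cancel, f_one, convAct_one]; rfl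
  have h3 (x : OSLq2 q) : convAct (f (s⁻¹ * (s * (s * s⁻¹)))) x = x := by
    rw [mul_inv_cancel, mul_one, h2]
  have h4 : s ^ 4 = s * (s * (s * s)) := by simp only [pow_succ, pow_zero, one_mul, mul_assoc]
  simp only [← counit_convAct, convAct_comp, Module.End.mul_apply, convAct_f_mul, convAct_E_mul,
    convAct_F_mul, map_add, Bialgebra.counit_mul, convAct_f_convAct_f, h1, h2, h3, h4, sq,
    inv_mul_cancel_left, mul_assoc s s s]
  ring

/-- By `hασ`, f_{s⁴} - 1 can be eliminated from the relation for X₁X₀ in favour of X₂, which changes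
its coefficient from α to α'. Conversely α takes the place of α' in the two relations with X₂. -/
theorem isKoszulTangent_threeD (hq : ∀ n : ℕ, 0 < n → q ^ n ≠ 1) {s : ℂˣ} (hs : s ^ 2 = q)
    (hγ : ∀ m : ℤ, ((s ^ 4 : ℂˣ) : ℂ) ^ m = 1 → m = 0) {c α α' σ' : ℂ} (hα : α ≠ 0) (hc : c ≠ 0)
    (hασ : c * (α - α') = σ')
    (r0 : (f (s ^ 4) - 1) * (F s hs * f s) = α' • (F s hs * f s * (f (s ^ 4) - 1)) +
      (α' - 1) • (F s hs * f s))
    (r1 : (f s * E s hs) * (f (s ^ 4) - 1) = α' • ((f (s ^ 4) - 1) * (f s * E s hs)) +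
      (α' - 1) • (f s * E s hs))
    (r2 : (f s * E s hs) * (F s hs * f s) = α • ((F s hs * f s) * (f s * E s hs)) +
      σ' • (f (s ^ 4) - 1)) :
    IsKoszulTangent
      ![F s hs * f s, f s * E s hs, (F s hs * f s) * (f s * E s hs) + c • (f (s ^ 4) - 1)]
      ![![f (s ^ 2), 0, f (s ^ 2) * (f s * E s hs)], ![0, f (s ^ 2), F s hs * f s * f (s ^ 2)],
        ![0, 0, f (s ^ 4)]]
      α (c * (α' - 1)) α' 0 (α - α') := by
  have hf (x : OSLq2 q) : f (s⁻¹ * s) x = Coalgebra.counit (R := ℂ) x := by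
    rw [inv_mul_cancel, f_one, one_functional_apply]
  have r1' : (f s * E s hs) * ((F s hs * f s) * (f s * E s hs) + c • (f (s ^ 4) - 1)) =
      α • (((F s hs * f s) * (f s * E s hs) + c • (f (s ^ 4) - 1)) * (f s * E s hs)) +
        (c * (α' - 1)) • (f s * E s hs) := by
    subst hασ
    rw [mul_add, ← mul_assoc, r2, mul_smul_comm, r1]
    simp only [add_mul, smul_mul_assoc]
    module
  refine IsKoszulTangent.of_three hα ?_ ?_ ?_ (fun x y ↦ ?_) (fun x y ↦ ?_) (fun x y ↦ ?_)
    ?_ r1' ?_ ?_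
  · simp [← counit_convAct, convAct_comp, convAct_f_one, convAct_F_one]
  · simp [← counit_convAct, convAct_comp, convAct_f_one, convAct_E_one]
  · simp [← counit_convAct, convAct_comp, convAct_sub, convAct_add, convAct_smul, convAct_f_one,
      convAct_one, convAct_E_one]
  · rw [F_mul_f_apply_mul hs s x y, hf]
    change _ = _ + (_ * f (s ^ 2) y + _ * 0 + _ * 0)
    rw [sq]
    ring
  · rw [f_mul_E_apply_mul hs s x y, hf]
    change _ = _ + (_ * 0 + _ * f (s ^ 2) y + _ * 0)
    rw [sq]
    ring
  · change ((F s hs * f s) * (f s * E s hs) : Functional q) (x * y) +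
      (c • (f (s ^ 4) - 1) : Functional q) (x * y) =
      _ * (((F s hs * f s) * (f s * E s hs) : Functional q) y +
      (c • (f (s ^ 4) - 1) : Functional q) y) +
      (_ * (f (s ^ 2) * (f s * E s hs) : Functional q) y +
        _ * (F s hs * f s * f (s ^ 2) : Functional q) y +
      (((F s hs * f s) * (f s * E s hs) : Functional q) x +
      (c • (f (s ^ 4) - 1) : Functional q) x) * f (s ^ 4) y)
    rw [F_mul_E_apply_mul]
    simp only [smul_functional_apply, sub_one_apply, f_apply_mul, Bialgebra.counit_mul]
    ring
  · subst hασ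
    rw [add_mul, mul_assoc, r2, smul_mul_assoc, r0]
    simp only [mul_add, mul_smul_comm]
    module
  · rw [r2, ← hασ]
    module
  · refine linearIndependent_quadraticMonomials hq hs s s rfl rfl
      (g := fun m : ℤ ↦ c * (((s ^ 4 : ℂˣ) : ℂ) ^ m - 1))
      (.add (((hasDegree_F s hs).mul (hasDegree_f s) rfl).mul
        ((hasDegree_f s).mul (hasDegree_E s hs) rfl) (by norm_num))
        ((hasDegree_f_sub_one _).smul c)) (fun _ x hx hE ↦ ?_) (fun h ↦ ?_) (fun h ↦ ?_)
      (fun h ↦ ?_) hα r1'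
    · change convAct ((F s hs * f s) * (f s * E s hs) + c • (f (s ^ 4) - 1)) x = _
      rw [convAct_add, convAct_smul, LinearMap.add_apply, LinearMap.smul_apply,
        convAct_f_sub_one_of_mem hx, convAct_comp, convAct_comp (f s), Module.End.mul_apply,
        Module.End.mul_apply, hE, map_zero, map_zero, zero_add, smul_smul]
    · exact one_ne_zero (hγ 1 (sub_eq_zero.mp ((mul_eq_zero.mp h).resolve_left hc)))
    · exact two_ne_zero (hγ 2 (sub_eq_zero.mp ((mul_eq_zero.mp h).resolve_left hc)))
    · exact zpow_one_ne_zpow_two hγ (sub_left_injective (mul_left_cancel₀ hc h))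

theorem deRham_threeD (hq : ∀ n : ℕ, 0 < n → q ^ n ≠ 1) {s : ℂˣ} (hs : s ^ 2 = q)
    (hC : C.IsLeftCovariant) (hX : C.tangentCoideal = coideal s hs 0) :
    (∀ n : ℕ, 3 < n → C.forms n = ⊥) ∧ Nonempty (C.Cohomology 0 ≃ₗ[ℂ] ℂ) ∧
      Subsingleton (C.Cohomology 1) ∧ Subsingleton (C.Cohomology 2) ∧
      Nonempty (C.Cohomology 3 ≃ₗ[ℂ] ℂ) := by
  have hq0 := q.ne_zero
  have hs0 := s.ne_zero
  have hqs : (q : ℂ) = (s : ℂ) ^ 2 := by rw [← hs]; rfl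
  have hq2 : (q : ℂ) ^ 2 - 1 ≠ 0 := sub_ne_zero.mpr (sq_ne_one hq)
  have hγ := zpow_eq_one_of_sq hq (γ := s ^ 4) (j := 4) (by norm_num)
    (by rw [← hs, ← pow_mul, ← zpow_natCast s 2, ← zpow_mul, ← zpow_natCast]; norm_num)
  set c : ℂ := (q : ℂ) ^ 5 / ((q : ℂ) ^ 2 - 1) ^ 2 with hc
  have hc0 : c ≠ 0 := div_ne_zero (pow_ne_zero 5 hq0) (pow_ne_zero 2 hq2)
  have hα0 : (((s : ℂ) * s) ^ 2)⁻¹ ≠ 0 := by positivity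
  have hα0' : (((s ^ 4 : ℂˣ) : ℂ) ^ 2)⁻¹ ≠ 0 := inv_ne_zero (pow_ne_zero 2 (Units.ne_zero _))
  have hσ0 : ((q : ℂ) - (q : ℂ)⁻¹)⁻¹ ≠ 0 := inv_ne_zero (sub_inv_ne_zero hq)
  -- Here α = q⁻² and α' = q⁻⁴; this equation is what singles out c = q⁵/(q² - 1)².
  have hασ : c * ((((s : ℂ) * s) ^ 2)⁻¹ - (((s ^ 4 : ℂˣ) : ℂ) ^ 2)⁻¹) =
      ((q : ℂ) - (q : ℂ)⁻¹)⁻¹ := by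
    have e1 : ((s : ℂ) * s) ^ 2 = (q : ℂ) ^ 2 := by rw [hqs]; ring
    have e2 : ((s ^ 4 : ℂˣ) : ℂ) ^ 2 = (q : ℂ) ^ 4 := by rw [hqs]; push_cast; ring
    have e3 : ((q : ℂ) - (q : ℂ)⁻¹) = ((q : ℂ) ^ 2 - 1) / q := by field_simp
    rw [e1, e2, e3, hc]
    field_simp
  have r2 : (f s * E s hs) * (F s hs * f s) =
      (((s : ℂ) * s) ^ 2)⁻¹ • ((F s hs * f s) * (f s * E s hs)) +
      ((q : ℂ) - (q : ℂ)⁻¹)⁻¹ • (f (s ^ 4) - 1) := by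
    rw [f_mul_E_mul_F_mul_f hq hs, ← f_one, show s * s * q = s ^ 4 by rw [← hs]; group,
      show s * s * q⁻¹ = 1 by rw [← hs]; group]
  have H : HasTrivialKoszulCohomology (convAct (F s hs * f s)) (convAct (f s * E s hs))
      (convAct ((F s hs * f s) * (f s * E s hs) + c • (f (s ^ 4) - 1))) (((s : ℂ) * s) ^ 2)⁻¹
      (c * ((((s ^ 4 : ℂˣ) : ℂ) ^ 2)⁻¹ - 1)) (((s ^ 4 : ℂˣ) : ℂ) ^ 2)⁻¹ 0
      ((((s : ℂ) * s) ^ 2)⁻¹ - (((s ^ 4 : ℂˣ) : ℂ) ^ 2)⁻¹) 1 := by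
    refine (hasTrivialKoszulCohomology hq s hs s s _ hγ (τ := 0) hσ0).change_generator (fun a ↦ ?_)
      (fun a ↦ ?_) hα0 hα0' hc0 (by rw [← hασ, mul_comm]) rfl (add_sub_cancel _ _) rfl
    · rw [convAct_add, convAct_smul, convAct_comp (F s hs * f s)]
      rfl
    · have := congrArg (fun Y : Functional q ↦ convAct Y a) r2
      simpa only [convAct_add, convAct_smul, convAct_comp (F s hs * f s),
        convAct_comp (f s * E s hs), LinearMap.add_apply, LinearMap.smul_apply,
        Module.End.mul_apply] using this
  refine FODC.deRham_of_tangentCoideal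
    (isKoszulTangent_threeD hq hs hγ hα0 hc0 hασ (sub_one_mul_F_mul_f hs s _)
      (f_mul_E_mul_sub_one hs s _) r2) H hC ?_
  rw [hX]
  have e : (F s hs * f s) * (f s * E s hs) + c • (f (s ^ 4) - 1) =
      ((F s hs * f s) * (f s * E s hs) + c • f (s ^ 4)) - c • (1 : Functional q) := by
    module
  rw [e, span_range_sup_span_singleton]
  have e' : F s hs * K s 2 * E s hs + c • K s 4 =
      (F s hs * f s) * (f s * E s hs) + c • f (s ^ 4) := by
    simp only [K]
    rw [mul_assoc (F s hs) (f s), ← mul_assoc (f s), f_mul_f, ← mul_assoc,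
      show s * s = s ^ (2 : ℤ) from (sq s).symm, show s ^ 4 = s ^ (4 : ℤ) by rfl]
  change Submodule.span ℂ {F s hs * K s 2 * E s hs + c • K s 4, F s hs * K s 1, K s 1 * E s hs,
    1} = _
  rw [e', K, zpow_one, Set.insert_comm, Set.insert_comm _ (f s * E s hs)]

end

end OSLq2

/-! ### The eleven calculi -/

theorem mainTheorem3 (q s : ℂˣ) (hs : s ^ 2 = q) (hq : ∀ n : ℕ, 0 < n → q ^ n ≠ 1)
    {Γ : Type*} [AddCommGroup Γ] [Module ℂ Γ] [Module (OSLq2 q) Γ] [Module (OSLq2 q)ᵐᵒᵖ Γ]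
    [IsScalarTower ℂ (OSLq2 q) Γ] [IsScalarTower ℂ (OSLq2 q)ᵐᵒᵖ Γ]
    [SMulCommClass (OSLq2 q) (OSLq2 q)ᵐᵒᵖ Γ]
    (C : FODC ℂ (OSLq2 q) Γ) (hC : C.IsLeftCovariant)
    (i : Fin 11) (hi : C.tangentCoideal = OSLq2.coideal s hs i) :
    (∀ n : ℕ, 3 < n → C.forms n = ⊥) ∧
      Nonempty (C.Cohomology 0 ≃ₗ[ℂ] ℂ) ∧
      Subsingleton (C.Cohomology 1) ∧
      Subsingleton (C.Cohomology 2) ∧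
      Nonempty (C.Cohomology 3 ≃ₗ[ℂ] ℂ) := by
  subst hs
  -- All cases but the first are given by characters μ, ν, γ, with exponents read off from μνq =
  -- γ^m, μνq⁻¹ = γ^n and γ² = q^j.
  have diagonal (μ ν γ : ℂˣ) (m n : ℕ) (j : ℤ) (hX : OSLq2.coideal s rfl i =
        Submodule.span ℂ {OSLq2.F s rfl * OSLq2.f μ, OSLq2.f ν * OSLq2.E s rfl, OSLq2.f γ, 1})
      (hμ : μ = s ∨ μ = s * γ) (hν : ν = s ∨ ν = s * γ) (hj : j ≠ 0) (hm : m ≤ 2) (hn : n ≤ 2)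
      (hmn : m ≠ n) (hγ : γ ^ 2 = (s ^ 2) ^ j) (hμm : μ * ν * s ^ 2 = γ ^ m)
      (hμn : μ * ν * (s ^ 2)⁻¹ = γ ^ n) :=
    OSLq2.deRham_diagonal hq rfl hC hj hγ hμ hν hm hn hmn hμm hμn (hi.trans hX)
  have one : s ^ (1 : ℤ) = s := zpow_one s
  fin_cases i
  · exact OSLq2.deRham_threeD hq rfl hC hi
  · apply diagonal (s ^ (5 : ℤ)) (s ^ (1 : ℤ)) (s ^ (4 : ℤ)) 2 1 4 rfl (.inr (by group)) (.inl one)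
      <;> first | (norm_num; done) | group
  · apply diagonal (s ^ (-3 : ℤ)) (s ^ (1 : ℤ)) (s ^ (-4 : ℤ)) 0 1 (-4) rfl (.inr (by group))
      (.inl one) <;> first | (norm_num; done) | group
  · apply diagonal (s ^ (-1 : ℤ)) (s ^ (-1 : ℤ)) (s ^ (-2 : ℤ)) 0 2 (-2) rfl (.inr (by group))
      (.inr (by group)) <;> first | (norm_num; done) | group
  -- The factor ε₋ = f₋₁ is absorbed into the characters.
  · have hX : OSLq2.coideal s rfl 4 = Submodule.span ℂ {OSLq2.F s rfl * OSLq2.f (-1 * s ^ (-1 : ℤ)),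
        OSLq2.f (-1 * s ^ (-1 : ℤ)) * OSLq2.E s rfl, OSLq2.f (-1 * s ^ (-2 : ℤ)), 1} := by
      simp only [← OSLq2.f_mul_f, ← mul_assoc]
      rfl
    apply diagonal _ _ _ 0 2 (-2) hX (.inr ?_) (.inr ?_)
    all_goals first | (norm_num; done) | (simp; group)
  · apply diagonal (s ^ (-3 : ℤ)) (s ^ (-3 : ℤ)) (s ^ (-4 : ℤ)) 1 2 (-4) rfl (.inr (by group))
      (.inr (by group)) <;> first | (norm_num; done) | group
  · apply diagonal (s ^ (1 : ℤ)) (s ^ (5 : ℤ)) (s ^ (4 : ℤ)) 2 1 4 rfl (.inl one) (.inr (by group))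
      <;> first | (norm_num; done) | group
  · apply diagonal (s ^ (1 : ℤ)) (s ^ (-3 : ℤ)) (s ^ (-4 : ℤ)) 0 1 (-4) rfl (.inl one)
      (.inr (by group)) <;> first | (norm_num; done) | group
  · apply diagonal (s ^ (1 : ℤ)) (s ^ (1 : ℤ)) (s ^ (4 : ℤ)) 1 0 4 rfl (.inl one) (.inl one)
      <;> first | (norm_num; done) | group
  · apply diagonal (s ^ (1 : ℤ)) (s ^ (1 : ℤ)) (s ^ (2 : ℤ)) 2 0 2 rfl (.inl one) (.inl one)
      <;> first | (norm_num; done) | group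
  · have hX : OSLq2.coideal s rfl 10 = Submodule.span ℂ {OSLq2.F s rfl * OSLq2.f (s ^ (1 : ℤ)),
        OSLq2.f (s ^ (1 : ℤ)) * OSLq2.E s rfl, OSLq2.f (-1 * s ^ (2 : ℤ)), 1} := by
      rw [← OSLq2.f_mul_f]
      rfl
    apply diagonal _ _ _ 2 0 2 hX (.inl one) (.inl one)
    all_goals first | (norm_num; done) | (simp; group)
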